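/- Let $n\in\{1,2,3\}$, $\mu,\sigma>0$ and $\omega>\max\{-1,-\mu/(3\sigma)\}$. Let $P,Q\in H^1(\mathbf R^n)$ be real-valued and satisfy (in the sense of distributions) $$-\Delta P+(\omega+1)P-\Big[\tfrac19P^3+2Q^2P+\tfrac13P^2Q\Big]=0,\qquad -\Delta Q+(\mu+3\sigma\omega)Q-\Big[9Q^3+2P^2Q+\tfrac19P^3\Big]=0,$$ so that $(e^{i\omega t}P,e^{3i\omega t}Q)$ is a standing wave of $$iu_t+\Delta u-u+\big(\tfrac19|u|^2+2|v|^2\big)u+\tfrac13\bar u^2v=0,\qquad i\sigma v_t+\Delta v-\mu v+\big(9|v|^2+2|u|^2\big)v+\tfrac19u^3=0 .$$ Put $$\mathcal L_1=-\Delta+(\omega+1)-\big(\tfrac{P^2}{3}+2Q^2+\tfrac23PQ\big),\quad \mathcal L_2=-\Delta+(\omega+1)-\big(\tfrac{P^2}{9}+2Q^2-\tfrac23PQ\big),$$ $$\mathcal L_3=-\Delta+(\mu+3\sigma\omega)-(27Q^2+2P^2),\quad \mathcal L_4=-\Delta+(\mu+3\sigma\omega)-(9Q^2+2P^2),$$ $A=-4PQ-\tfrac{P^2}{3}$,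 $B=-\tfrac{P^2}{3}$, and, with domain $H^2(\mathbf R^n;\mathbf C)^2$, $$\mathcal L_+=\begin{pmatrix}\mathcal L_1&A\\A&\mathcal L_3\end{pmatrix},\qquad \mathcal L_-=\begin{pmatrix}\mathcal L_2&B\\B&\mathcal L_4\end{pmatrix}.$$ Let $$\mathcal J=\begin{pmatrix}0&0&1&0\\0&0&0&\frac1\sigma\\-1&0&0&0\\0&-\frac1\sigma&0&0\end{pmatrix},\qquad \mathcal L=\begin{pmatrix}\mathcal L_+&0\\0&\mathcal L_-\end{pmatrix}.$$ The wave is called spectrally stable if $\mathcal J\mathcal L\vec v=\lambda\vec v$ has no solution with $\Re\lambda>0$ and $0\ne\vec v\in H^2(\mathbf R^n;\mathbf C)^4$, and spectrally unstable otherwise. Assume that either $P>0$ and $Q>0$ almost everywhere, or $\mathcal L_-\ge0$, i.e. $\langle\mathcal L_-h,h\rangle\ge0$ for all $h\in H^2(\mathbf R^n;\mathbf C)^2$. Then the wave is spectrally unstable if and only if there is $h\in H^2(\mathbf R^n;\mathbf C)^2$ with $h\perp\begin{pmatrix}P\\3\sigma Q\end{pmatrix}$ in $L^2$ and $\langle\mathcal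 L_+h,h\rangle<0$. Equivalently, the wave is spectrally stable if and only if $\langle\mathcal L_+h,h\rangle\ge0$ for all $h\in H^2(\mathbf R^n;\mathbf C)^2$ with $h\perp\begin{pmatrix}P\\3\sigma Q\end{pmatrix}$. -/

import Mathlib

open MeasureTheory Matrix
open scoped SchwartzMap Laplacian ComplexConjugate

namespace ThirdHarmonic

noncomputable section

/-- The Euclidean space `ℝⁿ`. -/
abbrev E (n : ℕ) : Type := EuclideanSpace ℝ (Fin n)

/-- The complex Hilbert space `L²(ℝⁿ)`. -/
abbrev L2 (n : ℕ) : Type := Lp ℂ 2 (volume : Measure (E n))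

/-- The Sobolev space `H²(ℝⁿ)`, as a subspace of `L²(ℝⁿ)`. -/
def H2 (n : ℕ) : Submodule ℂ (L2 n) where
  carrier := {u | TemperedDistribution.MemSobolev 2 2 (u : 𝓢'(E n, ℂ))}
  zero_mem' := by
    have h := TemperedDistribution.memSobolev_fun_zero (E n) ℂ 2 2
    have h0 : ((0 : L2 n) : 𝓢'(E n, ℂ)) = 0 := by
      rw [← Lp.toTemperedDistributionCLM_apply, map_zero]
    simpa only [Set.mem_ofPred_eq, h0] using h
  add_mem' := by
    intro u v hu hv
    have h0 : ((u + v : L2 n) : 𝓢'(E n, ℂ)) = (u : 𝓢'(E n, ℂ)) + (v : 𝓢'(E n, ℂ)) := by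
      simp only [← Lp.toTemperedDistributionCLM_apply, map_add]
    simpa only [Set.mem_ofPred_eq, h0] using
      TemperedDistribution.MemSobolev.add (show _ from hu) (show _ from hv)
  smul_mem' := by
    intro c u hu
    have h0 : ((c • u : L2 n) : 𝓢'(E n, ℂ)) = c • (u : 𝓢'(E n, ℂ)) := by
      simp only [← Lp.toTemperedDistributionCLM_apply, map_smul]
    simpa only [Set.mem_ofPred_eq, h0] using
      TemperedDistribution.MemSobolev.smul c (show _ from hu)

/-- A real-valued function belongs to `H¹(ℝⁿ)`. -/
def MemH1 {n : ℕ} (f : E n → ℝ) : Prop :=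
  ∃ hf : MemLp (fun x => (f x : ℂ)) 2 volume,
    TemperedDistribution.MemSobolev 1 2 ((hf.toLp _ : L2 n) : 𝓢'(E n, ℂ))

theorem exists_laplacian {n : ℕ} (u : H2 n) :
    ∃ g : L2 n, Δ ((u : L2 n) : 𝓢'(E n, ℂ)) = (g : 𝓢'(E n, ℂ)) := by
  have h := TemperedDistribution.MemSobolev.laplacian (s := 2) (show _ from u.2)
  rw [sub_self] at h
  exact TemperedDistribution.memSobolev_zero_iff.mp h

/-- The Laplacian `Δ : H²(ℝⁿ) → L²(ℝⁿ)`: the function in `L²` that represents the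
distributional Laplacian. -/
def lap {n : ℕ} (u : H2 n) : L2 n := (exists_laplacian u).choose

theorem lap_spec {n : ℕ} (u : H2 n) :
    Δ ((u : L2 n) : 𝓢'(E n, ℂ)) = (lap u : 𝓢'(E n, ℂ)) := (exists_laplacian u).choose_spec

/-- The representing function is unique. -/
theorem lap_unique {n : ℕ} (u : H2 n) (g : L2 n)
    (hg : Δ ((u : L2 n) : 𝓢'(E n, ℂ)) = (g : 𝓢'(E n, ℂ))) : lap u = g := by
  have hk := Lp.ker_toTemperedDistributionCLM_eq_bot (F := ℂ) (μ := (volume : Measure (E n)))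
    (p := 2)
  refine LinearMap.ker_eq_bot.mp hk ?_
  simp only [ContinuousLinearMap.coe_coe, Lp.toTemperedDistributionCLM_apply]
  rw [← lap_spec, hg]

/-- The scalar Schrödinger operator `-Δ + c - V` on `H²(ℝⁿ)`. -/
def schrodinger {n : ℕ} (c : ℝ) (V : E n → ℝ) (u : H2 n) : E n → ℂ :=
  fun x => -(lap u x) + ((c - V x : ℝ) : ℂ) * (u : L2 n) x

/-- `(P, Q)` solves, in the sense of distributions, the stationary system
`-ΔP + (ω+1)P - (P³/9 + 2Q²P + P²Q/3) = 0`,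
`-ΔQ + (μ+3σω)Q - (9Q³ + 2P²Q + P³/9) = 0`. -/
def SolvesStationary {n : ℕ} (μ σ ω : ℝ) (P Q : E n → ℝ) : Prop :=
  ∀ φ : E n → ℝ, ContDiff ℝ (⊤ : ℕ∞) φ → HasCompactSupport φ →
    (∫ x, (-(P x * Δ φ x) + ((ω + 1) * P x
        - (1 / 9 * P x ^ 3 + 2 * Q x ^ 2 * P x + 1 / 3 * P x ^ 2 * Q x)) * φ x) = 0) ∧
    (∫ x, (-(Q x * Δ φ x) + ((μ + 3 * σ * ω) * Q x
        - (9 * Q x ^ 3 + 2 * P x ^ 2 * Q x + 1 / 9 * P x ^ 3)) * φ x) = 0)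

/-- The operator `𝓛₊ = [[𝓛₁, A], [A, 𝓛₃]]` on `H² × H²`, with `A = -4PQ - P²/3`. -/
def Lplus {n : ℕ} (μ σ ω : ℝ) (P Q : E n → ℝ) (h : Fin 2 → H2 n) : Fin 2 → E n → ℂ :=
  ![fun x => schrodinger (ω + 1)
        (fun y => P y ^ 2 / 3 + 2 * Q y ^ 2 + 2 / 3 * P y * Q y) (h 0) x
      + ((-4 * P x * Q x - P x ^ 2 / 3 : ℝ) : ℂ) * (h 1 : L2 n) x,
    fun x => ((-4 * P x * Q x - P x ^ 2 / 3 : ℝ) : ℂ) * (h 0 : L2 n) x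
      + schrodinger (μ + 3 * σ * ω) (fun y => 27 * Q y ^ 2 + 2 * P y ^ 2) (h 1) x]

/-- The operator `𝓛₋ = [[𝓛₂, B], [B, 𝓛₄]]` on `H² × H²`, with `B = -P²/3`. The sign of the term
`2PQ/3` in `𝓛₂` is the one given by the linearization; with it `𝓛₋ (P, 3Q) = 0`. -/
def Lminus {n : ℕ} (μ σ ω : ℝ) (P Q : E n → ℝ) (h : Fin 2 → H2 n) : Fin 2 → E n → ℂ :=
  ![fun x => schrodinger (ω + 1)
        (fun y => P y ^ 2 / 9 + 2 * Q y ^ 2 - 2 / 3 * P y * Q y) (h 0) x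
      + ((-(P x ^ 2 / 3) : ℝ) : ℂ) * (h 1 : L2 n) x,
    fun x => ((-(P x ^ 2 / 3) : ℝ) : ℂ) * (h 0 : L2 n) x
      + schrodinger (μ + 3 * σ * ω) (fun y => 9 * Q y ^ 2 + 2 * P y ^ 2) (h 1) x]

/-- The `L²` inner product of pairs of functions. -/
def pairing {n : ℕ} (f g : Fin 2 → E n → ℂ) : ℂ := ∑ i, ∫ x, f i x * conj (g i x)

/-- A pair in `H² × H²`, regarded as a pair of functions. -/
def toFun2 {n : ℕ} (h : Fin 2 → H2 n) : Fin 2 → E n → ℂ := fun i x => (h i : L2 n) x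

/-- The quadratic form `⟨𝓛₊ h, h⟩`. -/
def formPlus {n : ℕ} (μ σ ω : ℝ) (P Q : E n → ℝ) (h : Fin 2 → H2 n) : ℝ :=
  (pairing (Lplus μ σ ω P Q h) (toFun2 h)).re

/-- The quadratic form `⟨𝓛₋ h, h⟩`. -/
def formMinus {n : ℕ} (μ σ ω : ℝ) (P Q : E n → ℝ) (h : Fin 2 → H2 n) : ℝ :=
  (pairing (Lminus μ σ ω P Q h) (toFun2 h)).re

/-- `h ⊥ (P, 3σQ)` in `L² × L²`. -/
def PerpWave {n : ℕ} (σ : ℝ) (P Q : E n → ℝ) (h : Fin 2 → H2 n) : Prop :=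
  pairing (toFun2 h) ![fun x => (P x : ℂ), fun x => ((3 * σ * Q x : ℝ) : ℂ)] = 0

/-- The matrix `𝓙`. -/
def J (σ : ℝ) : Matrix (Fin 4) (Fin 4) ℂ :=
  !![0, 0, 1, 0;
     0, 0, 0, 1 / (σ : ℂ);
     -1, 0, 0, 0;
     0, -(1 / (σ : ℂ)), 0, 0]

/-- The operator `𝓛 = diag(𝓛₊, 𝓛₋)` on `(H²)⁴`. -/
def calL {n : ℕ} (μ σ ω : ℝ) (P Q : E n → ℝ) (v : Fin 4 → H2 n) : Fin 4 → E n → ℂ :=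
  ![Lplus μ σ ω P Q ![v 0, v 1] 0, Lplus μ σ ω P Q ![v 0, v 1] 1,
    Lminus μ σ ω P Q ![v 2, v 3] 0, Lminus μ σ ω P Q ![v 2, v 3] 1]

/-- `v` solves the eigenvalue problem `𝓙 𝓛 v = lam v`. -/
def IsEigenSolution {n : ℕ} (μ σ ω : ℝ) (P Q : E n → ℝ) (lam : ℂ) (v : Fin 4 → H2 n) : Prop :=
  ∀ᵐ x, (J σ *ᵥ fun j => calL μ σ ω P Q v j x) = fun j => lam * (v j : L2 n) x

/-- Spectral stability of the wave `(exp(iωt) P, exp(3iωt) Q)`. -/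
def SpectrallyStable {n : ℕ} (μ σ ω : ℝ) (P Q : E n → ℝ) : Prop :=
  ¬ ∃ (lam : ℂ) (v : Fin 4 → H2 n), 0 < lam.re ∧ v ≠ 0 ∧ IsEigenSolution μ σ ω P Q lam v

end

end ThirdHarmonic

/-! Write v = (f, g), D = diag(1, σ) and L₊, L₋ for the two blocks of 𝓛. The eigenvalue problem is
the pair of equations L₋ g = λ D f, L₊ f = -λ D g. Gauge invariance puts φ = (P, 3Q) in the kernel
of L₋, and Dφ = (P, 3σQ) is the vector in the constraint. Everything rests on L₋ ≥ 0. For P, Q > 0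
this is Perron–Frobenius: the coupling -P²/3 is nonpositive, so a ground state with negative
eigenvalue could be replaced by its modulus, which would be orthogonal to the positive kernel
element φ (`Cooperative.nonneg_of_pos_kernel`).

Instability gives a negative direction (`form_neg_of_unstable_mode`). With z = ⟨g, Df⟩ one has ⟨g,
L₋ g⟩ = λ z and ⟨f, L₊ f⟩ = -λ z̄. Both are real and Re λ > 0, so z is real and ⟨f, L₊ f⟩ = -⟨g, L₋
g⟩ ≤ 0; equality would force L₋ g = 0 and then v = 0. Pairing the first equation with φ gives f ⊥
Dφ.

Conversely, eliminating g leads to L₊ f + λ² D L₋⁻¹ D f = 0 on the complement of D ker L₋. The form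
⟨L₊ f, f⟩ + τ ⟨L₋⁻¹ D f, D f⟩ takes a negative value at τ = 0 and, by compactness, none for large τ;
at the critical τ it has a zero mode, and λ = √τ (`exists_zero_mode`, `exists_hamiltonian_mode`).
This needs a negative direction orthogonal to all of D ker L₋ and not only to Dφ.
`exists_neg_perp_kernel` supplies it: if P ≠ 0 the kernel is the line through φ, and if P = 0 the
system decouples.

The analysis is done with bounded operators. With R = (c - Δ)⁻¹ one has R^{1/2} L± R^{1/2} = 1 - K±,
and K± is compact because the potentials lie in L² ∩ L^∞ and n ≤ 3. That P and Q are bounded follows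
from H¹ ⊂ L⁶, which puts the cubic terms in L², and from H² ⊂ L^∞. -/

namespace ThirdHarmonic

open Filter Topology
open scoped InnerProductSpace

/-! ### Compact perturbations of positive operators and a constrained Hamiltonian eigenvalue
problem. -/

section AbstractOperators

variable {H : Type*} [NormedAddCommGroup H] [InnerProductSpace ℂ H]

theorem exists_subseq_tendsto_of_isCompactOperator {K : H →L[ℂ] H} (hK : IsCompactOperator K)
    {u : ℕ → H} {C : ℝ} (hu : ∀ n, ‖u n‖ ≤ C) :
    ∃ (y : H) (φ : ℕ → ℕ), StrictMono φ ∧ Tendsto (fun n => K (u (φ n))) atTop (𝓝 y) := by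
  obtain ⟨S, hS, hKS⟩ := hK.image_closedBall_subset_compact (f := (K : H →ₗ[ℂ] H)) C
  obtain ⟨y, -, φ, hφ, hy⟩ := hS.tendsto_subseq (x := fun n => K (u n))
    (fun n => hKS ⟨u n, by simpa using hu n, rfl⟩)
  exact ⟨y, φ, hφ, hy⟩

/-- Testing positivity at `x - t • M x` with `t = (‖M‖ + 1)⁻¹` makes the quadratic term in `t`
absorb half of the linear one. Consequently `M x` is small, or zero, as soon as the form is. -/
theorem norm_sq_le_of_nonneg {M : H →L[ℂ] H} (hM : (M : H →ₗ[ℂ] H).IsSymmetric)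
    (hpos : ∀ x, 0 ≤ (⟪M x, x⟫_ℂ).re) (x : H) :
    ‖M x‖ ^ 2 ≤ (‖M‖ + 1) * (⟪M x, x⟫_ℂ).re := by
  set t : ℝ := (‖M‖ + 1)⁻¹ with ht
  have hM0 : 0 < ‖M‖ + 1 := by positivity
  have ht0 : 0 < t := by positivity
  have h := hpos (x - (t : ℂ) • M x)
  have e1 : ⟪M (M x), x⟫_ℂ = ⟪M x, M x⟫_ℂ := hM (M x) x
  have e2 : (⟪M x, M x⟫_ℂ) = ((‖M x‖ ^ 2 : ℝ) : ℂ) := by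
    rw [inner_self_eq_norm_sq_to_K]; norm_cast
  have e3 : (⟪M (x - (t : ℂ) • M x), x - (t : ℂ) • M x⟫_ℂ).re
      = (⟪M x, x⟫_ℂ).re - 2 * t * ‖M x‖ ^ 2 + t ^ 2 * (⟪M (M x), M x⟫_ℂ).re := by
    simp only [map_sub, map_smul, inner_sub_left, inner_sub_right, inner_smul_left,
      inner_smul_right, e1, e2, Complex.conj_ofReal]
    simp only [Complex.sub_re, Complex.re_ofReal_mul, Complex.ofReal_re]
    ring
  have e4 : (⟪M (M x), M x⟫_ℂ).re ≤ ‖M‖ * ‖M x‖ ^ 2 := by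
    refine (Complex.re_le_norm _).trans ((norm_inner_le_norm _ _).trans ?_)
    nlinarith [M.le_opNorm (M x), norm_nonneg (M x)]
  rw [e3] at h
  have e5 : t * (‖M‖ + 1) = 1 := inv_mul_cancel₀ hM0.ne'
  have e6 : t ^ 2 * (⟪M (M x), M x⟫_ℂ).re ≤ t * ‖M x‖ ^ 2 := by
    calc t ^ 2 * (⟪M (M x), M x⟫_ℂ).re ≤ t ^ 2 * (‖M‖ * ‖M x‖ ^ 2) := by gcongr
      _ ≤ t ^ 2 * ((‖M‖ + 1) * ‖M x‖ ^ 2) := by gcongr; linarith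
      _ = t * (t * (‖M‖ + 1)) * ‖M x‖ ^ 2 := by ring
      _ = _ := by rw [e5, mul_one]
  have e7 : t * ‖M x‖ ^ 2 ≤ (⟪M x, x⟫_ℂ).re := by linarith
  calc ‖M x‖ ^ 2 = (‖M‖ + 1) * (t * ‖M x‖ ^ 2) := by rw [← mul_assoc, mul_comm _ t, e5, one_mul]
    _ ≤ _ := by gcongr

/-- Otherwise there are unit vectors `u n` whose form values tend to zero, so that `(B - K) (u n) →
0`. Compactness makes `B (u n)` converge along a subsequence, and so does `u n` because `B` is
bounded below; the limit is a unit vector in the kernel. -/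
theorem sub_compact_coercive [CompleteSpace H] {B K : H →L[ℂ] H}
    (hB : (B : H →ₗ[ℂ] H).IsSymmetric)
    (hB1 : ∀ x, ‖x‖ ^ 2 ≤ (⟪B x, x⟫_ℂ).re) (hKs : (K : H →ₗ[ℂ] H).IsSymmetric)
    (hK : IsCompactOperator K) (hpos : ∀ x, 0 ≤ (⟪(B - K) x, x⟫_ℂ).re)
    (hinj : ∀ x, (B - K) x = 0 → x = 0) :
    ∃ δ > 0, ∀ x, δ * ‖x‖ ^ 2 ≤ (⟪(B - K) x, x⟫_ℂ).re := by
  by_contra! hcon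
  have hex : ∀ n : ℕ, ∃ x : H, ‖x‖ = 1 ∧ (⟪(B - K) x, x⟫_ℂ).re < 1 / ((n : ℝ) + 1) := by
    intro n
    obtain ⟨x, hx⟩ := hcon (1 / ((n : ℝ) + 1)) (by positivity)
    have hx0 : x ≠ 0 := by rintro rfl; simp at hx
    have hn : 0 < ‖x‖ := norm_pos_iff.mpr hx0
    refine ⟨((‖x‖⁻¹ : ℝ) : ℂ) • x, ?_, ?_⟩
    · rw [norm_smul, Complex.norm_real, norm_inv, norm_norm, inv_mul_cancel₀ hn.ne']
    · rw [map_smul, inner_smul_left, inner_smul_right, Complex.conj_ofReal,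
        Complex.re_ofReal_mul, Complex.re_ofReal_mul]
      calc ‖x‖⁻¹ * (‖x‖⁻¹ * (⟪(B - K) x, x⟫_ℂ).re)
          < ‖x‖⁻¹ * (‖x‖⁻¹ * (1 / ((n : ℝ) + 1) * ‖x‖ ^ 2)) := by gcongr
        _ = 1 / ((n : ℝ) + 1) := by field_simp
  choose u hu1 hu using hex
  have hBx : ∀ x, ‖x‖ ≤ ‖B x‖ := by
    intro x
    rcases eq_or_ne x 0 with rfl | hx
    · simp
    have h1 : ‖x‖ ^ 2 ≤ ‖B x‖ * ‖x‖ :=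
      (hB1 x).trans ((Complex.re_le_norm _).trans (norm_inner_le_norm _ _))
    have hn : 0 < ‖x‖ := norm_pos_iff.mpr hx
    nlinarith
  have hsymm : ((B - K : H →L[ℂ] H) : H →ₗ[ℂ] H).IsSymmetric := by
    intro x y
    have h1 := hB x y
    have h2 := hKs x y
    simp only [ContinuousLinearMap.coe_coe] at h1 h2
    simp [inner_sub_left, inner_sub_right, h1, h2]
  have hlim : Tendsto (fun n => (B - K) (u n)) atTop (𝓝 0) := by
    rw [tendsto_zero_iff_norm_tendsto_zero]
    have h2 : Tendsto (fun n => ‖(B - K) (u n)‖ ^ 2) atTop (𝓝 0) := by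
      refine squeeze_zero (fun n => by positivity)
        (fun n => (norm_sq_le_of_nonneg hsymm hpos (u n)).trans
          (mul_le_mul_of_nonneg_left (hu n).le (by positivity))) ?_
      simpa using tendsto_one_div_add_atTop_nhds_zero_nat.const_mul (‖B - K‖ + 1)
    have h3 := h2.sqrt
    simpa using h3
  obtain ⟨y, φ, hφ, hy⟩ := exists_subseq_tendsto_of_isCompactOperator hK (fun n => (hu1 n).le)
  have hBu : Tendsto (fun n => B (u (φ n))) atTop (𝓝 y) := by
    have := (hlim.comp hφ.tendsto_atTop).add hy
    simpa using this
  have hcau : CauchySeq (fun n => u (φ n)) := by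
    have hc := hBu.cauchySeq
    rw [Metric.cauchySeq_iff] at hc ⊢
    intro ε hε
    obtain ⟨N, hN⟩ := hc ε hε
    refine ⟨N, fun m hm n hn => lt_of_le_of_lt ?_ (hN m hm n hn)⟩
    rw [dist_eq_norm, dist_eq_norm, ← map_sub]
    exact hBx _
  obtain ⟨z, hz⟩ := cauchySeq_tendsto_of_complete hcau
  have hz1 : ‖z‖ = 1 := by
    have := hz.norm
    simp only [hu1] at this
    exact (tendsto_nhds_unique this tendsto_const_nhds)
  have hz0 : (B - K) z = 0 :=
    tendsto_nhds_unique (((B - K).continuous.tendsto z).comp hz) (hlim.comp hφ.tendsto_atTop)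
  have := hinj z hz0
  rw [this, norm_zero] at hz1
  exact zero_ne_one hz1

/-- A compact perturbation of the identity that has a negative direction acquires a kernel when
a suitable multiple of an injective nonnegative operator is added. -/
theorem exists_zero_mode [CompleteSpace H] {C K : H →L[ℂ] H}
    (hC : (C : H →ₗ[ℂ] H).IsSymmetric) (hCpos : ∀ x, 0 ≤ (⟪C x, x⟫_ℂ).re)
    (hCinj : ∀ x, C x = 0 → x = 0)
    (hKs : (K : H →ₗ[ℂ] H).IsSymmetric) (hK : IsCompactOperator K)
    {u₀ : H} (hu₀ : (⟪u₀ - K u₀, u₀⟫_ℂ).re < 0) :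
    ∃ τ : ℝ, 0 < τ ∧ (∀ x, 0 ≤ (⟪x + (τ : ℂ) • C x - K x, x⟫_ℂ).re) ∧
      ∃ u, u ≠ 0 ∧ u + (τ : ℂ) • C u - K u = 0 := by
  set q : ℝ → H → ℝ := fun τ x => (⟪x + (τ : ℂ) • C x - K x, x⟫_ℂ).re with hq
  have qform : ∀ τ x, q τ x = ‖x‖ ^ 2 + τ * (⟪C x, x⟫_ℂ).re - (⟪K x, x⟫_ℂ).re := by
    intro τ x
    simp only [hq, inner_sub_left, inner_add_left, inner_smul_left, Complex.conj_ofReal,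
      Complex.sub_re, Complex.add_re, Complex.re_ofReal_mul]
    congr 2
    rw [inner_self_eq_norm_sq_to_K]; norm_cast
  have hcont : ∀ x, Continuous fun τ => q τ x := by
    intro x; simp only [qform]; fun_prop
  -- The critical parameter is the supremum of the `τ` for which the form still takes a negative
  -- value.
  set S : Set ℝ := {τ | 0 ≤ τ ∧ ∃ x, q τ x < 0} with hS
  have hS0 : (0 : ℝ) ∈ S := ⟨le_rfl, u₀, by simpa [hq] using hu₀⟩
  -- If `S` were unbounded, unit vectors with `q n (u n) < 0` would satisfy `C (u n) → 0`. Being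
  -- symmetric and injective, `C` has dense range, so the inner products of `u (φ n)` with `y = lim
  -- K (u (φ n))` tend to zero, and therefore so do those of `K (u (φ n))` with `u (φ n)`. But
  -- negativity of the form keeps the latter at least `1`.
  have hbdd : BddAbove S := by
    by_contra hnb
    rw [not_bddAbove_iff] at hnb
    have hex : ∀ n : ℕ, ∃ x : H, ‖x‖ = 1 ∧ q n x < 0 := by
      intro n
      obtain ⟨τ, ⟨hτ0, x, hx⟩, hτ⟩ := hnb n
      have hx' : q n x < 0 := by
        rw [qform] at hx ⊢
        have := mul_le_mul_of_nonneg_right hτ.le (hCpos x)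
        linarith
      have hx0 : x ≠ 0 := by rintro rfl; simp [hq] at hx
      have hn : 0 < ‖x‖ := norm_pos_iff.mpr hx0
      refine ⟨((‖x‖⁻¹ : ℝ) : ℂ) • x, ?_, ?_⟩
      · rw [norm_smul, Complex.norm_real, norm_inv, norm_norm, inv_mul_cancel₀ hn.ne']
      · have : q n (((‖x‖⁻¹ : ℝ) : ℂ) • x) = ‖x‖⁻¹ * (‖x‖⁻¹ * q n x) := by
          simp only [hq, map_smul]
          rw [smul_comm, ← smul_add, ← smul_sub, inner_smul_left, inner_smul_right,
            Complex.conj_ofReal, Complex.re_ofReal_mul, Complex.re_ofReal_mul]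
        rw [this]
        have h1 : 0 < ‖x‖⁻¹ := by positivity
        exact mul_neg_of_pos_of_neg h1 (mul_neg_of_pos_of_neg h1 hx')
    choose u hu1 hu using hex
    obtain ⟨y, φ, hφ, hy⟩ := exists_subseq_tendsto_of_isCompactOperator hK (fun n => (hu1 n).le)
    have hKb : ∀ n, (⟪K (u n), u n⟫_ℂ).re ≤ ‖K‖ := by
      intro n
      refine (Complex.re_le_norm _).trans ((norm_inner_le_norm _ _).trans ?_)
      have := K.le_opNorm (u n)
      rw [hu1, mul_one] at this ⊢
      exact this
    have hCu : ∀ n : ℕ, (⟪C (u n), u n⟫_ℂ).re ≤ ‖K‖ * (1 / (n : ℝ)) ∨ n = 0 := by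
      intro n
      rcases Nat.eq_zero_or_pos n with h0 | h0
      · exact Or.inr h0
      left
      have h1 := hu n
      rw [qform, hu1] at h1
      have h2 : (0 : ℝ) < n := by exact_mod_cast h0
      rw [mul_one_div, le_div_iff₀ h2]
      nlinarith [hKb n]
    have hClim : Tendsto (fun n => C (u n)) atTop (𝓝 0) := by
      rw [tendsto_zero_iff_norm_tendsto_zero]
      have h2 : Tendsto (fun n => ‖C (u n)‖ ^ 2) atTop (𝓝 0) := by
        have hg : Tendsto (fun n : ℕ => (‖C‖ + 1) * (‖K‖ * (1 / (n : ℝ)))) atTop (𝓝 0) := by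
          simpa using (tendsto_one_div_atTop_nhds_zero_nat (𝕜 := ℝ)).const_mul ‖K‖
            |>.const_mul (‖C‖ + 1)
        refine squeeze_zero' (Eventually.of_forall fun n => by positivity) ?_ hg
        filter_upwards [eventually_gt_atTop 0] with n hn
        refine (norm_sq_le_of_nonneg hC hCpos (u n)).trans
          (mul_le_mul_of_nonneg_left ?_ (by positivity))
        exact (hCu n).resolve_right hn.ne'
      have h3 := h2.sqrt
      simpa using h3
    have hdense : y ∈ closure (Set.range C) := by
      have hbot : (LinearMap.range (C : H →ₗ[ℂ] H))ᗮ = ⊥ := by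
        rw [Submodule.eq_bot_iff]
        intro x hx
        refine hCinj x (ext_inner_left ℂ fun z => ?_)
        rw [inner_zero_right]
        have h1 := (Submodule.mem_orthogonal _ x).mp hx (C z) ⟨z, rfl⟩
        have h2 := hC z x
        simp only [ContinuousLinearMap.coe_coe] at h2
        rw [← h2, h1]
      have htop := (Submodule.topologicalClosure_eq_top_iff).mpr hbot
      have : y ∈ (LinearMap.range (C : H →ₗ[ℂ] H)).topologicalClosure := by
        rw [htop]; trivial
      rw [← SetLike.mem_coe, Submodule.topologicalClosure_coe] at this
      exact this
    have hyu : Tendsto (fun n => ⟪y, u (φ n)⟫_ℂ) atTop (𝓝 0) := by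
      rw [Metric.tendsto_atTop]
      intro ε hε
      obtain ⟨_, ⟨z, rfl⟩, hz⟩ := Metric.mem_closure_iff.mp hdense (ε / 2) (by positivity)
      have hlim : Tendsto (fun n => ⟪z, C (u (φ n))⟫_ℂ) atTop (𝓝 0) := by
        have := (tendsto_const_nhds (x := z)).inner (𝕜 := ℂ) (hClim.comp hφ.tendsto_atTop)
        simpa using this
      obtain ⟨N, hN⟩ := Metric.tendsto_atTop.mp hlim (ε / 2) (by positivity)
      refine ⟨N, fun n hn => ?_⟩
      have h1 := hN n hn
      rw [dist_zero_right] at h1 ⊢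
      have h2 : ⟪y, u (φ n)⟫_ℂ = ⟪y - C z, u (φ n)⟫_ℂ + ⟪z, C (u (φ n))⟫_ℂ := by
        have h3 := hC z (u (φ n))
        simp only [ContinuousLinearMap.coe_coe] at h3
        rw [← h3, inner_sub_left]; ring
      rw [h2]
      refine (norm_add_le _ _).trans_lt ?_
      have h4 : ‖⟪y - C z, u (φ n)⟫_ℂ‖ ≤ ‖y - C z‖ := by
        have := norm_inner_le_norm (𝕜 := ℂ) (y - C z) (u (φ n))
        rwa [hu1, mul_one] at this
      rw [dist_eq_norm] at hz
      linarith
    have hKu : Tendsto (fun n => (⟪K (u (φ n)), u (φ n)⟫_ℂ).re) atTop (𝓝 0) := by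
      have h1 : Tendsto (fun n => ⟪K (u (φ n)) - y, u (φ n)⟫_ℂ) atTop (𝓝 0) := by
        refine squeeze_zero_norm (fun n => ?_) (tendsto_iff_norm_sub_tendsto_zero.mp hy)
        have := norm_inner_le_norm (𝕜 := ℂ) (K (u (φ n)) - y) (u (φ n))
        rwa [hu1, mul_one] at this
      have h2 := (Complex.continuous_re.tendsto _).comp (h1.add hyu)
      refine (h2.congr fun n => ?_).trans (by simp)
      simp only [Function.comp_apply, inner_sub_left]
      ring_nf
    have hge : ∀ n, 1 ≤ (⟪K (u (φ n)), u (φ n)⟫_ℂ).re := by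
      intro n
      have h1 := hu (φ n)
      rw [qform, hu1] at h1
      have h2 : (0 : ℝ) ≤ (φ n : ℝ) * (⟪C (u (φ n)), u (φ n)⟫_ℂ).re :=
        mul_nonneg (Nat.cast_nonneg _) (hCpos _)
      linarith
    exact absurd (ge_of_tendsto' hKu hge) (by norm_num)
  set τ := sSup S with hτdef
  have hτ0 : 0 ≤ τ := le_csSup hbdd hS0
  have hopen : ∀ t ∈ S, ∃ δ > 0, t + δ ∈ S := by
    rintro t ⟨ht, x, hx⟩
    have h1 : ∀ᶠ s in 𝓝 t, q s x < 0 := (hcont x).continuousAt.eventually_lt_const hx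
    obtain ⟨ε, hε, hball⟩ := Metric.eventually_nhds_iff.mp h1
    refine ⟨ε / 2, by positivity, by positivity, x, hball ?_⟩
    rw [Real.dist_eq, add_sub_cancel_left, abs_of_pos (by positivity)]
    linarith
  have hτpos : 0 < τ := by
    obtain ⟨δ, hδ, h⟩ := hopen 0 hS0
    exact lt_of_lt_of_le (by linarith) (le_csSup hbdd h)
  have hnotin : τ ∉ S := by
    intro h
    obtain ⟨δ, hδ, h'⟩ := hopen τ h
    linarith [le_csSup hbdd h']
  have hpos : ∀ x, 0 ≤ q τ x := by
    intro x
    by_contra! hx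
    exact hnotin ⟨hτ0, x, hx⟩
  refine ⟨τ, hτpos, hpos, ?_⟩
  -- Without a kernel the form at `τ` is coercive with some constant `δ`, hence remains nonnegative
  -- when `τ` is lowered by less than `η`. This contradicts the presence of elements of `S` above `τ
  -- - η`.
  by_contra! hno
  set B : H →L[ℂ] H := ContinuousLinearMap.id ℂ H + (τ : ℂ) • C with hB
  have hBK : ∀ x, (B - K) x = x + (τ : ℂ) • C x - K x := fun x => by simp [hB]
  have hBs : (B : H →ₗ[ℂ] H).IsSymmetric := by
    intro x y
    have := hC x y
    simp only [ContinuousLinearMap.coe_coe] at this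
    change ⟪x + (τ : ℂ) • C x, y⟫_ℂ = ⟪x, y + (τ : ℂ) • C y⟫_ℂ
    rw [inner_add_left, inner_add_right, inner_smul_left, inner_smul_right, this,
      Complex.conj_ofReal]
  obtain ⟨δ, hδ, hco⟩ := sub_compact_coercive hBs (fun x => by
      change ‖x‖ ^ 2 ≤ (⟪x + (τ : ℂ) • C x, x⟫_ℂ).re
      rw [inner_add_left, inner_smul_left, Complex.conj_ofReal, Complex.add_re,
        Complex.re_ofReal_mul, inner_self_eq_norm_sq_to_K]
      have h1 := mul_nonneg hτ0 (hCpos x)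
      have h2 : ((‖x‖ : ℂ) ^ 2).re = ‖x‖ ^ 2 := by norm_cast
      simp only [Complex.coe_algebraMap] at h2 ⊢
      linarith) hKs hK
    (fun x => by rw [hBK]; exact hpos x)
    (fun x hx => by
      by_contra hx0
      exact hno x hx0 (by rw [← hBK, hx]))
  set η := δ / (‖C‖ + 1) with hη
  have hη0 : 0 < η := by positivity
  obtain ⟨t, ⟨-, x, hx⟩, ht⟩ := exists_lt_of_lt_csSup ⟨0, hS0⟩ (show τ - η < sSup S by linarith)
  have h1 := hco x
  rw [hBK] at h1
  change δ * ‖x‖ ^ 2 ≤ q τ x at h1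
  rw [qform] at h1 hx
  have h2 : (⟪C x, x⟫_ℂ).re ≤ ‖C‖ * ‖x‖ ^ 2 := by
    refine (Complex.re_le_norm _).trans ((norm_inner_le_norm _ _).trans ?_)
    nlinarith [C.le_opNorm x, norm_nonneg x]
  have h3 : η * ‖C‖ ≤ δ := by
    rw [hη, div_mul_eq_mul_div, div_le_iff₀ (by positivity)]
    nlinarith [norm_nonneg C]
  have h4 : (τ - t) * (⟪C x, x⟫_ℂ).re ≤ δ * ‖x‖ ^ 2 := by
    calc (τ - t) * (⟪C x, x⟫_ℂ).re ≤ η * (⟪C x, x⟫_ℂ).re :=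
          mul_le_mul_of_nonneg_right (by linarith) (hCpos x)
      _ ≤ η * (‖C‖ * ‖x‖ ^ 2) := by gcongr
      _ = (η * ‖C‖) * ‖x‖ ^ 2 := by ring
      _ ≤ _ := by gcongr
  linarith

/-- The compression of a bounded operator to a subspace. -/
noncomputable def compress (X : Submodule ℂ H) [X.HasOrthogonalProjection] (A : H →L[ℂ] H) :
    X →L[ℂ] X :=
  X.orthogonalProjectionOnto ∘L A ∘L X.subtypeL

theorem inner_compress (X : Submodule ℂ H) [X.HasOrthogonalProjection] (A : H →L[ℂ] H) (x y : X) :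
    ⟪compress X A x, y⟫_ℂ = ⟪A x, (y : H)⟫_ℂ := by
  simp [compress]

theorem inner_compress_right (X : Submodule ℂ H) [X.HasOrthogonalProjection] (A : H →L[ℂ] H)
    (x y : X) : ⟪x, compress X A y⟫_ℂ = ⟪(x : H), A y⟫_ℂ := by
  simp [compress]

theorem compress_isSymmetric (X : Submodule ℂ H) [X.HasOrthogonalProjection] {A : H →L[ℂ] H}
    (hA : (A : H →ₗ[ℂ] H).IsSymmetric) : (compress X A : X →ₗ[ℂ] X).IsSymmetric := by
  intro x y
  change ⟪compress X A x, y⟫_ℂ = ⟪x, compress X A y⟫_ℂ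
  rw [inner_compress, inner_compress_right]
  exact hA x y

theorem compress_isCompactOperator (X : Submodule ℂ H) [X.HasOrthogonalProjection] {A : H →L[ℂ] H}
    (hA : IsCompactOperator A) : IsCompactOperator (compress X A) :=
  (hA.comp_clm X.subtypeL).clm_comp X.orthogonalProjectionOnto

/-- Let `N` be the kernel of `1 - Km` and `G` the inverse of `1 - Km` on `Nᗮ`, extended by zero.
Eliminating `w` leaves `(1 - Kp) u + lam² S G S u = 0` modulo `S N`, which `exists_zero_mode` solves
after compression to the complement of `S N`. -/
theorem exists_hamiltonian_mode [CompleteSpace H] {S Kp Km : H →L[ℂ] H}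
    (hS : (S : H →ₗ[ℂ] H).IsSymmetric) (hSinj : ∀ x, S x = 0 → x = 0)
    (hKp : (Kp : H →ₗ[ℂ] H).IsSymmetric) (hKpc : IsCompactOperator Kp)
    (hKm : (Km : H →ₗ[ℂ] H).IsSymmetric) (hKmc : IsCompactOperator Km)
    (hpos : ∀ x, 0 ≤ (⟪x - Km x, x⟫_ℂ).re)
    {u₀ : H} (hu₀ : (⟪u₀ - Kp u₀, u₀⟫_ℂ).re < 0)
    (hperp : ∀ z, Km z = z → ⟪S z, u₀⟫_ℂ = 0) :
    ∃ (lam : ℝ) (u w : H), 0 < lam ∧ u ≠ 0 ∧ w - Km w = (lam : ℂ) • S u ∧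
      u - Kp u = -((lam : ℂ) • S w) := by
  set N : Submodule ℂ H := Module.End.eigenspace (Km : H →ₗ[ℂ] H) 1 with hN
  have hNfin : FiniteDimensional ℂ N :=
    ContinuousLinearMap.finite_dimensional_eigenspace hKmc 1 one_ne_zero
  have hmemN : ∀ z, z ∈ N ↔ Km z = z := by
    intro z; rw [hN, Module.End.mem_eigenspace_iff, one_smul]; rfl
  have hrange : ∀ z, z - Km z ∈ Nᗮ := by
    intro z
    rw [Submodule.mem_orthogonal]
    intro m hm
    have h1 := hKm m z
    simp only [ContinuousLinearMap.coe_coe, (hmemN m).mp hm] at h1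
    rw [inner_sub_right, h1, sub_self]
  set Ky := compress Nᗮ Km with hKy
  obtain ⟨δ, hδ, hco⟩ := sub_compact_coercive (B := ContinuousLinearMap.id ℂ Nᗮ) (K := Ky)
    (fun x y => rfl)
    (fun x => le_of_eq (by
      rw [ContinuousLinearMap.id_apply, inner_self_eq_norm_sq_to_K]
      norm_cast))
    (compress_isSymmetric _ hKm) (compress_isCompactOperator _ hKmc)
    (fun x => by
      rw [_root_.sub_apply, ContinuousLinearMap.id_apply, inner_sub_left, inner_compress]
      simpa [inner_sub_left] using hpos x)
    (fun x hx => by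
      have h1 : (x : H) - Km x = 0 := by
        have h2 : ⟪(x : H) - Km x, (x : H) - Km x⟫_ℂ = 0 := by
          have h3 : ⟪(ContinuousLinearMap.id ℂ Nᗮ - Ky) x, ⟨(x : H) - Km x, hrange x⟩⟫_ℂ = 0 := by
            rw [hx, inner_zero_left]
          rw [_root_.sub_apply, ContinuousLinearMap.id_apply, inner_sub_left, inner_compress] at h3
          rw [inner_sub_left]
          exact h3
        exact inner_self_eq_zero.mp h2
      have h4 : (x : H) ∈ N := (hmemN _).mpr (sub_eq_zero.mp h1).symm
      have h5 := (Submodule.mem_orthogonal _ _).mp x.2 _ h4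
      exact Subtype.ext (inner_self_eq_zero.mp h5))
  have hunit : IsUnit (ContinuousLinearMap.id ℂ Nᗮ - Ky) := by
    refine ContinuousLinearMap.isUnit_of_forall_le_norm_inner_map _ (c := ⟨δ, hδ.le⟩) hδ
      fun x => ?_
    have h1 := (hco x).trans (Complex.re_le_norm _)
    change ‖x‖ ^ 2 * δ ≤ _
    linarith
  obtain ⟨U, hU⟩ := hunit
  set Gi : Nᗮ →L[ℂ] Nᗮ := (↑U⁻¹ : Nᗮ →L[ℂ] Nᗮ) with hGi
  have hMG : ∀ y, (ContinuousLinearMap.id ℂ Nᗮ - Ky) (Gi y) = y := by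
    intro y
    rw [← hU, hGi, ← mul_apply_eq_comp, Units.mul_inv, one_apply_eq_self]
  have hMGH : ∀ y : Nᗮ, (Gi y : H) - Km (Gi y) = y := by
    intro y
    have h1 := congrArg (Subtype.val) (hMG y)
    rw [_root_.sub_apply, ContinuousLinearMap.id_apply] at h1
    rw [← h1, Submodule.coe_sub, sub_right_inj, hKy]
    have h2 : Km (Gi y) ∈ Nᗮ := by
      have := Submodule.sub_mem _ (Gi y).2 (hrange (Gi y))
      rwa [sub_sub_cancel] at this
    change _ = ((Nᗮ.orthogonalProjectionOnto (Km (Gi y)) : Nᗮ) : H)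
    exact (Submodule.orthogonalProjectionOnto_mem_subspace_eq_self (⟨_, h2⟩ : Nᗮ) ▸ rfl)
  have hGsymm : ∀ x y : Nᗮ, ⟪Gi x, y⟫_ℂ = ⟪x, Gi y⟫_ℂ := by
    intro x y
    have h1 := compress_isSymmetric Nᗮ hKm (Gi x) (Gi y)
    simp only [ContinuousLinearMap.coe_coe] at h1
    conv_lhs => rw [← hMG y]
    conv_rhs => rw [← hMG x]
    rw [_root_.sub_apply, _root_.sub_apply, inner_sub_left, inner_sub_right]
    rw [hKy, h1]
    rfl
  have hGpos : ∀ x : Nᗮ, δ * ‖Gi x‖ ^ 2 ≤ (⟪Gi x, x⟫_ℂ).re := by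
    intro x
    have h1 := hco (Gi x)
    rw [hMG] at h1
    rwa [← hGsymm] at h1
  set G : H →L[ℂ] H := Nᗮ.subtypeL ∘L Gi ∘L Nᗮ.orthogonalProjectionOnto with hG
  have hGin : ∀ x y : H, ⟪G x, y⟫_ℂ = ⟪Gi (Nᗮ.orthogonalProjectionOnto x),
      Nᗮ.orthogonalProjectionOnto y⟫_ℂ := fun x y => by simp [hG]
  have hGin' : ∀ x y : H, ⟪x, G y⟫_ℂ = ⟪Nᗮ.orthogonalProjectionOnto x,
      Gi (Nᗮ.orthogonalProjectionOnto y)⟫_ℂ := fun x y => by simp [hG]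
  set C : H →L[ℂ] H := S ∘L G ∘L S with hC
  have hCin : ∀ x y, ⟪C x, y⟫_ℂ = ⟪G (S x), S y⟫_ℂ := fun x y => hS (G (S x)) y
  have hCsymm : (C : H →ₗ[ℂ] H).IsSymmetric := by
    intro x y
    change ⟪C x, y⟫_ℂ = ⟪x, S (G (S y))⟫_ℂ
    have := hS x (G (S y))
    simp only [ContinuousLinearMap.coe_coe] at this
    rw [hCin, ← this, hGin, hGin', hGsymm]
  -- `S` sends `SNᗮ` into `Nᗮ`, where `G` is a genuine positive inverse. So the compression of `C`
  -- to `SNᗮ` is nonnegative and injective, and `hperp` says that `u₀` lies in `SNᗮ`.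
  set SN : Submodule ℂ H := N.map (S : H →ₗ[ℂ] H) with hSN
  have hSNfin : FiniteDimensional ℂ SN := by rw [hSN]; infer_instance
  have hSX : ∀ x ∈ SNᗮ, S x ∈ Nᗮ := by
    intro x hx
    rw [Submodule.mem_orthogonal] at hx ⊢
    intro m hm
    have := hS m x
    simp only [ContinuousLinearMap.coe_coe] at this
    rw [← this]
    exact hx _ ⟨m, hm, rfl⟩
  have hu₀X : u₀ ∈ SNᗮ := by
    rw [Submodule.mem_orthogonal]
    rintro _ ⟨m, hm, rfl⟩
    exact hperp m ((hmemN m).mp hm)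
  obtain ⟨τ, hτ, -, ⟨x, hx⟩, hx0, hxeq⟩ := exists_zero_mode (C := compress SNᗮ C)
    (K := compress SNᗮ Kp) (compress_isSymmetric _ hCsymm)
    (fun x => by
      rw [inner_compress, hCin, hGin]
      exact (mul_nonneg hδ.le (sq_nonneg _)).trans (hGpos _))
    (fun x hx => by
      have h1 : ⟪compress SNᗮ C x, x⟫_ℂ = 0 := by rw [hx, inner_zero_left]
      rw [inner_compress, hCin, hGin] at h1
      have h2 := hGpos (Nᗮ.orthogonalProjectionOnto (S x))
      rw [h1, Complex.zero_re] at h2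
      have h3 : Gi (Nᗮ.orthogonalProjectionOnto (S x)) = 0 := by
        have h5 : ‖Gi (Nᗮ.orthogonalProjectionOnto (S x))‖ ^ 2 ≤ 0 := by
          by_contra! h
          exact absurd h2 (not_le.mpr (mul_pos hδ h))
        simpa using le_antisymm h5 (sq_nonneg _)
      have h4 := hMG (Nᗮ.orthogonalProjectionOnto (S x))
      rw [h3, map_zero] at h4
      have h6 := Submodule.orthogonalProjectionOnto_mem_subspace_eq_self
        (⟨S x, hSX x x.2⟩ : Nᗮ)
      rw [← h4] at h6
      exact Subtype.ext (hSinj _ (congrArg Subtype.val h6).symm))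
    (compress_isSymmetric _ hKp) (compress_isCompactOperator _ hKpc)
    (u₀ := ⟨u₀, hu₀X⟩) (by
      rw [inner_sub_left, inner_compress]
      simpa [inner_sub_left] using hu₀)
  -- The compressed equation controls the residual only up to `SNᗮᗮ`, which is `SN` because the
  -- eigenspace `N` of a compact operator is finite dimensional.
  have hmem : x + (τ : ℂ) • C x - Kp x ∈ SN := by
    have h1 : x + (τ : ℂ) • C x - Kp x ∈ SNᗮᗮ := by
      rw [Submodule.mem_orthogonal']
      intro y hy
      have h2 := congrArg (fun z => ⟪z, (⟨y, hy⟩ : SNᗮ)⟫_ℂ) hxeq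
      simp only [inner_sub_left, inner_add_left, inner_smul_left, inner_compress,
        inner_zero_left] at h2
      rw [inner_sub_left, inner_add_left, inner_smul_left]
      exact h2
    rwa [Submodule.orthogonal_orthogonal] at h1
  obtain ⟨m, hm, hmeq⟩ := hmem
  have hmK : Km m = m := (hmemN m).mp hm
  simp only [ContinuousLinearMap.coe_coe] at hmeq
  set lam := √τ with hlam
  have hlam0 : 0 < lam := Real.sqrt_pos.mpr hτ
  have hlam2 : (lam : ℂ) * lam = τ := by
    rw [← Complex.ofReal_mul, Real.mul_self_sqrt hτ.le]
  have hlamne : (lam : ℂ) ≠ 0 := by exact_mod_cast hlam0.ne'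
  -- The component `-lam⁻¹ • m` is invisible to `1 - Km`, and in the second equation it absorbs the
  -- residual `S m`.
  refine ⟨lam, x, (lam : ℂ) • G (S x) - (lam : ℂ)⁻¹ • m, hlam0,
    fun h => hx0 (Subtype.ext h), ?_, ?_⟩
  · have h1 : G (S x) - Km (G (S x)) = S x := by
      have h2 := hMGH (⟨S x, hSX x hx⟩ : Nᗮ)
      have h3 : G (S x) = Gi ⟨S x, hSX x hx⟩ := by
        have h4 := Submodule.orthogonalProjectionOnto_mem_subspace_eq_self
          (⟨S x, hSX x hx⟩ : Nᗮ)
        change ((Gi (Nᗮ.orthogonalProjectionOnto (S x)) : Nᗮ) : H) = _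
        exact congrArg (fun z => ((Gi z : Nᗮ) : H)) h4
      rw [h3]; exact h2
    calc (lam : ℂ) • G (S x) - (lam : ℂ)⁻¹ • m - Km ((lam : ℂ) • G (S x) - (lam : ℂ)⁻¹ • m)
        = (lam : ℂ) • (G (S x) - Km (G (S x))) := by
          rw [map_sub, map_smul, map_smul, hmK, smul_sub]; abel
      _ = _ := by rw [h1]
  · have h1 : C x = S (G (S x)) := rfl
    rw [map_sub, map_smul, map_smul, hmeq, ← h1, smul_sub, smul_smul, smul_smul, hlam2,
      mul_inv_cancel₀ hlamne, one_smul]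
    abel

end AbstractOperators

end ThirdHarmonic

namespace ThirdHarmonic

open Filter Topology FourierTransform
open scoped InnerProductSpace ENNReal

noncomputable section

/-! ### Multiplication operators, Fourier multipliers and the Laplacian on L². -/

section Multipliers

variable {n : ℕ}

/-- A real function is essentially bounded. -/
abbrev EssBdd (a : E n → ℝ) : Prop := MemLp (fun x => (a x : ℂ)) ⊤ (volume : Measure (E n))

theorem EssBdd.exists_bound {a : E n → ℝ} (ha : EssBdd a) :
    ∃ C, 0 ≤ C ∧ ∀ᵐ x, |a x| ≤ C := by
  refine ⟨(eLpNormEssSup (fun x => (a x : ℂ)) volume).toReal, ENNReal.toReal_nonneg, ?_⟩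
  have h := ha.2
  rw [eLpNorm_exponent_top] at h
  filter_upwards [ae_le_eLpNormEssSup (f := fun x => (a x : ℂ)) (μ := volume)] with x hx
  have h1 := ENNReal.toReal_mono h.ne hx
  rw [toReal_enorm, Complex.norm_real, Real.norm_eq_abs] at h1
  exact h1

theorem EssBdd.aestronglyMeasurable {a : E n → ℝ} (ha : EssBdd a) :
    AEStronglyMeasurable a volume := by
  have := Complex.continuous_re.comp_aestronglyMeasurable ha.1
  simpa [Function.comp_def] using this

theorem essBdd_of_bound {a : E n → ℝ} (hm : AEStronglyMeasurable a volume) (C : ℝ)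
    (h : ∀ᵐ x, |a x| ≤ C) : EssBdd a :=
  memLp_top_of_bound (Complex.continuous_ofReal.comp_aestronglyMeasurable hm) C
    (h.mono fun x hx => by simpa using hx)

/-- Multiplication by an essentially bounded real function on `L²`. -/
def mulOp (a : E n → ℝ) (ha : EssBdd a) : L2 n →L[ℂ] L2 n :=
  (ContinuousLinearMap.mul ℂ ℂ).holderL volume ⊤ 2 2 (ha.toLp _)

theorem mulOp_ae {a : E n → ℝ} (ha : EssBdd a) (f : L2 n) :
    mulOp a ha f =ᵐ[volume] fun x => (a x : ℂ) * f x := by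
  have h1 := (ContinuousLinearMap.mul ℂ ℂ).coeFn_holder (r := 2) (ha.toLp _) f
  filter_upwards [h1, ha.coeFn_toLp] with x hx hx'
  change ((ContinuousLinearMap.mul ℂ ℂ).holder 2 (ha.toLp _) f) x = _
  rw [hx, hx']
  rfl

theorem inner_L2 (f g : L2 n) : ⟪f, g⟫_ℂ = ∫ x, g x * conj (f x) := by
  rw [L2.inner_def]
  simp [RCLike.inner_apply]

theorem mulOp_isSymmetric {a : E n → ℝ} (ha : EssBdd a) (f g : L2 n) :
    ⟪mulOp a ha f, g⟫_ℂ = ⟪f, mulOp a ha g⟫_ℂ := by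
  rw [inner_L2, inner_L2]
  refine integral_congr_ae ?_
  filter_upwards [mulOp_ae ha f, mulOp_ae ha g] with x h1 h2
  rw [h1, h2, map_mul, Complex.conj_ofReal]; ring

theorem mulOp_congr {a b : E n → ℝ} (ha : EssBdd a) (hb : EssBdd b) (h : a =ᵐ[volume] b) :
    mulOp a ha = mulOp b hb := by
  ext1 f
  refine Lp.ext ?_
  filter_upwards [mulOp_ae ha f, mulOp_ae hb f, h] with x h1 h2 h3
  rw [h1, h2, h3]

theorem norm_mulOp_le {a : E n → ℝ} (ha : EssBdd a) {C : ℝ} (h : ∀ᵐ x, |a x| ≤ C) (f : L2 n) :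
    ‖mulOp a ha f‖ ≤ C * ‖f‖ := by
  refine Lp.norm_le_mul_norm_of_ae_le_mul ?_
  filter_upwards [mulOp_ae ha f, h] with x h1 h2
  rw [h1, norm_mul, Complex.norm_real, Real.norm_eq_abs]
  gcongr

/-- The Fourier multiplier on `L²` with an essentially bounded real symbol. -/
def mult (m : E n → ℝ) (hm : EssBdd m) : L2 n →L[ℂ] L2 n :=
  ((Lp.fourierTransformₗᵢ (E n) ℂ).symm.toContinuousLinearEquiv : L2 n →L[ℂ] L2 n) ∘L
    mulOp m hm ∘L ((Lp.fourierTransformₗᵢ (E n) ℂ).toContinuousLinearEquiv : L2 n →L[ℂ] L2 n)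

theorem mult_apply {m : E n → ℝ} (hm : EssBdd m) (f : L2 n) :
    mult m hm f = 𝓕⁻ (mulOp m hm (𝓕 f)) := rfl

theorem fourier_mult {m : E n → ℝ} (hm : EssBdd m) (f : L2 n) :
    𝓕 (mult m hm f) = mulOp m hm (𝓕 f) := by
  rw [mult_apply, fourier_fourierInv_eq]

theorem fourier_mult_ae {m : E n → ℝ} (hm : EssBdd m) (f : L2 n) :
    (𝓕 (mult m hm f) : L2 n) =ᵐ[volume] fun ξ => (m ξ : ℂ) * (𝓕 f : L2 n) ξ := by
  rw [fourier_mult]; exact mulOp_ae hm _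

theorem fourier_injective {f g : L2 n} (h : (𝓕 f : L2 n) = 𝓕 g) : f = g := by
  exact (Lp.fourierTransformₗᵢ (E n) ℂ).injective h

theorem eq_of_fourier_ae {f g : L2 n} (h : (𝓕 f : L2 n) =ᵐ[volume] (𝓕 g : L2 n)) : f = g :=
  fourier_injective (Lp.ext h)

theorem fourier_sub_L2 (f g : L2 n) : (𝓕 (f - g) : L2 n) = 𝓕 f - 𝓕 g :=
  (Lp.fourierTransformₗᵢ (E n) ℂ).map_sub f g

theorem fourier_smul_L2 (c : ℂ) (f : L2 n) : (𝓕 (c • f) : L2 n) = c • 𝓕 f :=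
  (Lp.fourierTransformₗᵢ (E n) ℂ).map_smul c f

theorem inner_mult {m : E n → ℝ} (hm : EssBdd m) (f g : L2 n) :
    ⟪mult m hm f, g⟫_ℂ = ⟪mulOp m hm (𝓕 f), (𝓕 g : L2 n)⟫_ℂ := by
  rw [← fourier_mult, Lp.inner_fourier_eq]

theorem mult_isSymmetric {m : E n → ℝ} (hm : EssBdd m) (f g : L2 n) :
    ⟪mult m hm f, g⟫_ℂ = ⟪f, mult m hm g⟫_ℂ := by
  rw [inner_mult, mulOp_isSymmetric, ← fourier_mult, Lp.inner_fourier_eq]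

theorem norm_mult_le {m : E n → ℝ} (hm : EssBdd m) {C : ℝ} (h : ∀ᵐ x, |m x| ≤ C) (f : L2 n) :
    ‖mult m hm f‖ ≤ C * ‖f‖ := by
  rw [← Lp.norm_fourier_eq, fourier_mult, ← Lp.norm_fourier_eq f]
  exact norm_mulOp_le hm h _

theorem mult_injective {m : E n → ℝ} (hm : EssBdd m) (h : ∀ ξ, m ξ ≠ 0) {f : L2 n}
    (hf : mult m hm f = 0) : f = 0 := by
  have h0 : (𝓕 (0 : L2 n) : L2 n) = 0 := (Lp.fourierTransformₗᵢ (E n) ℂ).map_zero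
  apply eq_of_fourier_ae
  have h1 := fourier_mult_ae hm f
  rw [hf, h0] at h1
  rw [h0]
  filter_upwards [h1, Lp.coeFn_zero ℂ 2 (volume : Measure (E n))] with ξ h2 h3
  rw [h3] at h2 ⊢
  rcases mul_eq_zero.mp h2.symm with h4 | h4
  · exact absurd (by exact_mod_cast h4) (h ξ)
  · exact h4

/-- The L² extension of the inverse transform and the Fourier integral are both moved onto a test
function by duality, so they define the same distribution. -/
theorem fourierInv_ae_of_integrable (g : L2 n) (hg : Integrable g) :
    (𝓕⁻ g : L2 n) =ᵐ[volume] 𝓕⁻ (g : E n → ℂ) := by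
  refine ae_eq_of_integral_contDiff_smul_eq
    ((Lp.memLp _).locallyIntegrable (by norm_num)) ?_ fun φ hφ hφc => ?_
  · have hc : Continuous (𝓕⁻ (g : E n → ℂ)) := by
      have := VectorFourier.fourierIntegral_continuous (e := Real.fourierChar)
        (μ := (volume : Measure (E n))) (L := -innerₗ (E n)) Real.continuous_fourierChar
        (by simp only [LinearMap.neg_apply, innerₗ_apply_apply]; fun_prop) hg
      exact this
    exact hc.locallyIntegrable
  · have hφ₁ : HasCompactSupport (Complex.ofRealCLM ∘ φ) := hφc.comp_left rfl
    have hφ₂ : ContDiff ℝ ((⊤ : ℕ∞) : WithTop ℕ∞) (Complex.ofRealCLM ∘ φ) := by fun_prop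
    set ψ : 𝓢(E n, ℂ) := hφ₁.toSchwartzMap hφ₂ with hψ
    have hψx : ∀ x, ψ x = (φ x : ℂ) := fun x => rfl
    have h1 := congrArg (fun T : 𝓢'(E n, ℂ) => T ψ) (Lp.fourierInv_toTemperedDistribution_eq g)
    simp only [TemperedDistribution.fourierInv_apply, Lp.toTemperedDistribution_apply] at h1
    have h2 := VectorFourier.integral_fourierIntegral_smul_eq_flip (e := Real.fourierChar)
      (μ := (volume : Measure (E n))) (ν := (volume : Measure (E n))) (L := -innerₗ (E n))
      (f := fun x => (ψ x : ℂ)) (g := (g : E n → ℂ)) Real.continuous_fourierChar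
      (by simp only [LinearMap.neg_apply, innerₗ_apply_apply]; fun_prop) ψ.integrable hg
    have h3 : (-innerₗ (E n)).flip = -innerₗ (E n) := by
      ext x y; simp [real_inner_comm]
    rw [h3] at h2
    have h4 : ∀ x, (𝓕⁻ ψ : 𝓢(E n, ℂ)) x
        = VectorFourier.fourierIntegral Real.fourierChar volume (-innerₗ (E n))
          (fun x => (ψ x : ℂ)) x := fun x => by
      rw [SchwartzMap.fourierInv_coe]; rfl
    simp only [h4] at h1
    rw [h2] at h1
    simp only [hψx] at h1
    simp only [← Complex.coe_smul] at *
    exact h1.symm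

theorem integrable_mul_fourier {m : E n → ℝ} (hm : EssBdd m)
    (hm2 : MemLp (fun ξ => (m ξ : ℂ)) 2 volume) (f : L2 n) : Integrable (mulOp m hm (𝓕 f)) := by
  refine (hm2.integrable_mul (Lp.memLp (𝓕 f))).congr ?_
  filter_upwards [mulOp_ae hm (𝓕 f)] with x hx
  rw [hx]; rfl

/-- Pointwise formula for a Fourier multiplier with square integrable symbol. -/
theorem mult_ae {m : E n → ℝ} (hm : EssBdd m)
    (hm2 : MemLp (fun ξ => (m ξ : ℂ)) 2 volume) (f : L2 n) :
    mult m hm f =ᵐ[volume] fun x =>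
      ∫ ξ, Complex.exp (2 * Real.pi * ⟪ξ, x⟫_ℝ * Complex.I) * ((m ξ : ℂ) * (𝓕 f : L2 n) ξ) := by
  filter_upwards [fourierInv_ae_of_integrable _ (integrable_mul_fourier hm hm2 f)] with x hx
  rw [mult_apply, hx, Real.fourierInv_eq']
  refine integral_congr_ae ?_
  filter_upwards [mulOp_ae hm (𝓕 f)] with ξ hξ
  rw [hξ, smul_eq_mul]
  push_cast
  ring_nf

theorem memLp_modulate {m : E n → ℝ} (hm2 : MemLp (fun ξ => (m ξ : ℂ)) 2 volume) (x : E n) :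
    MemLp (fun ξ => Complex.exp (-(2 * Real.pi * ⟪ξ, x⟫_ℝ * Complex.I)) * (m ξ : ℂ)) 2
      (volume : Measure (E n)) := by
  refine hm2.congr_norm ?_ ?_
  · exact (Continuous.aestronglyMeasurable (by fun_prop)).mul hm2.1
  · refine Eventually.of_forall fun ξ => ?_
    rw [norm_mul, Complex.norm_exp]
    simp

/-- The modulated symbol `e^{-2πi⟨ξ, x⟩} m(ξ)` as an element of `L²`. -/
def modulate {m : E n → ℝ} (hm2 : MemLp (fun ξ => (m ξ : ℂ)) 2 volume) (x : E n) : L2 n :=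
  (memLp_modulate hm2 x).toLp _

theorem norm_modulate {m : E n → ℝ} (hm2 : MemLp (fun ξ => (m ξ : ℂ)) 2 volume) (x : E n) :
    ‖modulate hm2 x‖ = ‖(hm2.toLp _ : L2 n)‖ := by
  rw [modulate, Lp.norm_toLp, Lp.norm_toLp]
  congr 1
  refine eLpNorm_congr_norm_ae (Eventually.of_forall fun ξ => ?_)
  rw [norm_mul, Complex.norm_exp]
  simp

/-- Reading the value at `x` as an inner product with a vector whose norm does not depend on `x`
gives the supremum bound `norm_mult_ae_le`. It also turns weak convergence of `𝓕 f` into pointwise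
convergence, which is the source of compactness. -/
theorem mult_ae_inner {m : E n → ℝ} (hm : EssBdd m)
    (hm2 : MemLp (fun ξ => (m ξ : ℂ)) 2 volume) (f : L2 n) :
    mult m hm f =ᵐ[volume] fun x => ⟪modulate hm2 x, (𝓕 f : L2 n)⟫_ℂ := by
  filter_upwards [mult_ae hm hm2 f] with x hx
  rw [hx, inner_L2]
  refine integral_congr_ae ?_
  filter_upwards [(memLp_modulate hm2 x).coeFn_toLp] with ξ hξ
  rw [modulate, hξ, map_mul, Complex.conj_ofReal, ← Complex.exp_conj]
  simp only [map_neg, map_mul, Complex.conj_ofReal, Complex.conj_I, mul_neg, neg_neg, map_ofNat]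
  ring

theorem norm_mult_ae_le {m : E n → ℝ} (hm : EssBdd m)
    (hm2 : MemLp (fun ξ => (m ξ : ℂ)) 2 volume) (f : L2 n) :
    ∀ᵐ x, ‖mult m hm f x‖ ≤ ‖(hm2.toLp _ : L2 n)‖ * ‖f‖ := by
  filter_upwards [mult_ae_inner hm hm2 f] with x hx
  rw [hx, ← norm_modulate hm2 x, ← Lp.norm_fourier_eq f]
  exact norm_inner_le_norm _ _

/-- The symbol may grow, so the product with `u` is only locally integrable; comparison against
compactly supported test functions is still enough to identify it almost everywhere. -/
theorem smulLeftCLM_eq_iff {m : E n → ℂ} (hm : m.HasTemperateGrowth) (u f : L2 n) :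
    TemperedDistribution.smulLeftCLM ℂ m (u : 𝓢'(E n, ℂ)) = (f : 𝓢'(E n, ℂ)) ↔
      f =ᵐ[volume] fun ξ => m ξ * u ξ := by
  have happ : ∀ ψ : 𝓢(E n, ℂ), TemperedDistribution.smulLeftCLM ℂ m (u : 𝓢'(E n, ℂ)) ψ
      = ∫ x, ψ x * (m x * u x) := by
    intro ψ
    rw [TemperedDistribution.smulLeftCLM_apply_apply, Lp.toTemperedDistribution_apply]
    refine integral_congr_ae (Eventually.of_forall fun x => ?_)
    simp only [SchwartzMap.smulLeftCLM_apply_apply hm, smul_eq_mul]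
    ring
  constructor
  · intro h
    refine ae_eq_of_integral_contDiff_smul_eq ((Lp.memLp _).locallyIntegrable (by norm_num)) ?_
      fun φ hφ hφc => ?_
    · have h1 := ((Lp.memLp u).locallyIntegrable (by norm_num)).locallyIntegrableOn Set.univ
      have h2 := LocallyIntegrableOn.continuousOn_mul (g := m) h1
        hm.1.continuous.continuousOn isClosed_univ.isLocallyClosed
      exact locallyIntegrableOn_univ.mp h2
    · have hφ₁ : HasCompactSupport (Complex.ofRealCLM ∘ φ) := hφc.comp_left rfl
      have hφ₂ : ContDiff ℝ ((⊤ : ℕ∞) : WithTop ℕ∞) (Complex.ofRealCLM ∘ φ) := by fun_prop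
      set ψ : 𝓢(E n, ℂ) := hφ₁.toSchwartzMap hφ₂ with hψ
      have hψx : ∀ x, ψ x = (φ x : ℂ) := fun x => rfl
      have h1 := congrArg (fun T : 𝓢'(E n, ℂ) => T ψ) h
      simp only [happ, Lp.toTemperedDistribution_apply, hψx] at h1
      simp only [smul_eq_mul] at h1
      simp only [Complex.real_smul]
      exact h1.symm
  · intro h
    ext ψ
    rw [happ, Lp.toTemperedDistribution_apply]
    refine integral_congr_ae ?_
    filter_upwards [h] with x hx
    rw [hx]; rfl

theorem fourierMultiplierCLM_eq_iff {m : E n → ℂ} (hm : m.HasTemperateGrowth) (u f : L2 n) :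
    TemperedDistribution.fourierMultiplierCLM ℂ m (u : 𝓢'(E n, ℂ)) = (f : 𝓢'(E n, ℂ)) ↔
      (𝓕 f : L2 n) =ᵐ[volume] fun ξ => m ξ * (𝓕 u : L2 n) ξ := by
  rw [← smulLeftCLM_eq_iff hm, TemperedDistribution.fourierMultiplierCLM_apply,
    Lp.fourier_toTemperedDistribution_eq, ← Lp.fourier_toTemperedDistribution_eq f]
  constructor
  · intro h
    rw [← h, fourier_fourierInv_eq]
  · intro h
    rw [h, fourierInv_fourier_eq]

/-- The symbol `4π²|ξ|²` of `-Δ`. -/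
def lapSymbol (ξ : E n) : ℝ := (2 * Real.pi) ^ 2 * ‖ξ‖ ^ 2

theorem lapSymbol_nonneg (ξ : E n) : 0 ≤ lapSymbol ξ := by unfold lapSymbol; positivity

theorem add_lapSymbol_pos {κ : ℝ} (hκ : 0 < κ) (ξ : E n) : 0 < κ + lapSymbol ξ :=
  add_pos_of_pos_of_nonneg hκ (lapSymbol_nonneg ξ)

theorem continuous_lapSymbol : Continuous (lapSymbol : E n → ℝ) := by
  unfold lapSymbol; fun_prop

theorem laplacian_eq_iff (u g : L2 n) :
    Δ (u : 𝓢'(E n, ℂ)) = (g : 𝓢'(E n, ℂ)) ↔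
      (𝓕 g : L2 n) =ᵐ[volume] fun ξ => -(lapSymbol ξ : ℂ) * (𝓕 u : L2 n) ξ := by
  have hm : (fun ξ : E n => -(lapSymbol ξ : ℂ)).HasTemperateGrowth := by
    unfold lapSymbol
    fun_prop
  rw [← fourierMultiplierCLM_eq_iff hm]
  have h1 : (fun ξ : E n => -(lapSymbol ξ : ℂ))
      = (-(2 * Real.pi : ℂ) ^ 2) • (fun ξ : E n => Complex.ofReal (‖ξ‖ ^ 2)) := by
    ext ξ; simp [lapSymbol]
  rw [h1, TemperedDistribution.fourierMultiplierCLM_smul (by fun_prop),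
    TemperedDistribution.laplacian_eq_fourierMultiplierCLM]
  have h2 : ∀ T : 𝓢'(E n, ℂ), (-(2 * Real.pi) ^ 2 : ℝ) • T = (-(2 * Real.pi : ℂ) ^ 2) • T := by
    intro T
    ext ψ
    change (-(2 * Real.pi) ^ 2 : ℝ) • (T ψ) = (-(2 * Real.pi : ℂ) ^ 2) • (T ψ)
    rw [Complex.real_smul, smul_eq_mul]
    push_cast
    rfl
  rw [h2]
  rfl

theorem fourier_lap_ae (u : H2 n) :
    (𝓕 (lap u) : L2 n) =ᵐ[volume] fun ξ => -(lapSymbol ξ : ℂ) * (𝓕 (u : L2 n) : L2 n) ξ :=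
  (laplacian_eq_iff _ _).mp (lap_spec u)

theorem mem_H2_of_laplacian {u g : L2 n} (h : Δ (u : 𝓢'(E n, ℂ)) = (g : 𝓢'(E n, ℂ))) :
    u ∈ H2 n := by
  have hm : (fun ξ : E n => (((1 + ‖ξ‖ ^ 2) ^ ((2 : ℝ) / 2) : ℝ) : ℂ)).HasTemperateGrowth := by
    fun_prop
  -- The symbol of `-Δ` carries the factor (2π)², so 1 + |ξ|² is the symbol of 1 - (2π)⁻² Δ.
  refine ⟨u - (((2 * Real.pi) ^ 2)⁻¹ : ℂ) • g, ?_⟩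
  refine (fourierMultiplierCLM_eq_iff hm _ _).mpr ?_
  rw [fourier_sub_L2, fourier_smul_L2]
  filter_upwards [(laplacian_eq_iff _ _).mp h, Lp.coeFn_sub (𝓕 u : L2 n)
    ((((2 * Real.pi) ^ 2)⁻¹ : ℂ) • (𝓕 g : L2 n)),
    Lp.coeFn_smul (((2 * Real.pi) ^ 2)⁻¹ : ℂ) (𝓕 g : L2 n)] with ξ h1 h2 h3
  rw [h2, Pi.sub_apply, h3, Pi.smul_apply, h1, smul_eq_mul, lapSymbol]
  have hpi : (Real.pi : ℂ) ≠ 0 := by exact_mod_cast Real.pi_ne_zero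
  rw [div_self two_ne_zero, Real.rpow_one]
  push_cast
  field_simp
  ring

theorem essBdd_of_continuous {m : E n → ℝ} (hm : Continuous m) (C : ℝ) (h : ∀ ξ, |m ξ| ≤ C) :
    EssBdd m :=
  essBdd_of_bound hm.aestronglyMeasurable C (Eventually.of_forall h)

/-- The symbol of the resolvent `(κ - Δ)⁻¹`. -/
def resSymbol (κ : ℝ) (ξ : E n) : ℝ := (κ + lapSymbol ξ)⁻¹

theorem continuous_resSymbol {κ : ℝ} (hκ : 0 < κ) : Continuous (resSymbol κ : E n → ℝ) := by
  unfold resSymbol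
  exact (continuous_const.add continuous_lapSymbol).inv₀ fun ξ => (add_lapSymbol_pos hκ ξ).ne'

theorem resSymbol_pos {κ : ℝ} (hκ : 0 < κ) (ξ : E n) : 0 < resSymbol κ ξ :=
  inv_pos.mpr (by linarith [lapSymbol_nonneg ξ])

theorem resSymbol_le {κ : ℝ} (hκ : 0 < κ) (ξ : E n) : resSymbol κ ξ ≤ κ⁻¹ :=
  inv_anti₀ hκ (by linarith [lapSymbol_nonneg ξ])

theorem essBdd_resSymbol {κ : ℝ} (hκ : 0 < κ) : EssBdd (resSymbol κ : E n → ℝ) :=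
  essBdd_of_continuous (continuous_resSymbol hκ) κ⁻¹ fun ξ => by
    rw [abs_of_pos (resSymbol_pos hκ ξ)]; exact resSymbol_le hκ ξ

/-- The resolvent `(κ - Δ)⁻¹` on `L²`. -/
def res (κ : ℝ) (hκ : 0 < κ) : L2 n →L[ℂ] L2 n := mult (resSymbol κ) (essBdd_resSymbol hκ)

theorem res_laplacian {κ : ℝ} (hκ : 0 < κ) (f : L2 n) :
    Δ ((res κ hκ f : L2 n) : 𝓢'(E n, ℂ)) = (((κ : ℂ) • res κ hκ f - f : L2 n) : 𝓢'(E n, ℂ)) := by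
  rw [laplacian_eq_iff, fourier_sub_L2, fourier_smul_L2]
  filter_upwards [fourier_mult_ae (essBdd_resSymbol hκ) f,
    Lp.coeFn_sub ((κ : ℂ) • (𝓕 (res κ hκ f) : L2 n)) (𝓕 f : L2 n),
    Lp.coeFn_smul (κ : ℂ) (𝓕 (res κ hκ f) : L2 n)] with ξ h1 h2 h3
  rw [h2, Pi.sub_apply, h3, Pi.smul_apply, res, h1, smul_eq_mul]
  have h4 : (κ + lapSymbol ξ : ℂ) ≠ 0 := by
    exact_mod_cast (add_lapSymbol_pos hκ ξ).ne'
  rw [resSymbol]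
  push_cast
  field_simp
  ring

theorem res_mem_H2 {κ : ℝ} (hκ : 0 < κ) (f : L2 n) : res κ hκ f ∈ H2 n :=
  mem_H2_of_laplacian (res_laplacian hκ f)

theorem lap_res {κ : ℝ} (hκ : 0 < κ) (f : L2 n) :
    lap ⟨res κ hκ f, res_mem_H2 hκ f⟩ = (κ : ℂ) • res κ hκ f - f :=
  lap_unique _ _ (res_laplacian hκ f)

theorem res_sub_lap {κ : ℝ} (hκ : 0 < κ) (u : H2 n) :
    res κ hκ ((κ : ℂ) • (u : L2 n) - lap u) = u := by
  apply eq_of_fourier_ae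
  have h0 := fourier_mult_ae (essBdd_resSymbol hκ) ((κ : ℂ) • (u : L2 n) - lap u)
  rw [fourier_sub_L2, fourier_smul_L2] at h0
  filter_upwards [h0, fourier_lap_ae u,
    Lp.coeFn_sub ((κ : ℂ) • (𝓕 (u : L2 n) : L2 n)) (𝓕 (lap u) : L2 n),
    Lp.coeFn_smul (κ : ℂ) (𝓕 (u : L2 n) : L2 n)] with ξ h1 h2 h3 h4
  rw [res, h1, h3, Pi.sub_apply, h4, Pi.smul_apply, h2, smul_eq_mul]
  have h4 : (κ + lapSymbol ξ : ℂ) ≠ 0 := by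
    exact_mod_cast (add_lapSymbol_pos hκ ξ).ne'
  rw [resSymbol]
  push_cast
  field_simp
  ring

theorem lap_add (u v : H2 n) : lap (u + v) = lap u + lap v := by
  refine lap_unique _ _ ?_
  have h0 : ∀ f g : L2 n, ((f + g : L2 n) : 𝓢'(E n, ℂ)) = (f : 𝓢'(E n, ℂ)) + (g : 𝓢'(E n, ℂ)) := by
    intro f g
    simp only [← Lp.toTemperedDistributionCLM_apply, map_add]
  rw [Submodule.coe_add, h0, h0, ← lap_spec, ← lap_spec]
  simp only [← TemperedDistribution.laplacianCLM_apply, map_add]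

theorem lap_smul (c : ℂ) (u : H2 n) : lap (c • u) = c • lap u := by
  refine lap_unique _ _ ?_
  have h0 : ∀ f : L2 n, ((c • f : L2 n) : 𝓢'(E n, ℂ)) = c • (f : 𝓢'(E n, ℂ)) := by
    intro f
    simp only [← Lp.toTemperedDistributionCLM_apply, map_smul]
  rw [Submodule.coe_smul, h0, h0, ← lap_spec]
  simp only [← TemperedDistribution.laplacianCLM_apply, map_smul]

theorem inner_lap (u v : H2 n) : ⟪lap u, (v : L2 n)⟫_ℂ = ⟪(u : L2 n), lap v⟫_ℂ := by
  rw [← Lp.inner_fourier_eq, ← Lp.inner_fourier_eq (u : L2 n), inner_L2, inner_L2]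
  refine integral_congr_ae ?_
  filter_upwards [fourier_lap_ae u, fourier_lap_ae v] with ξ h1 h2
  rw [h1, h2, map_mul, map_neg, Complex.conj_ofReal]
  ring

end Multipliers

end

end ThirdHarmonic

namespace ThirdHarmonic

open Filter Topology FourierTransform
open scoped InnerProductSpace ENNReal

noncomputable section

/-! ### The Sobolev embedding H¹ ⊂ L⁶ in dimensions one to three. -/

section Embedding

variable {n : ℕ}

theorem lintegral_enorm_sq_fourier (f : L2 n) :
    ∫⁻ x, ‖(𝓕 f : L2 n) x‖ₑ ^ 2 = ∫⁻ x, ‖f x‖ₑ ^ 2 := by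
  have h : ∀ g : L2 n, ∫⁻ x, ‖g x‖ₑ ^ 2 = ‖g‖ₑ ^ 2 := by
    intro g
    rw [Lp.enorm_def, eLpNorm_eq_lintegral_rpow_enorm_toReal (by norm_num) (by norm_num)]
    simp only [ENNReal.toReal_ofNat, ENNReal.rpow_ofNat]
    rw [← ENNReal.rpow_natCast, ← ENNReal.rpow_mul]
    norm_num
  rw [h, h, ← ofReal_norm, ← ofReal_norm, Lp.norm_fourier_eq]

theorem lintegral_enorm_sq_lt_top (f : L2 n) : ∫⁻ x, ‖f x‖ₑ ^ 2 < ⊤ := by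
  have := (Lp.memLp f).2
  rw [eLpNorm_lt_top_iff_lintegral_rpow_enorm_lt_top (by norm_num) (by norm_num)] at this
  simpa using this

/-- The symbol `(1 + |ξ|²)^{-1/2}`. -/
def besselSymbol (ξ : E n) : ℝ := (√(1 + ‖ξ‖ ^ 2))⁻¹

theorem besselSymbol_pos (ξ : E n) : 0 < besselSymbol ξ := by unfold besselSymbol; positivity

theorem besselSymbol_sq (ξ : E n) : besselSymbol ξ ^ 2 = (1 + ‖ξ‖ ^ 2)⁻¹ := by
  rw [besselSymbol, inv_pow, Real.sq_sqrt (by positivity)]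

theorem besselSymbol_le_one (ξ : E n) : besselSymbol ξ ≤ 1 := by
  rw [besselSymbol]
  refine inv_le_one_of_one_le₀ ?_
  rw [Real.one_le_sqrt]
  nlinarith [sq_nonneg ‖ξ‖]

theorem continuous_besselSymbol : Continuous (besselSymbol : E n → ℝ) := by
  unfold besselSymbol
  exact Continuous.inv₀ (by fun_prop) fun ξ => by positivity

/-- The low frequency part of `besselSymbol`. -/
def lowSymbol (A : ℝ) (ξ : E n) : ℝ := (Metric.ball (0 : E n) A).indicator besselSymbol ξ

theorem lowSymbol_measurable (A : ℝ) : Measurable (lowSymbol A : E n → ℝ) :=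
  continuous_besselSymbol.measurable.indicator measurableSet_ball

theorem lowSymbol_nonneg (A : ℝ) (ξ : E n) : 0 ≤ lowSymbol A ξ :=
  Set.indicator_nonneg (fun _ _ => (besselSymbol_pos _).le) _

theorem lowSymbol_le (A : ℝ) (ξ : E n) : lowSymbol A ξ ≤ besselSymbol ξ :=
  Set.indicator_le_self' (fun _ _ => (besselSymbol_pos _).le) _

theorem essBdd_besselSymbol : EssBdd (besselSymbol : E n → ℝ) :=
  essBdd_of_continuous continuous_besselSymbol 1 fun ξ => by
    rw [abs_of_pos (besselSymbol_pos ξ)]; exact besselSymbol_le_one ξ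

theorem essBdd_lowSymbol (A : ℝ) : EssBdd (lowSymbol A : E n → ℝ) :=
  essBdd_of_bound (lowSymbol_measurable A).aestronglyMeasurable 1 <| Eventually.of_forall fun ξ => by
    rw [abs_of_nonneg (lowSymbol_nonneg A ξ)]
    exact (lowSymbol_le A ξ).trans (besselSymbol_le_one ξ)

theorem norm_sq_toLp_ofReal {m : E n → ℝ}
    (hm : MemLp (fun ξ => (m ξ : ℂ)) 2 (volume : Measure (E n))) :
    ‖(hm.toLp _ : L2 n)‖ ^ 2 = ∫ ξ, m ξ ^ 2 := by
  rw [← Complex.ofReal_inj]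
  have h := inner_self_eq_norm_sq_to_K (𝕜 := ℂ) (hm.toLp _ : L2 n)
  push_cast
  simp only [Complex.coe_algebraMap] at h
  rw [← h, inner_L2, ← integral_complex_ofReal]
  refine integral_congr_ae ?_
  filter_upwards [hm.coeFn_toLp] with ξ hξ
  rw [hξ]
  simp [sq]

/-- The surface measure of the unit sphere of `ℝⁿ`. -/
def sphereConst (n : ℕ) : ℝ := n * (volume : Measure (E n)).real (Metric.ball 0 1)

/-- Since n - 1 ≤ 2, the function (1 + r²)⁻¹ is at most r^{-(n-1)}, which cancels the Jacobian of
polar coordinates and integrates to a multiple of `A`. This linear growth in `A` is what leads to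
the exponent six. -/
theorem lowSymbol_memLp (hn1 : 1 ≤ n) (hn3 : n ≤ 3) {A : ℝ} (hA : 0 < A) :
    ∃ h : MemLp (fun ξ => (lowSymbol A ξ : ℂ)) 2 (volume : Measure (E n)),
      ‖(h.toLp _ : L2 n)‖ ^ 2 ≤ sphereConst n * A := by
  have hnt : Nontrivial (E n) := by
    apply Module.nontrivial_of_finrank_pos (R := ℝ)
    rw [finrank_euclideanSpace_fin]; omega
  set F : ℝ → ℝ := (Set.Iio A).indicator (fun y => (y ^ (n - 1))⁻¹) with hF
  have hFr : Set.EqOn (fun y : ℝ => y ^ (n - 1) • F y) ((Set.Iio A).indicator 1) (Set.Ioi 0) := by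
    intro y (hy : 0 < y)
    by_cases hyA : y < A
    · simp only [hF, smul_eq_mul]
      rw [Set.indicator_of_mem (show y ∈ Set.Iio A from hyA),
        Set.indicator_of_mem (show y ∈ Set.Iio A from hyA)]
      exact mul_inv_cancel₀ (by positivity)
    · simp only [hF, smul_eq_mul]
      rw [Set.indicator_of_notMem (show y ∉ Set.Iio A from hyA),
        Set.indicator_of_notMem (show y ∉ Set.Iio A from hyA), mul_zero]
  have hset : Set.Ioi (0 : ℝ) ∩ Set.Iio A = Set.Ioo 0 A := rfl
  have hint : Integrable (fun ξ : E n => F ‖ξ‖) := by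
    rw [integrable_fun_norm_addHaar, finrank_euclideanSpace_fin]
    rw [integrableOn_congr_fun hFr measurableSet_Ioi, IntegrableOn,
      integrable_indicator_iff measurableSet_Iio, IntegrableOn, Measure.restrict_restrict
      measurableSet_Iio, Set.inter_comm, hset]
    exact integrable_const (1 : ℝ)
  have hval : ∫ ξ : E n, F ‖ξ‖ = sphereConst n * A := by
    rw [integral_fun_norm_addHaar, finrank_euclideanSpace_fin,
      setIntegral_congr_fun measurableSet_Ioi hFr, setIntegral_indicator measurableSet_Iio, hset]
    simp [sphereConst, hA.le, mul_assoc]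
  have hle : ∀ᵐ ξ : E n, lowSymbol A ξ ^ 2 ≤ F ‖ξ‖ := by
    have h0 : ∀ᵐ ξ : E n, ξ ≠ 0 := by
      simp [ae_iff]
    filter_upwards [h0] with ξ hξ
    have hpos : 0 < ‖ξ‖ := norm_pos_iff.mpr hξ
    by_cases hb : ‖ξ‖ < A
    · rw [lowSymbol, Set.indicator_of_mem (by simpa using hb), hF,
        Set.indicator_of_mem (by simpa using hb), besselSymbol_sq]
      refine inv_anti₀ (by positivity) ?_
      interval_cases n
      · simp
      · simp only [Nat.add_one_sub_one, pow_one]; nlinarith [sq_nonneg (‖ξ‖ - 1)]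
      · simp
    · rw [lowSymbol, Set.indicator_of_notMem (by simpa using hb), hF,
        Set.indicator_of_notMem (by simpa using hb)]
      simp
  have hsq : Integrable (fun ξ : E n => lowSymbol A ξ ^ 2) := by
    refine hint.mono' ((lowSymbol_measurable A).pow_const 2).aestronglyMeasurable ?_
    filter_upwards [hle] with ξ hξ
    rwa [Real.norm_of_nonneg (sq_nonneg _)]
  have hmem : MemLp (fun ξ : E n => lowSymbol A ξ) 2 volume :=
    (memLp_two_iff_integrable_sq (lowSymbol_measurable A).aestronglyMeasurable).mpr hsq
  refine ⟨hmem.ofReal, ?_⟩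
  rw [norm_sq_toLp_ofReal, ← hval]
  exact integral_mono_ae hsq hint hle

theorem sphereConst_pos (hn1 : 1 ≤ n) : 0 < sphereConst n := by
  unfold sphereConst
  have : 0 < (volume : Measure (E n)).real (Metric.ball 0 1) :=
    ENNReal.toReal_pos (Metric.measure_ball_pos _ _ one_pos).ne' measure_ball_lt_top.ne
  have : (0 : ℝ) < n := by exact_mod_cast hn1
  positivity

/-- The frequencies are cut at a height `A` depending on `t`. The low part never exceeds `t / 2`, so
where the function exceeds `t` the high part is at least `t / 2`; Chebyshev and Plancherel bound the
measure of that set. -/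
theorem measure_lt_mult_bessel_le (hn1 : 1 ≤ n) (hn3 : n ≤ 3) (g : L2 n) (hg : g ≠ 0) {t : ℝ}
    (ht : 0 < t) :
    volume {x | t < ‖mult besselSymbol essBdd_besselSymbol g x‖} ≤
      ENNReal.ofReal (4 / t ^ 2) * ∫⁻ ξ, {ξ : E n | t ^ 2 ≤ 4 * sphereConst n * ‖g‖ ^ 2 * ‖ξ‖}.indicator
        (fun ξ => ENNReal.ofReal ((1 + ‖ξ‖ ^ 2)⁻¹) * ‖(𝓕 g : L2 n) ξ‖ₑ ^ 2) ξ := by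
  have hG : 0 < ‖g‖ := norm_pos_iff.mpr hg
  have hS := sphereConst_pos hn1
  -- This is the value for which `sphereConst n * A * ‖g‖ ^ 2 = (t / 2) ^ 2`.
  set A : ℝ := t ^ 2 / (4 * sphereConst n * ‖g‖ ^ 2) with hA
  have hA0 : 0 < A := by positivity
  obtain ⟨hl2, hl⟩ := lowSymbol_memLp hn1 hn3 hA0
  set u := mult besselSymbol essBdd_besselSymbol g with hu
  set l := mult (lowSymbol A) (essBdd_lowSymbol A) g with hl'
  have hlow : ∀ᵐ x, ‖l x‖ ≤ t / 2 := by
    filter_upwards [norm_mult_ae_le (essBdd_lowSymbol A) hl2 g] with x hx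
    refine hx.trans (le_of_sq_le_sq ?_ (by positivity))
    rw [mul_pow]
    calc _ ≤ (sphereConst n * A) * ‖g‖ ^ 2 := by gcongr
      _ = (t / 2) ^ 2 := by rw [hA]; field_simp; norm_num
  set h := u - l with hh
  have hsub : volume {x | t < ‖u x‖} ≤ volume {x | ENNReal.ofReal (t ^ 2 / 4) ≤ ‖h x‖ₑ ^ 2} := by
    refine measure_mono_ae ?_
    filter_upwards [hlow, Lp.coeFn_sub u l] with x hx1 hx2 (hx3 : t < ‖u x‖)
    change ENNReal.ofReal (t ^ 2 / 4) ≤ ‖h x‖ₑ ^ 2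
    rw [← ofReal_norm, ← ENNReal.ofReal_pow (norm_nonneg _)]
    refine ENNReal.ofReal_le_ofReal ?_
    rw [hh, hx2, Pi.sub_apply]
    have h1 := norm_sub_norm_le (u x) (l x)
    have h2 : t / 2 ≤ ‖u x - l x‖ := by linarith
    calc t ^ 2 / 4 = (t / 2) ^ 2 := by ring
      _ ≤ _ := by gcongr
  have hcheb := mul_meas_ge_le_lintegral₀ (μ := volume) (f := fun x => ‖h x‖ₑ ^ 2)
    ((Lp.aestronglyMeasurable h).enorm.pow_const 2) (ENNReal.ofReal (t ^ 2 / 4))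
  have hFh : ∫⁻ x, ‖h x‖ₑ ^ 2 ≤ ∫⁻ ξ, {ξ : E n | t ^ 2 ≤ 4 * sphereConst n * ‖g‖ ^ 2 * ‖ξ‖}.indicator
        (fun ξ => ENNReal.ofReal ((1 + ‖ξ‖ ^ 2)⁻¹) * ‖(𝓕 g : L2 n) ξ‖ₑ ^ 2) ξ := by
    rw [← lintegral_enorm_sq_fourier, hh, fourier_sub_L2]
    refine lintegral_mono_ae ?_
    filter_upwards [Lp.coeFn_sub (𝓕 u : L2 n) (𝓕 l : L2 n),
      fourier_mult_ae essBdd_besselSymbol g, fourier_mult_ae (essBdd_lowSymbol A) g]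
      with ξ h1 h2 h3
    rw [h1, Pi.sub_apply, hu, h2, hl', h3, ← sub_mul]
    by_cases hξ : ‖ξ‖ < A
    · rw [lowSymbol, Set.indicator_of_mem (by simpa using hξ), sub_self]
      simp
    · rw [lowSymbol, Set.indicator_of_notMem (by simpa using hξ), Set.indicator_of_mem]
      · rw [enorm_mul, mul_pow]
        gcongr
        rw [Complex.ofReal_zero, sub_zero, ← ofReal_norm, ← ENNReal.ofReal_pow (norm_nonneg _),
          Complex.norm_real, Real.norm_eq_abs, sq_abs, besselSymbol_sq]
      · rw [not_lt, hA, div_le_iff₀ (by positivity)] at hξ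
        change t ^ 2 ≤ _
        linarith
  calc volume {x | t < ‖u x‖} ≤ volume {x | ENNReal.ofReal (t ^ 2 / 4) ≤ ‖h x‖ₑ ^ 2} := hsub
    _ = ENNReal.ofReal (4 / t ^ 2) * (ENNReal.ofReal (t ^ 2 / 4) *
          volume {x | ENNReal.ofReal (t ^ 2 / 4) ≤ ‖h x‖ₑ ^ 2}) := by
        rw [← mul_assoc, ← ENNReal.ofReal_mul (by positivity)]
        have : 4 / t ^ 2 * (t ^ 2 / 4) = 1 := by field_simp
        rw [this, ENNReal.ofReal_one, one_mul]
    _ ≤ _ := by gcongr; exact hcheb.trans hFh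

/-- The Sobolev embedding `H¹ ⊂ L⁶` in dimension at most three. -/
theorem memLp_six_mult_bessel (hn1 : 1 ≤ n) (hn3 : n ≤ 3) (g : L2 n) :
    MemLp (mult besselSymbol essBdd_besselSymbol g) 6 volume := by
  rcases eq_or_ne g 0 with rfl | hg
  · rw [map_zero]; exact (MemLp.zero (p := 6) (μ := volume)).ae_eq (Lp.coeFn_zero ℂ 2 volume).symm
  set u := mult besselSymbol essBdd_besselSymbol g with hu
  refine ⟨Lp.aestronglyMeasurable u, ?_⟩
  rw [eLpNorm_lt_top_iff_lintegral_rpow_enorm_lt_top (by norm_num) (by norm_num)]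
  have hS := sphereConst_pos hn1
  have hG : 0 < ‖g‖ := norm_pos_iff.mpr hg
  set c : ℝ := 4 * sphereConst n * ‖g‖ ^ 2 with hc
  have hc0 : 0 < c := by positivity
  set w : E n → ℝ≥0∞ := fun ξ => ENNReal.ofReal ((1 + ‖ξ‖ ^ 2)⁻¹) * ‖(𝓕 g : L2 n) ξ‖ₑ ^ 2 with hw
  have hwm : AEMeasurable w volume := by
    have hcont : Continuous fun ξ : E n => ENNReal.ofReal ((1 + ‖ξ‖ ^ 2)⁻¹) :=
      ENNReal.continuous_ofReal.comp (Continuous.inv₀ (by fun_prop) fun ξ => by positivity)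
    refine hcont.measurable.aemeasurable.mul ?_
    exact (Lp.aestronglyMeasurable _).enorm.pow_const 2
  have h1 : ∫⁻ x, ‖u x‖ₑ ^ (6 : ℝ≥0∞).toReal = ∫⁻ x, ENNReal.ofReal (‖u x‖ ^ (6 : ℝ)) := by
    refine lintegral_congr fun x => ?_
    rw [← ofReal_norm, ENNReal.ofReal_rpow_of_nonneg (norm_nonneg _) (by norm_num)]
    norm_num
  -- Layer-cake formula: the sixth power costs a weight t⁵, and the Chebyshev factor 4 / t² reduces
  -- it to 4 t³.
  rw [h1, lintegral_rpow_eq_lintegral_meas_lt_mul volume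
    (Eventually.of_forall fun x => norm_nonneg (u x))
    (Lp.aestronglyMeasurable u).norm.aemeasurable (by norm_num)]
  refine ENNReal.mul_lt_top ENNReal.ofReal_lt_top ?_
  set k : ℝ → E n → ℝ≥0∞ := fun t ξ => ENNReal.ofReal (4 * t ^ 3) *
    {ξ : E n | t ^ 2 ≤ c * ‖ξ‖}.indicator w ξ with hk
  have h2 : ∫⁻ t in Set.Ioi (0 : ℝ), volume {x | t < ‖u x‖} * ENNReal.ofReal (t ^ ((6 : ℝ) - 1))
      ≤ ∫⁻ t in Set.Ioi (0 : ℝ), ∫⁻ ξ, k t ξ := by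
    refine setLIntegral_mono' measurableSet_Ioi fun t (ht : 0 < t) => ?_
    have h3 := measure_lt_mult_bessel_le hn1 hn3 g hg ht
    rw [hk]
    simp only
    rw [lintegral_const_mul' _ _ ENNReal.ofReal_ne_top]
    calc _ ≤ (ENNReal.ofReal (4 / t ^ 2) * ∫⁻ ξ, {ξ : E n | t ^ 2 ≤ c * ‖ξ‖}.indicator w ξ)
          * ENNReal.ofReal (t ^ ((6 : ℝ) - 1)) := by gcongr
      _ = (ENNReal.ofReal (4 / t ^ 2) * ENNReal.ofReal (t ^ ((6 : ℝ) - 1))) *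
            ∫⁻ ξ, {ξ : E n | t ^ 2 ≤ c * ‖ξ‖}.indicator w ξ := by ring
      _ = _ := by
        rw [← ENNReal.ofReal_mul (by positivity)]
        congr 2
        have : (6 : ℝ) - 1 = ((5 : ℕ) : ℝ) := by norm_num
        rw [this, Real.rpow_natCast]
        field_simp
  refine h2.trans_lt ?_
  have hkm : AEMeasurable (Function.uncurry k)
      ((volume.restrict (Set.Ioi (0 : ℝ))).prod (volume : Measure (E n))) := by
    have e : Function.uncurry k = fun p : ℝ × E n => ENNReal.ofReal (4 * p.1 ^ 3) *
        {p : ℝ × E n | p.1 ^ 2 ≤ c * ‖p.2‖}.indicator (fun p => w p.2) p := by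
      ext ⟨t, ξ⟩
      simp only [Function.uncurry, hk, Set.indicator, Set.mem_ofPred_eq]
    rw [e]
    refine AEMeasurable.mul (Measurable.aemeasurable (by fun_prop)) ?_
    refine AEMeasurable.indicator ?_ (measurableSet_le (by fun_prop) (by fun_prop))
    exact hwm.comp_quasiMeasurePreserving Measure.quasiMeasurePreserving_snd
  rw [lintegral_lintegral_swap hkm]
  -- After exchanging the integrals, only t ≤ T = √(c|ξ|) contributes at a fixed ξ. The crude bound
  -- 4 T³ · T = 4 c² |ξ|² is compensated by the factor (1 + |ξ|²)⁻¹ in `w`.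
  have h4 : ∀ ξ, ∫⁻ t in Set.Ioi (0 : ℝ), k t ξ ≤ ENNReal.ofReal (4 * c ^ 2) * ‖(𝓕 g : L2 n) ξ‖ₑ ^ 2 := by
    intro ξ
    set T := √(c * ‖ξ‖) with hT
    have h5 : ∀ t ∈ Set.Ioi (0 : ℝ), k t ξ ≤
        (Set.Iic T).indicator (fun _ => ENNReal.ofReal (4 * T ^ 3) * w ξ) t := by
      intro t (ht : 0 < t)
      by_cases h : t ^ 2 ≤ c * ‖ξ‖
      · have htT : t ≤ T := Real.le_sqrt_of_sq_le h
        rw [Set.indicator_of_mem (show t ∈ Set.Iic T from htT)]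
        simp only [hk]
        rw [Set.indicator_of_mem (show ξ ∈ {ξ : E n | t ^ 2 ≤ c * ‖ξ‖} from h)]
        gcongr
      · simp only [hk]
        rw [Set.indicator_of_notMem (show ξ ∉ {ξ : E n | t ^ 2 ≤ c * ‖ξ‖} from h), mul_zero]
        exact zero_le
    calc ∫⁻ t in Set.Ioi (0 : ℝ), k t ξ
        ≤ ∫⁻ t in Set.Ioi (0 : ℝ),
          (Set.Iic T).indicator (fun _ => ENNReal.ofReal (4 * T ^ 3) * w ξ) t :=
          setLIntegral_mono' measurableSet_Ioi h5
      _ = ENNReal.ofReal (4 * T ^ 3) * w ξ * ENNReal.ofReal T := by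
          rw [lintegral_indicator measurableSet_Iic, Measure.restrict_restrict measurableSet_Iic,
            Set.inter_comm, Set.Ioi_inter_Iic, setLIntegral_const, Real.volume_Ioc, sub_zero]
      _ = ENNReal.ofReal (4 * T ^ 3 * T * (1 + ‖ξ‖ ^ 2)⁻¹) * ‖(𝓕 g : L2 n) ξ‖ₑ ^ 2 := by
          have hT0 : 0 ≤ 4 * T ^ 3 := by positivity
          have hT1 : 0 ≤ 4 * T ^ 3 * T := by positivity
          rw [ENNReal.ofReal_mul hT1, ENNReal.ofReal_mul hT0, hw]
          ring
      _ ≤ _ := by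
          refine mul_le_mul_left (ENNReal.ofReal_le_ofReal ?_) _
          have h6 : T ^ 2 = c * ‖ξ‖ := Real.sq_sqrt (by positivity)
          have h7 : 4 * T ^ 3 * T = 4 * c ^ 2 * ‖ξ‖ ^ 2 := by
            calc 4 * T ^ 3 * T = 4 * (T ^ 2) ^ 2 := by ring
              _ = _ := by rw [h6]; ring
          rw [h7, mul_assoc]
          refine mul_le_of_le_one_right (by positivity) ?_
          rw [← div_eq_mul_inv, div_le_one (by positivity)]
          linarith
  calc ∫⁻ ξ, ∫⁻ t in Set.Ioi (0 : ℝ), k t ξ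
      ≤ ∫⁻ ξ, ENNReal.ofReal (4 * c ^ 2) * ‖(𝓕 g : L2 n) ξ‖ₑ ^ 2 := lintegral_mono h4
    _ = ENNReal.ofReal (4 * c ^ 2) * ∫⁻ ξ, ‖(𝓕 g : L2 n) ξ‖ₑ ^ 2 :=
        lintegral_const_mul' _ _ ENNReal.ofReal_ne_top
    _ < ⊤ := ENNReal.mul_lt_top ENNReal.ofReal_lt_top (lintegral_enorm_sq_lt_top _)

end Embedding

end

end ThirdHarmonic

namespace ThirdHarmonic

open Filter Topology FourierTransform
open scoped InnerProductSpace ENNReal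

noncomputable section

/-! ### From compactly supported test functions to tempered distributions. -/

section WeakLaplacian

variable {n : ℕ}

theorem two_le_smooth : ((2 : ℕ) : WithTop ℕ∞) ≤ ((⊤ : ℕ∞) : WithTop ℕ∞) := by
  exact WithTop.coe_le_coe.mpr (le_top : ((2 : ℕ) : ℕ∞) ≤ ⊤)

/-- A smooth function equal to one on the unit ball and supported in the ball of radius two. -/
def cutoffBump (n : ℕ) : ContDiffBump (0 : E n) := ⟨1, 2, one_pos, one_lt_two⟩

/-- Smooth cutoff functions exhausting `ℝⁿ`. -/
def cutoff (k : ℕ) (x : E n) : ℝ := cutoffBump n (((k : ℝ) + 1)⁻¹ • x)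

theorem contDiff_cutoff (k : ℕ) {m : ℕ∞} : ContDiff ℝ m (cutoff k : E n → ℝ) :=
  (cutoffBump n).contDiff.comp (by fun_prop)

theorem hasCompactSupport_cutoff (k : ℕ) : HasCompactSupport (cutoff k : E n → ℝ) :=
  (cutoffBump n).hasCompactSupport.comp_smul (by positivity)

theorem cutoff_eventually_one (x : E n) : ∀ᶠ k : ℕ in atTop, cutoff k =ᶠ[𝓝 x] fun _ => 1 := by
  filter_upwards [eventually_gt_atTop ⌈‖x‖⌉₊] with k hk
  have h1 : ‖x‖ < (k : ℝ) + 1 := by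
    have := Nat.lt_of_ceil_lt hk
    linarith
  have h2 : ∀ᶠ y in 𝓝 x, ‖y‖ < (k : ℝ) + 1 := continuous_norm.continuousAt.eventually_lt_const h1
  filter_upwards [h2] with y hy
  refine (cutoffBump n).one_of_mem_closedBall ?_
  have hk0 : (0 : ℝ) < (k : ℝ) + 1 := by positivity
  rw [mem_closedBall_zero_iff, norm_smul, norm_inv, Real.norm_of_nonneg hk0.le]
  change _ ≤ (1 : ℝ)
  rw [inv_mul_le_iff₀ hk0]
  linarith

/-- Dilating by the factor k + 1 ≥ 1 can only shrink derivatives, so the bounds of the fixed bump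
serve for every `k`. -/
theorem exists_cutoff_bound (i : ℕ) :
    ∃ C, 0 ≤ C ∧ ∀ (k : ℕ) (x : E n), ‖iteratedFDeriv ℝ i (cutoff k : E n → ℝ) x‖ ≤ C := by
  have hc : HasCompactSupport (iteratedFDeriv ℝ i (cutoffBump n)) :=
    (cutoffBump n).hasCompactSupport.iteratedFDeriv i
  have hcont : Continuous (iteratedFDeriv ℝ i (cutoffBump n)) :=
    ((cutoffBump n).contDiff (n := (⊤ : ℕ∞))).continuous_iteratedFDeriv (mod_cast le_top)
  obtain ⟨C, hC⟩ := hcont.bounded_above_of_compact_support hc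
  refine ⟨C, (norm_nonneg _).trans (hC 0), fun k x => ?_⟩
  set L : E n →L[ℝ] E n := ((k : ℝ) + 1)⁻¹ • ContinuousLinearMap.id ℝ (E n) with hL
  have hLn : ‖L‖ ≤ 1 := by
    rw [hL, norm_smul, norm_inv, Real.norm_of_nonneg (by positivity)]
    have h1 := ContinuousLinearMap.norm_id_le (𝕜 := ℝ) (E := E n)
    have h2 : ((k : ℝ) + 1)⁻¹ ≤ 1 := inv_le_one_of_one_le₀ (by
      have : (0 : ℝ) ≤ k := Nat.cast_nonneg k
      linarith)
    exact mul_le_one₀ h2 (norm_nonneg _) h1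
  have h1 : (cutoff k : E n → ℝ) = cutoffBump n ∘ L := by
    ext y; simp [cutoff, hL]
  rw [h1, L.iteratedFDeriv_comp_right ((cutoffBump n).contDiff (n := (i : ℕ∞))) x le_rfl]
  refine (ContinuousMultilinearMap.norm_compContinuousLinearMap_le _ _).trans ?_
  calc _ ≤ C * 1 := by
        refine mul_le_mul (hC _) ?_ (Finset.prod_nonneg fun _ _ => norm_nonneg _)
          ((norm_nonneg _).trans (hC 0))
        exact Finset.prod_le_one (fun _ _ => norm_nonneg _) fun _ _ => hLn
    _ = C := mul_one C

theorem abs_laplacian_le (f : E n → ℝ) (x : E n) : |Δ f x| ≤ n * ‖iteratedFDeriv ℝ 2 f x‖ := by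
  rw [InnerProductSpace.laplacian_eq_iteratedFDeriv_stdOrthonormalBasis]
  refine (Finset.abs_sum_le_sum_abs _ _).trans ?_
  refine (Finset.sum_le_card_nsmul _ _ ‖iteratedFDeriv ℝ 2 f x‖ fun i _ => ?_).trans ?_
  · refine ((iteratedFDeriv ℝ 2 f x).le_opNorm _).trans ?_
    simp [Fin.prod_univ_two]
  · rw [Finset.card_univ, Fintype.card_fin, finrank_euclideanSpace_fin, nsmul_eq_mul]

theorem memLp_iteratedFDeriv (ψ : 𝓢(E n, ℝ)) (j : ℕ) :
    MemLp (fun x => ‖iteratedFDeriv ℝ j ψ x‖) 2 (volume : Measure (E n)) := by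
  have hcont : Continuous fun x => ‖iteratedFDeriv ℝ j ψ x‖ :=
    ((ψ.smooth ⊤).continuous_iteratedFDeriv (mod_cast le_top)).norm
  rw [memLp_two_iff_integrable_sq hcont.aestronglyMeasurable]
  obtain ⟨C, hC⟩ := ψ.decay' 0 j
  have h1 : Integrable (fun x => C * ‖iteratedFDeriv ℝ j ψ x‖) (volume : Measure (E n)) := by
    have := (ψ.integrable_pow_mul_iteratedFDeriv volume 0 j).const_mul C
    simpa using this
  refine h1.mono' (hcont.pow 2).aestronglyMeasurable (Eventually.of_forall fun x => ?_)
  have h2 := hC x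
  simp only [pow_zero, one_mul] at h2
  rw [Real.norm_of_nonneg (sq_nonneg _), sq]
  exact mul_le_mul_of_nonneg_right h2 (norm_nonneg _)

/-- A pair `(u, g)` of functions satisfies `Δ u = g` weakly. -/
def WeakLaplacian (u g : L2 n) : Prop :=
  ∀ φ : E n → ℝ, ContDiff ℝ (⊤ : ℕ∞) φ → HasCompactSupport φ →
    ∫ x, ((Δ φ x : ℂ) * u x - (φ x : ℂ) * g x) = 0

/-- The test functions `cutoff k * ψ` approximate `ψ`: near each point they eventually coincide with
it, and the product rule with the uniform bounds on the cutoffs gives a dominating function. -/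
theorem WeakLaplacian.schwartz {u g : L2 n} (h : WeakLaplacian u g) (ψ : 𝓢(E n, ℝ)) :
    Integrable (fun x => (Δ (ψ : E n → ℝ) x : ℂ) * u x - (ψ x : ℂ) * g x) ∧
      ∫ x, ((Δ (ψ : E n → ℝ) x : ℂ) * u x - (ψ x : ℂ) * g x) = 0 := by
  obtain ⟨C0, hC0, hb0⟩ := exists_cutoff_bound (n := n) 0
  obtain ⟨C1, hC1, hb1⟩ := exists_cutoff_bound (n := n) 1
  obtain ⟨C2, hC2, hb2⟩ := exists_cutoff_bound (n := n) 2
  set bd : E n → ℝ := fun x => (n * (C0 * ‖iteratedFDeriv ℝ 2 ψ x‖ +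
    2 * C1 * ‖iteratedFDeriv ℝ 1 ψ x‖ + C2 * ‖iteratedFDeriv ℝ 0 ψ x‖)) * ‖u x‖ +
    (C0 * ‖iteratedFDeriv ℝ 0 ψ x‖) * ‖g x‖ with hbd
  have hbdint : Integrable bd := by
    have h2 := memLp_iteratedFDeriv ψ 2
    have h1 := memLp_iteratedFDeriv ψ 1
    have h0 := memLp_iteratedFDeriv ψ 0
    have hu := (Lp.memLp u).norm
    have hg := (Lp.memLp g).norm
    refine Integrable.add ?_ ?_
    · exact ((((h2.const_mul C0).add (h1.const_mul (2 * C1))).add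
        (h0.const_mul C2)).const_mul n).integrable_mul hu
    · exact (h0.const_mul C0).integrable_mul hg
  set φ : ℕ → E n → ℝ := fun k x => cutoff k x * ψ x with hφ
  have hφs : ∀ k, ContDiff ℝ (⊤ : ℕ∞) (φ k) := fun k => (contDiff_cutoff k).mul (ψ.smooth ⊤)
  have hφc : ∀ k, HasCompactSupport (φ k) := fun k => (hasCompactSupport_cutoff k).mul_right
  have hD2 : ∀ k x, ‖iteratedFDeriv ℝ 2 (φ k) x‖ ≤ C0 * ‖iteratedFDeriv ℝ 2 ψ x‖ +
      2 * C1 * ‖iteratedFDeriv ℝ 1 ψ x‖ + C2 * ‖iteratedFDeriv ℝ 0 ψ x‖ := by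
    intro k x
    have h1 := norm_iteratedFDeriv_mul_le (𝕜 := ℝ) (N := (⊤ : ℕ∞)) (contDiff_cutoff (n := n) k)
      (ψ.smooth ⊤) x (n := 2) two_le_smooth
    refine h1.trans ?_
    simp only [Finset.sum_range_succ, Finset.sum_range_zero, zero_add, Nat.choose_zero_right,
      Nat.cast_one, one_mul, Nat.choose_one_right, Nat.cast_ofNat, Nat.choose_self,
      Nat.add_one_sub_one, Nat.reduceAdd]
    have := hb0 k x
    have := hb1 k x
    have := hb2 k x
    gcongr
  have hφ0 : ∀ k x, |φ k x| ≤ C0 * ‖iteratedFDeriv ℝ 0 ψ x‖ := by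
    intro k x
    have h1 := hb0 k x
    rw [norm_iteratedFDeriv_zero, Real.norm_eq_abs] at h1 ⊢
    rw [hφ, abs_mul]
    gcongr
  have hbound : ∀ k, ∀ᵐ x, ‖(Δ (φ k) x : ℂ) * u x - (φ k x : ℂ) * g x‖ ≤ bd x := by
    intro k
    refine Eventually.of_forall fun x => (norm_sub_le _ _).trans ?_
    rw [norm_mul, norm_mul, Complex.norm_real, Complex.norm_real, Real.norm_eq_abs,
      Real.norm_eq_abs]
    refine add_le_add (mul_le_mul_of_nonneg_right ?_ (norm_nonneg _))
      (mul_le_mul_of_nonneg_right (hφ0 k x) (norm_nonneg _))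
    exact (abs_laplacian_le _ x).trans (mul_le_mul_of_nonneg_left (hD2 k x) (Nat.cast_nonneg n))
  have hlim : ∀ᵐ x, Tendsto (fun k => (Δ (φ k) x : ℂ) * u x - (φ k x : ℂ) * g x) atTop
      (𝓝 ((Δ (ψ : E n → ℝ) x : ℂ) * u x - (ψ x : ℂ) * g x)) := by
    refine Eventually.of_forall fun x => ?_
    refine tendsto_const_nhds.congr' ?_
    filter_upwards [cutoff_eventually_one x] with k hk
    have h1 : φ k =ᶠ[𝓝 x] ψ := by
      filter_upwards [hk] with y hy
      simp only [hφ, hy, one_mul]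
    rw [(InnerProductSpace.laplacian_congr_nhds h1).eq_of_nhds, h1.eq_of_nhds]
  have hcontLap : ∀ f : E n → ℝ, ContDiff ℝ (⊤ : ℕ∞) f → Continuous (Δ f) := by
    intro f hf
    rw [InnerProductSpace.laplacian_eq_iteratedFDeriv_stdOrthonormalBasis]
    refine continuous_finsetSum _ fun i _ => ?_
    exact (continuous_eval_const _).comp
      (hf.continuous_iteratedFDeriv (m := 2) two_le_smooth)
  have hmeas : ∀ f : E n → ℝ, ContDiff ℝ (⊤ : ℕ∞) f →
      AEStronglyMeasurable (fun x => (Δ f x : ℂ) * u x - (f x : ℂ) * g x) volume := by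
    intro f hf
    refine AEStronglyMeasurable.sub (AEStronglyMeasurable.mul ?_ (Lp.aestronglyMeasurable u))
      (AEStronglyMeasurable.mul ?_ (Lp.aestronglyMeasurable g))
    · exact (Complex.continuous_ofReal.comp (hcontLap f hf)).aestronglyMeasurable
    · exact (Complex.continuous_ofReal.comp hf.continuous).aestronglyMeasurable
  constructor
  · refine hbdint.mono' (hmeas ψ (ψ.smooth ⊤)) ?_
    filter_upwards [hlim, ae_all_iff.mpr hbound] with x h1 h2
    exact le_of_tendsto' h1.norm h2
  · have h3 := tendsto_integral_of_dominated_convergence bd (fun k => hmeas (φ k) (hφs k)) hbdint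
      hbound hlim
    refine tendsto_nhds_unique h3 ?_
    simp only [h (φ _) (hφs _) (hφc _)]
    exact tendsto_const_nhds

theorem WeakLaplacian.laplacian_eq {u g : L2 n} (h : WeakLaplacian u g) :
    Δ (u : 𝓢'(E n, ℂ)) = (g : 𝓢'(E n, ℂ)) := by
  ext ψ
  rw [TemperedDistribution.laplacian_apply_apply, Lp.toTemperedDistribution_apply,
    Lp.toTemperedDistribution_apply]
  -- The weak formulation only tests real functions, so the real and imaginary parts are tested
  -- separately and recombined.
  set ψr : 𝓢(E n, ℝ) := ψ.postcompCLM Complex.reCLM with hψr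
  set ψi : 𝓢(E n, ℝ) := ψ.postcompCLM Complex.imCLM with hψi
  obtain ⟨hr1, hr2⟩ := h.schwartz ψr
  obtain ⟨hi1, hi2⟩ := h.schwartz ψi
  have hr : ∀ x, ψr x = (ψ x).re := fun x => rfl
  have hi : ∀ x, ψi x = (ψ x).im := fun x => rfl
  have hψ2 : ∀ x, ContDiffAt ℝ 2 ψ x := fun x => (ψ.smooth 2).contDiffAt
  have hLr : ∀ x, Δ (ψr : E n → ℝ) x = (Δ (ψ : E n → ℂ) x).re := fun x =>
    (hψ2 x).laplacian_CLM_comp_left (l := Complex.reCLM)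
  have hLi : ∀ x, Δ (ψi : E n → ℝ) x = (Δ (ψ : E n → ℂ) x).im := fun x =>
    (hψ2 x).laplacian_CLM_comp_left (l := Complex.imCLM)
  have hsum : ∫ x, ((Δ (ψ : E n → ℂ) x) * u x - ψ x * g x) = 0 := by
    have h1 : ∫ x, (((Δ (ψr : E n → ℝ) x : ℂ) * u x - (ψr x : ℂ) * g x) + Complex.I *
        ((Δ (ψi : E n → ℝ) x : ℂ) * u x - (ψi x : ℂ) * g x)) = 0 := by
      rw [integral_add hr1 (hi1.const_mul _), hr2, integral_const_mul, hi2]; simp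
    rw [← h1]
    refine integral_congr_ae (Eventually.of_forall fun x => ?_)
    simp only [hLr, hLi, hr, hi]
    conv_lhs => rw [← Complex.re_add_im (Δ (ψ : E n → ℂ) x), ← Complex.re_add_im (ψ x)]
    ring
  have hint : ∀ (χ : 𝓢(E n, ℂ)) (f : L2 n), Integrable (fun x => χ x * f x) := fun χ f =>
    (χ.memLp 2).integrable_mul (Lp.memLp f)
  have h2 : ∀ x, (Δ ψ : 𝓢(E n, ℂ)) x = Δ (ψ : E n → ℂ) x := fun x =>
    SchwartzMap.laplacian_apply ψ x
  simp only [← h2] at hsum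
  rw [integral_sub (hint _ _) (hint _ _), sub_eq_zero] at hsum
  exact hsum

end WeakLaplacian

/-! ### The profiles P and Q belong to H² and are bounded. -/

section Regularity

variable {n : ℕ}

/-- The square of the symbol is comparable to (1 + |ξ|²)⁻², which is integrable exactly in
dimensions below four. Both the embedding H² ⊂ L^∞ and the compactness of the potentials rest on
this. -/
theorem resSymbol_memLp (hn3 : n ≤ 3) {κ : ℝ} (hκ : 0 < κ) :
    MemLp (fun ξ => (resSymbol κ ξ : ℂ)) 2 (volume : Measure (E n)) := by
  have hcont := continuous_resSymbol (n := n) hκ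
  refine MemLp.ofReal (K := ℂ) ((memLp_two_iff_integrable_sq hcont.aestronglyMeasurable).mpr ?_)
  set C : ℝ := max κ⁻¹ 1 with hC
  have hC1 : 1 ≤ C := le_max_right _ _
  have hCκ : 1 ≤ C * κ := by
    have : κ⁻¹ ≤ C := le_max_left _ _
    calc 1 = κ⁻¹ * κ := (inv_mul_cancel₀ hκ.ne').symm
      _ ≤ C * κ := by gcongr
  have hint := (integrable_rpow_neg_one_add_norm_sq (E := E n) (μ := volume) (r := 4) (by
    rw [finrank_euclideanSpace_fin]
    have : (n : ℝ) ≤ 3 := by exact_mod_cast hn3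
    linarith)).const_mul (C ^ 2)
  refine hint.mono' (hcont.pow 2).aestronglyMeasurable (Eventually.of_forall fun ξ => ?_)
  rw [Real.norm_of_nonneg (sq_nonneg _)]
  have h1 : ((1 : ℝ) + ‖ξ‖ ^ 2) ^ (-(4 : ℝ) / 2) = ((1 + ‖ξ‖ ^ 2)⁻¹) ^ 2 := by
    have : -(4 : ℝ) / 2 = -((2 : ℕ) : ℝ) := by norm_num
    rw [this, Real.rpow_neg (by positivity), Real.rpow_natCast, inv_pow]
  rw [h1, ← mul_pow]
  refine pow_le_pow_left₀ (resSymbol_pos hκ ξ).le ?_ 2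
  rw [resSymbol, ← div_eq_mul_inv, inv_eq_one_div, div_le_div_iff₀ (add_lapSymbol_pos hκ ξ)
    (by positivity), one_mul, mul_add, lapSymbol]
  have h2 : 1 ≤ (2 * Real.pi) ^ 2 := by nlinarith [Real.pi_gt_three]
  have h3 : ‖ξ‖ ^ 2 ≤ C * ((2 * Real.pi) ^ 2 * ‖ξ‖ ^ 2) := by
    have h4 : 1 ≤ C * (2 * Real.pi) ^ 2 := by nlinarith
    calc ‖ξ‖ ^ 2 = 1 * ‖ξ‖ ^ 2 := (one_mul _).symm
      _ ≤ C * (2 * Real.pi) ^ 2 * ‖ξ‖ ^ 2 := by gcongr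
      _ = _ := by ring
  linarith

/-- The embedding `H² ⊂ L^∞` in dimension at most three. -/
theorem exists_bound_H2 (hn3 : n ≤ 3) (u : H2 n) : ∃ C, ∀ᵐ x, ‖(u : L2 n) x‖ ≤ C := by
  have h := norm_mult_ae_le (essBdd_resSymbol one_pos) (resSymbol_memLp hn3 one_pos)
    (((1 : ℝ) : ℂ) • (u : L2 n) - lap u)
  have e : mult (resSymbol 1) (essBdd_resSymbol one_pos) (((1 : ℝ) : ℂ) • (u : L2 n) - lap u) = u :=
    res_sub_lap one_pos u
  rw [e] at h
  exact ⟨_, h⟩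

theorem memLp_six_of_memSobolev (hn1 : 1 ≤ n) (hn3 : n ≤ 3) {u : L2 n}
    (h : TemperedDistribution.MemSobolev 1 2 (u : 𝓢'(E n, ℂ))) : MemLp u 6 volume := by
  obtain ⟨g, hg⟩ := h
  have hm : (fun ξ : E n => (((1 + ‖ξ‖ ^ 2) ^ ((1 : ℝ) / 2) : ℝ) : ℂ)).HasTemperateGrowth := by
    fun_prop
  have h1 := (fourierMultiplierCLM_eq_iff hm u g).mp hg
  have h2 : u = mult besselSymbol essBdd_besselSymbol g := by
    apply eq_of_fourier_ae
    filter_upwards [h1, fourier_mult_ae essBdd_besselSymbol g] with ξ h3 h4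
    rw [h4, h3, besselSymbol, Real.sqrt_eq_rpow, ← mul_assoc, ← Complex.ofReal_mul,
      inv_mul_cancel₀ (by positivity), Complex.ofReal_one, one_mul]
  rw [h2]
  exact memLp_six_mult_bessel hn1 hn3 g

theorem MemH1.memLp {P : E n → ℝ} (hP : MemH1 P) : MemLp P 2 volume := by
  obtain ⟨h, -⟩ := hP
  simpa using h.re

theorem MemH1.memLp_six (hn1 : 1 ≤ n) (hn3 : n ≤ 3) {P : E n → ℝ} (hP : MemH1 P) :
    MemLp P 6 volume := by
  obtain ⟨h, hs⟩ := hP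
  have h1 := (memLp_six_of_memSobolev hn1 hn3 hs).ae_eq h.coeFn_toLp
  simpa using h1.re

theorem memLp_two_mul_mul {f g h : E n → ℝ} (hf : MemLp f 6 volume) (hg : MemLp g 6 volume)
    (hh : MemLp h 6 volume) : MemLp (fun x => f x * g x * h x) 2 volume := by
  have h1 : ENNReal.HolderTriple 6 6 3 := ⟨by
    rw [← ENNReal.toReal_eq_toReal_iff' (by simp) (by simp)]
    rw [ENNReal.toReal_add (by simp) (by simp)]
    simp only [ENNReal.toReal_inv, ENNReal.toReal_ofNat]
    norm_num⟩
  have h2 : ENNReal.HolderTriple 3 6 2 := ⟨by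
    rw [← ENNReal.toReal_eq_toReal_iff' (by simp) (by simp)]
    rw [ENNReal.toReal_add (by simp) (by simp)]
    simp only [ENNReal.toReal_inv, ENNReal.toReal_ofNat]
    norm_num⟩
  have h3 : MemLp (fun x => f x * g x) 3 volume := hg.mul hf
  exact hh.mul h3

theorem exists_H2_of_weak (hn3 : n ≤ 3) {P G : E n → ℝ} (hP : MemLp P 2 volume)
    (hG : MemLp G 2 volume)
    (h : ∀ φ : E n → ℝ, ContDiff ℝ (⊤ : ℕ∞) φ → HasCompactSupport φ →
      ∫ x, (-(P x * Δ φ x) + G x * φ x) = 0) :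
    EssBdd P ∧ ∃ p : H2 n, (p : L2 n) =ᵐ[volume] (fun x => (P x : ℂ)) ∧
      lap p =ᵐ[volume] fun x => (G x : ℂ) := by
  have hPc : MemLp (fun x => (P x : ℂ)) 2 volume := hP.ofReal
  have hGc : MemLp (fun x => (G x : ℂ)) 2 volume := hG.ofReal
  have hweak : WeakLaplacian (hPc.toLp _ : L2 n) (hGc.toLp _) := by
    intro φ hφ hφc
    have h1 := h φ hφ hφc
    rw [← Complex.ofReal_inj, ← integral_complex_ofReal, Complex.ofReal_zero] at h1
    rw [← neg_eq_zero, ← integral_neg, ← h1]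
    refine integral_congr_ae ?_
    filter_upwards [hPc.coeFn_toLp, hGc.coeFn_toLp] with x h2 h3
    rw [h2, h3]
    push_cast
    ring
  have hL := hweak.laplacian_eq
  set p : H2 n := ⟨_, mem_H2_of_laplacian hL⟩ with hp
  have hpP : (p : L2 n) =ᵐ[volume] (fun x => (P x : ℂ)) := hPc.coeFn_toLp
  refine ⟨?_, p, hpP, ?_⟩
  · obtain ⟨C, hC⟩ := exists_bound_H2 hn3 p
    refine essBdd_of_bound hP.1 C ?_
    filter_upwards [hC, hpP] with x h1 h2
    rwa [h2, Complex.norm_real, Real.norm_eq_abs] at h1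
  · rw [lap_unique p _ hL]
    exact hGc.coeFn_toLp

/-- Once P and Q are in L⁶, Hölder puts every cubic term in L². The equations then give Laplacians
in L² in a single step, without a bootstrap. -/
theorem SolvesStationary.regularity (hn1 : 1 ≤ n) (hn3 : n ≤ 3) {μ σ ω : ℝ} {P Q : E n → ℝ}
    (hP : MemH1 P) (hQ : MemH1 Q) (hsol : SolvesStationary μ σ ω P Q) :
    EssBdd P ∧ EssBdd Q ∧ ∃ p q : H2 n, (p : L2 n) =ᵐ[volume] (fun x => (P x : ℂ)) ∧
      (q : L2 n) =ᵐ[volume] (fun x => (Q x : ℂ)) ∧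
      (lap p =ᵐ[volume] fun x => (((ω + 1) * P x
        - (1 / 9 * P x ^ 3 + 2 * Q x ^ 2 * P x + 1 / 3 * P x ^ 2 * Q x) : ℝ) : ℂ)) ∧
      (lap q =ᵐ[volume] fun x => (((μ + 3 * σ * ω) * Q x
        - (9 * Q x ^ 3 + 2 * P x ^ 2 * Q x + 1 / 9 * P x ^ 3) : ℝ) : ℂ)) := by
  have hP2 := hP.memLp
  have hQ2 := hQ.memLp
  have hP6 := hP.memLp_six hn1 hn3
  have hQ6 := hQ.memLp_six hn1 hn3
  have hPPP := memLp_two_mul_mul hP6 hP6 hP6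
  have hQQQ := memLp_two_mul_mul hQ6 hQ6 hQ6
  have hQQP := memLp_two_mul_mul hQ6 hQ6 hP6
  have hPPQ := memLp_two_mul_mul hP6 hP6 hQ6
  have hG1 : MemLp (fun x => (ω + 1) * P x
      - (1 / 9 * P x ^ 3 + 2 * Q x ^ 2 * P x + 1 / 3 * P x ^ 2 * Q x)) 2 volume := by
    refine MemLp.ae_eq (Eventually.of_forall fun x => ?_) ((hP2.const_mul (ω + 1)).sub
      (((hPPP.const_mul (1 / 9)).add (hQQP.const_mul 2)).add (hPPQ.const_mul (1 / 3))))
    simp only [Pi.sub_apply, Pi.add_apply]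
    ring
  have hG2 : MemLp (fun x => (μ + 3 * σ * ω) * Q x
      - (9 * Q x ^ 3 + 2 * P x ^ 2 * Q x + 1 / 9 * P x ^ 3)) 2 volume := by
    refine MemLp.ae_eq (Eventually.of_forall fun x => ?_) ((hQ2.const_mul (μ + 3 * σ * ω)).sub
      (((hQQQ.const_mul 9).add (hPPQ.const_mul 2)).add (hPPP.const_mul (1 / 9))))
    simp only [Pi.sub_apply, Pi.add_apply]
    ring
  obtain ⟨hPb, p, hp, hlp⟩ := exists_H2_of_weak hn3 hP2 hG1 fun φ h1 h2 => (hsol φ h1 h2).1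
  obtain ⟨hQb, q, hq, hlq⟩ := exists_H2_of_weak hn3 hQ2 hG2 fun φ h1 h2 => (hsol φ h1 h2).2
  exact ⟨hPb, hQb, p, q, hp, hq, hlp, hlq⟩

end Regularity

end

end ThirdHarmonic

namespace ThirdHarmonic

open Filter Topology FourierTransform
open scoped InnerProductSpace ENNReal ComplexOrder

noncomputable section

/-! ### The heat semigroup and the resolvent preserve and improve positivity. -/

section Positivity

variable {n : ℕ}

/-- An `L²` function with values in `[0, ∞)`. -/
def NonnegL (f : L2 n) : Prop := ∀ᵐ x, 0 ≤ f x

/-- An `L²` function with values in `(0, ∞)`. -/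
def PosL (f : L2 n) : Prop := ∀ᵐ x, 0 < f x

theorem complex_integral_nonneg {α : Type*} [MeasurableSpace α] {ν : Measure α} {f : α → ℂ}
    (h : ∀ᵐ x ∂ν, 0 ≤ f x) : 0 ≤ ∫ x, f x ∂ν := by
  have h1 : ∫ x, f x ∂ν = ∫ x, (((f x).re : ℝ) : ℂ) ∂ν := by
    refine integral_congr_ae ?_
    filter_upwards [h] with x hx
    exact (Complex.eq_re_of_ofReal_le (r := 0) (by simpa using hx))
  rw [h1, integral_complex_ofReal]
  refine Complex.zero_le_real.mpr (integral_nonneg_of_ae ?_)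
  filter_upwards [h] with x hx
  exact (Complex.le_def.mp hx).1

theorem NonnegL.inner {f g : L2 n} (hf : NonnegL f) (hg : NonnegL g) : 0 ≤ ⟪f, g⟫_ℂ := by
  rw [inner_L2]
  refine complex_integral_nonneg ?_
  filter_upwards [hf, hg] with x h1 h2
  exact mul_nonneg h2 (star_nonneg_iff.mpr h1)

/-- The cone of nonnegative functions is self-dual: indicators of sets of finite measure already
detect the sign. The order on ℂ includes vanishing of the imaginary part, so reality is obtained as
well. -/
theorem nonnegL_of_inner {w : L2 n} (h : ∀ ψ : L2 n, NonnegL ψ → 0 ≤ ⟪ψ, w⟫_ℂ) : NonnegL w := by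
  have hset : ∀ s : Set (E n), MeasurableSet s → volume s < ⊤ → 0 ≤ ∫ x in s, w x := by
    intro s hs hs'
    have h1 := h (indicatorConstLp 2 hs hs'.ne (1 : ℂ)) (by
      filter_upwards [indicatorConstLp_coeFn (p := 2) (hs := hs) (hμs := hs'.ne) (c := (1 : ℂ))]
        with x hx
      rw [hx]
      exact Set.indicator_nonneg (fun _ _ => zero_le_one) _)
    rwa [L2.inner_indicatorConstLp_one] at h1
  have hint : ∀ s : Set (E n), MeasurableSet s → volume s < ⊤ → IntegrableOn w s := by
    intro s hs hs'
    have : Fact (volume s < ⊤) := ⟨hs'⟩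
    exact ((Lp.memLp w).restrict s).integrable (by norm_num)
  have hre : 0 ≤ᵐ[volume] fun x => (w x).re := by
    refine ae_nonneg_of_forall_setIntegral_nonneg_of_sigmaFinite
      (fun s hs hs' => (hint s hs hs').re) fun s hs hs' => ?_
    have h1 := (Complex.le_def.mp (hset s hs hs')).1
    have h2 := integral_re (hint s hs hs')
    simp only [RCLike.re_eq_complex_re] at h2
    rw [h2]
    simpa using h1
  have him : (fun x => (w x).im) =ᵐ[volume] 0 := by
    refine ae_eq_zero_of_forall_setIntegral_eq_of_sigmaFinite
      (fun s hs hs' => (hint s hs hs').im) fun s hs hs' => ?_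
    have h1 := (Complex.le_def.mp (hset s hs hs')).2
    have h2 := integral_im (hint s hs hs')
    simp only [RCLike.im_eq_complex_im] at h2
    rw [h2]
    simpa using h1.symm
  filter_upwards [hre, him] with x h1 h2
  exact Complex.le_def.mpr ⟨h1, h2.symm⟩

/-- The symbol of the heat semigroup. -/
def heatSymbol (s : ℝ) (ξ : E n) : ℝ := Real.exp (-s * lapSymbol ξ)

theorem heatSymbol_le_one {s : ℝ} (hs : 0 ≤ s) (ξ : E n) : heatSymbol s ξ ≤ 1 := by
  rw [heatSymbol, Real.exp_le_one_iff]
  nlinarith [lapSymbol_nonneg ξ]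

theorem essBdd_heatSymbol {s : ℝ} (hs : 0 ≤ s) : EssBdd (heatSymbol s : E n → ℝ) :=
  essBdd_of_continuous (by unfold heatSymbol; have := continuous_lapSymbol (n := n); fun_prop) 1
    fun ξ => by
      rw [heatSymbol, abs_of_pos (Real.exp_pos _)]; exact heatSymbol_le_one hs ξ

/-- The heat semigroup on `L²`. -/
def heat (s : ℝ) (hs : 0 ≤ s) : L2 n →L[ℂ] L2 n := mult (heatSymbol s) (essBdd_heatSymbol hs)

theorem heatSymbol_integrable {s : ℝ} (hs : 0 < s) (x : E n) :
    Integrable (fun ξ : E n => Complex.exp (-(2 * Real.pi * ⟪ξ, x⟫_ℝ * Complex.I)) *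
      (heatSymbol s ξ : ℂ)) := by
  have h := GaussianFourier.integrable_cexp_neg_mul_sq_norm_add (V := E n)
    (b := ((s * (2 * Real.pi) ^ 2 : ℝ) : ℂ)) (by rw [Complex.ofReal_re]; positivity)
    (-(2 * Real.pi * Complex.I)) x
  refine h.congr (Eventually.of_forall fun ξ => ?_)
  simp only [heatSymbol, lapSymbol]
  rw [Complex.ofReal_exp, ← Complex.exp_add, real_inner_comm]
  congr 1
  push_cast
  ring

theorem heatSymbol_memLp {s : ℝ} (hs : 0 < s) :
    MemLp (fun ξ => (heatSymbol s ξ : ℂ)) 2 (volume : Measure (E n)) := by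
  refine MemLp.ofReal (K := ℂ) ((memLp_two_iff_integrable_sq ?_).mpr ?_)
  · exact (essBdd_heatSymbol hs.le).aestronglyMeasurable
  · have h := (heatSymbol_integrable (n := n) (s := 2 * s) (by positivity) 0).re
    refine h.congr (Eventually.of_forall fun ξ => ?_)
    have h0 : Complex.exp (-(2 * Real.pi * ⟪ξ, (0 : E n)⟫_ℝ * Complex.I)) = 1 := by
      rw [inner_zero_right]; simp
    beta_reduce
    rw [h0, one_mul, RCLike.re_eq_complex_re, Complex.ofReal_re]
    have h1 : heatSymbol (2 * s) ξ = heatSymbol s ξ ^ 2 := by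
      rw [heatSymbol, heatSymbol, pow_two, ← Real.exp_add]
      congr 1
      ring
    exact h1

/-- The Gaussian heat kernel. -/
def heatKernel (s : ℝ) (z : E n) : ℝ :=
  (Real.pi / (s * (2 * Real.pi) ^ 2)) ^ ((n : ℝ) / 2) *
    Real.exp (-Real.pi ^ 2 * ‖z‖ ^ 2 / (s * (2 * Real.pi) ^ 2))

theorem heatKernel_pos {s : ℝ} (hs : 0 < s) (z : E n) : 0 < heatKernel s z := by
  unfold heatKernel; positivity

/-- The modulation recentres the Gaussian at `x`; with it, `mult_ae_inner` becomes convolution with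
the heat kernel. -/
theorem fourierInv_modulate_heat {s : ℝ} (hs : 0 < s) (x : E n) :
    (𝓕⁻ (modulate (heatSymbol_memLp hs) x) : L2 n) =ᵐ[volume]
      fun y => (heatKernel s (y - x) : ℂ) := by
  have hco : modulate (heatSymbol_memLp hs) x =ᵐ[volume] fun ξ =>
      Complex.exp (-(2 * Real.pi * ⟪ξ, x⟫_ℝ * Complex.I)) * (heatSymbol s ξ : ℂ) :=
    (memLp_modulate (heatSymbol_memLp hs) x).coeFn_toLp
  have hint : Integrable (modulate (heatSymbol_memLp hs) x) :=
    (heatSymbol_integrable hs x).congr hco.symm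
  filter_upwards [fourierInv_ae_of_integrable _ hint] with y hy
  rw [hy, Real.fourierInv_congr_ae hco, Real.fourierInv_eq_fourier_neg]
  set b : ℂ := ((s * (2 * Real.pi) ^ 2 : ℝ) : ℂ) with hb
  have hbre : 0 < b.re := by rw [hb, Complex.ofReal_re]; positivity
  have h := fourier_gaussian_innerProductSpace' hbre (-x) (-y)
  have hfun : (fun ξ : E n => Complex.exp (-(2 * Real.pi * ⟪ξ, x⟫_ℝ * Complex.I)) *
      (heatSymbol s ξ : ℂ)) = fun v => Complex.exp (-b * ‖v‖ ^ 2 +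
        2 * Real.pi * Complex.I * ⟪-x, v⟫_ℝ) := by
    ext ξ
    simp only [heatSymbol, lapSymbol, hb]
    rw [Complex.ofReal_exp, ← Complex.exp_add, inner_neg_left, real_inner_comm]
    congr 1
    push_cast
    ring
  rw [hfun, h, heatKernel, finrank_euclideanSpace_fin]
  have hn : ‖-x - -y‖ = ‖y - x‖ := by rw [neg_sub_neg]
  rw [hn, Complex.ofReal_mul, Complex.ofReal_cpow (by positivity), Complex.ofReal_exp, hb]
  push_cast
  rfl

theorem integrable_heatKernel_mul {s : ℝ} (hs : 0 < s) (x : E n) (f : L2 n) :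
    Integrable (fun y => (heatKernel s (y - x) : ℂ) * f y) := by
  have h := (Lp.memLp (𝓕⁻ (modulate (heatSymbol_memLp hs) x) : L2 n)).integrable_mul (Lp.memLp f)
  refine h.congr ?_
  filter_upwards [fourierInv_modulate_heat hs x] with y hy
  rw [Pi.mul_apply, hy]

theorem heat_ae {s : ℝ} (hs : 0 < s) (f : L2 n) :
    ∀ᵐ x, heat s hs.le f x = ∫ y, (heatKernel s (y - x) : ℂ) * f y := by
  filter_upwards [mult_ae_inner (essBdd_heatSymbol hs.le) (heatSymbol_memLp hs) f] with x hx
  rw [heat, hx]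
  have h1 : ⟪modulate (heatSymbol_memLp hs) x, (𝓕 f : L2 n)⟫_ℂ
      = ⟪(𝓕⁻ (modulate (heatSymbol_memLp hs) x) : L2 n), f⟫_ℂ := by
    rw [← Lp.inner_fourier_eq (𝓕⁻ (modulate (heatSymbol_memLp hs) x) : L2 n) f,
      fourier_fourierInv_eq]
  rw [h1, inner_L2]
  refine integral_congr_ae ?_
  filter_upwards [fourierInv_modulate_heat hs x] with y hy
  rw [hy, Complex.conj_ofReal, mul_comm]

theorem NonnegL.heat {f : L2 n} (hf : NonnegL f) {s : ℝ} (hs : 0 < s) :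
    NonnegL (heat s hs.le f) := by
  filter_upwards [heat_ae hs f] with x hx
  rw [hx]
  refine complex_integral_nonneg ?_
  filter_upwards [hf] with y hy
  exact mul_nonneg (Complex.zero_le_real.mpr (heatKernel_pos hs _).le) hy

theorem NonnegL.heat_pos {f : L2 n} (hf : NonnegL f) (hf0 : f ≠ 0) {s : ℝ} (hs : 0 < s) :
    PosL (ThirdHarmonic.heat s hs.le f) := by
  filter_upwards [heat_ae hs f] with x hx
  rw [hx]
  have hint := integrable_heatKernel_mul hs x f
  have hre : ∀ᵐ y, (heatKernel s (y - x) : ℂ) * f y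
      = ((heatKernel s (y - x) * (f y).re : ℝ) : ℂ) := by
    filter_upwards [hf] with y hy
    have : f y = ((f y).re : ℂ) := Complex.eq_re_of_ofReal_le (r := 0) (by simpa using hy)
    rw [this]
    push_cast
    simp
  rw [integral_congr_ae hre, integral_complex_ofReal]
  refine Complex.zero_lt_real.mpr ?_
  rw [integral_pos_iff_support_of_nonneg_ae]
  · by_contra hcon
    have h0 : volume (Function.support fun y => heatKernel s (y - x) * (f y).re) = 0 := by
      simpa using hcon
    apply hf0
    refine (Lp.eq_zero_iff_ae_eq_zero).mpr ?_
    have h1 : ∀ᵐ y, y ∉ Function.support fun y => heatKernel s (y - x) * (f y).re :=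
      measure_eq_zero_iff_ae_notMem.mp h0
    filter_upwards [hf, h1] with y hy hy'
    have h2 : f y = ((f y).re : ℂ) := Complex.eq_re_of_ofReal_le (r := 0) (by simpa using hy)
    rw [Function.notMem_support] at hy'
    rcases mul_eq_zero.mp hy' with h3 | h3
    · exact absurd h3 (heatKernel_pos hs _).ne'
    · rw [h2, h3]; simp
  · filter_upwards [hf] with y hy
    exact mul_nonneg (heatKernel_pos hs _).le (Complex.le_def.mp hy).1
  · refine (hint.re).congr ?_
    filter_upwards [hre] with y hy
    rw [hy]
    simp

theorem inner_mult_eq_integral {m : E n → ℝ} (hm : EssBdd m) (ψ f : L2 n) :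
    ⟪ψ, mult m hm f⟫_ℂ = ∫ ξ, (m ξ : ℂ) * ((𝓕 f : L2 n) ξ * conj ((𝓕 ψ : L2 n) ξ)) := by
  rw [← Lp.inner_fourier_eq, inner_L2]
  refine integral_congr_ae ?_
  filter_upwards [fourier_mult_ae hm f] with ξ hξ
  rw [hξ, mul_assoc]

/-- The vector tested against `ψ` is ∫₀ˢ e^{-κr} e^{rΔ} f dr, a positive superposition of
nonnegative functions. The integral is never formed in L²: it is taken under the inner product on
the Fourier side, by Fubini in ξ and r. -/
theorem res_sub_heat_nonneg {κ : ℝ} (hκ : 0 < κ) {s : ℝ} (hs : 0 < s) {f ψ : L2 n}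
    (hf : NonnegL f) (hψ : NonnegL ψ) :
    0 ≤ ⟪ψ, res κ hκ f - (Real.exp (-κ * s) : ℂ) • heat s hs.le (res κ hκ f)⟫_ℂ := by
  set F : E n → ℂ := fun ξ => (𝓕 f : L2 n) ξ * conj ((𝓕 ψ : L2 n) ξ) with hF
  have hFint : Integrable F := (Lp.memLp (𝓕 f : L2 n)).integrable_mul (Lp.memLp (𝓕 ψ : L2 n)).star
  have hm1 : EssBdd fun ξ : E n => resSymbol κ ξ - Real.exp (-κ * s) * (heatSymbol s ξ * resSymbol κ ξ) := by
    refine essBdd_of_bound ?_ (κ⁻¹ + κ⁻¹) (Eventually.of_forall fun ξ => ?_)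
    · exact (essBdd_resSymbol hκ).aestronglyMeasurable.sub
        (((essBdd_heatSymbol hs.le).aestronglyMeasurable.mul
          (essBdd_resSymbol hκ).aestronglyMeasurable).const_mul _)
    · have h1 := resSymbol_pos hκ ξ
      have h2 := resSymbol_le hκ ξ
      have h3 := heatSymbol_le_one hs.le ξ
      have h4 : 0 < heatSymbol s ξ := Real.exp_pos _
      have h5 : Real.exp (-κ * s) ≤ 1 := by rw [Real.exp_le_one_iff]; nlinarith
      have h6 : heatSymbol s ξ * resSymbol κ ξ ≤ κ⁻¹ := by nlinarith
      have h7 : 0 < heatSymbol s ξ * resSymbol κ ξ := by positivity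
      have h8 : Real.exp (-κ * s) * (heatSymbol s ξ * resSymbol κ ξ) ≤ κ⁻¹ := by
        nlinarith [Real.exp_pos (-κ * s)]
      have h9 : 0 < Real.exp (-κ * s) * (heatSymbol s ξ * resSymbol κ ξ) := by positivity
      rw [abs_le]
      constructor <;> linarith
  have e1 : res κ hκ f - (Real.exp (-κ * s) : ℂ) • heat s hs.le (res κ hκ f) = mult _ hm1 f := by
    apply eq_of_fourier_ae
    rw [fourier_sub_L2, fourier_smul_L2]
    filter_upwards [Lp.coeFn_sub (𝓕 (res κ hκ f) : L2 n)
      ((Real.exp (-κ * s) : ℂ) • (𝓕 (heat s hs.le (res κ hκ f)) : L2 n)),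
      Lp.coeFn_smul (Real.exp (-κ * s) : ℂ) (𝓕 (heat s hs.le (res κ hκ f)) : L2 n),
      fourier_mult_ae (essBdd_resSymbol hκ) f,
      fourier_mult_ae (essBdd_heatSymbol hs.le) (res κ hκ f), fourier_mult_ae hm1 f]
      with ξ h1 h2 h3 h4 h5
    rw [h1, Pi.sub_apply, h2, Pi.smul_apply, h5, heat, h4, res, h3, smul_eq_mul]
    push_cast
    ring
  rw [e1, inner_mult_eq_integral]
  have e2 : ∀ ξ : E n, ((resSymbol κ ξ - Real.exp (-κ * s) * (heatSymbol s ξ * resSymbol κ ξ) : ℝ) : ℂ)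
      = ∫ r in Set.Ioc 0 s, Complex.exp (-(κ + lapSymbol ξ : ℝ) * r) := by
    intro ξ
    have ha := add_lapSymbol_pos hκ ξ
    have hac : (-(κ + lapSymbol ξ : ℝ) : ℂ) ≠ 0 := by
      rw [neg_ne_zero]; exact_mod_cast ha.ne'
    rw [← intervalIntegral.integral_of_le hs.le, integral_exp_mul_complex hac, resSymbol, heatSymbol]
    rw [Complex.ofReal_zero, mul_zero, Complex.exp_zero]
    have h1 : Complex.exp (-(κ + lapSymbol ξ : ℝ) * s)
        = ((Real.exp (-κ * s) * Real.exp (-s * lapSymbol ξ) : ℝ) : ℂ) := by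
      rw [← Real.exp_add]
      push_cast
      congr 1
      ring
    rw [h1]
    have hac' : ((κ + lapSymbol ξ : ℝ) : ℂ) ≠ 0 := by exact_mod_cast ha.ne'
    push_cast at hac' ⊢
    field_simp
    ring
  have e3 : ∫ ξ, ((resSymbol κ ξ - Real.exp (-κ * s) * (heatSymbol s ξ * resSymbol κ ξ) : ℝ) : ℂ) * F ξ
      = ∫ ξ, ∫ r in Set.Ioc 0 s, Complex.exp (-(κ + lapSymbol ξ : ℝ) * r) * F ξ := by
    refine integral_congr_ae (Eventually.of_forall fun ξ => ?_)
    simp only [e2]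
    rw [integral_mul_const]
  rw [e3, integral_integral_swap]
  · refine complex_integral_nonneg ?_
    filter_upwards [ae_restrict_mem measurableSet_Ioc] with r hr
    have h1 : ∫ ξ, Complex.exp (-(κ + lapSymbol ξ : ℝ) * r) * F ξ
        = (Real.exp (-κ * r) : ℂ) * ⟪ψ, heat r hr.1.le f⟫_ℂ := by
      rw [heat, inner_mult_eq_integral, ← integral_const_mul]
      refine integral_congr_ae (Eventually.of_forall fun ξ => ?_)
      have h3 : Complex.exp (-(κ + lapSymbol ξ : ℝ) * r)
          = (Real.exp (-κ * r) : ℂ) * (heatSymbol r ξ : ℂ) := by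
        rw [heatSymbol, ← Complex.ofReal_mul, ← Real.exp_add, Complex.ofReal_exp]
        congr 1
        push_cast
        ring
      beta_reduce
      rw [h3]
      simp only [hF]
      ring
    rw [h1]
    exact mul_nonneg (Complex.zero_le_real.mpr (Real.exp_pos _).le) (hψ.inner (hf.heat hr.1))
  · have h1 : Integrable (fun p : E n × ℝ => F p.1)
        ((volume : Measure (E n)).prod (volume.restrict (Set.Ioc 0 s))) := hFint.comp_fst _
    have hc : Continuous fun p : E n × ℝ => Complex.exp (-(κ + lapSymbol p.1 : ℝ) * p.2) := by
      have := continuous_lapSymbol (n := n)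
      fun_prop
    refine h1.mono (hc.aestronglyMeasurable.mul h1.1) ?_
    have h2 : ∀ᵐ p : E n × ℝ ∂((volume : Measure (E n)).prod (volume.restrict (Set.Ioc 0 s))),
        p.2 ∈ Set.Ioc 0 s :=
      Measure.quasiMeasurePreserving_snd.ae (ae_restrict_mem measurableSet_Ioc)
    filter_upwards [h2] with p hp
    rw [Function.uncurry, norm_mul]
    refine mul_le_of_le_one_left (norm_nonneg _) ?_
    rw [Complex.norm_exp, ← Complex.ofReal_neg, ← Complex.ofReal_mul, Complex.ofReal_re,
      Real.exp_le_one_iff]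
    nlinarith [add_lapSymbol_pos hκ p.1, hp.1]

theorem norm_heat_le {s : ℝ} (hs : 0 ≤ s) (f : L2 n) : ‖heat s hs f‖ ≤ ‖f‖ := by
  have := norm_mult_le (essBdd_heatSymbol hs) (C := 1) (Eventually.of_forall fun ξ => by
    rw [heatSymbol, abs_of_pos (Real.exp_pos _)]; exact heatSymbol_le_one hs ξ) f
  rwa [one_mul] at this

/-- The resolvent of the Laplacian preserves positivity. -/
theorem NonnegL.res {f : L2 n} (hf : NonnegL f) {κ : ℝ} (hκ : 0 < κ) : NonnegL (res κ hκ f) := by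
  refine nonnegL_of_inner fun ψ hψ => ?_
  set u := ThirdHarmonic.res κ hκ f with hu
  -- Taking s = k + 1 → ∞ in `res_sub_heat_nonneg` makes the heat term vanish and leaves the
  -- resolvent.
  set X : ℕ → ℂ := fun k => ⟪ψ, u - (Real.exp (-κ * ((k : ℝ) + 1)) : ℂ) •
    ThirdHarmonic.heat ((k : ℝ) + 1) (by positivity) u⟫_ℂ with hX
  have hlim : Tendsto X atTop (𝓝 ⟪ψ, u⟫_ℂ) := by
    have h1 : Tendsto (fun k : ℕ => (Real.exp (-κ * ((k : ℝ) + 1)) : ℂ) •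
        ThirdHarmonic.heat ((k : ℝ) + 1) (by positivity) u) atTop (𝓝 0) := by
      have h2 : Tendsto (fun k : ℕ => Real.exp (-κ * ((k : ℝ) + 1)) * ‖u‖) atTop (𝓝 0) := by
        have h3 : Tendsto (fun k : ℕ => κ * ((k : ℝ) + 1)) atTop atTop :=
          (tendsto_natCast_atTop_atTop.atTop_add tendsto_const_nhds).const_mul_atTop hκ
        have h4 := (Real.tendsto_exp_neg_atTop_nhds_zero.comp h3).mul_const ‖u‖
        simpa [Function.comp_def] using h4
      refine squeeze_zero_norm (fun k => ?_) h2
      rw [norm_smul, Complex.norm_real, Real.norm_of_nonneg (Real.exp_pos _).le]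
      exact mul_le_mul_of_nonneg_left (norm_heat_le _ u) (Real.exp_pos _).le
    have h5 := (tendsto_const_nhds (x := ψ)).inner (𝕜 := ℂ) ((tendsto_const_nhds (x := u)).sub h1)
    rw [sub_zero] at h5
    exact h5
  exact ge_of_tendsto' hlim fun k => res_sub_heat_nonneg hκ (by positivity) hf hψ

/-- The resolvent of the Laplacian improves positivity. -/
theorem NonnegL.res_pos {f : L2 n} (hf : NonnegL f) (hf0 : f ≠ 0) {κ : ℝ} (hκ : 0 < κ) :
    PosL (ThirdHarmonic.res κ hκ f) := by
  set u := ThirdHarmonic.res κ hκ f with hu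
  have hu0 : u ≠ 0 := fun h =>
    hf0 (mult_injective (essBdd_resSymbol hκ) (fun ξ => (resSymbol_pos hκ ξ).ne') h)
  -- At s = 1 the function `u` dominates e^{-κ} e^{Δ} u, which is strictly positive because the
  -- Gaussian kernel is.
  have h1 : NonnegL (u - (Real.exp (-κ * 1) : ℂ) • ThirdHarmonic.heat 1 one_pos.le u) :=
    nonnegL_of_inner fun ψ hψ => res_sub_heat_nonneg hκ one_pos hf hψ
  have h2 := (hf.res hκ).heat_pos hu0 one_pos
  filter_upwards [h1, h2, Lp.coeFn_sub u ((Real.exp (-κ * 1) : ℂ) •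
    ThirdHarmonic.heat 1 one_pos.le u), Lp.coeFn_smul (Real.exp (-κ * 1) : ℂ)
    (ThirdHarmonic.heat 1 one_pos.le u)] with x h3 h4 h5 h6
  rw [h5, Pi.sub_apply, h6, Pi.smul_apply, smul_eq_mul, sub_nonneg] at h3
  exact (mul_pos (Complex.zero_lt_real.mpr (Real.exp_pos _)) h4).trans_le h3

end Positivity

/-! ### Compactness of (κ - Δ)^{-1/2} composed with a potential. -/

section Compactness

theorem exists_weakly_convergent_subseq {H : Type*} [NormedAddCommGroup H] [InnerProductSpace ℂ H]
    [CompleteSpace H] [TopologicalSpace.SeparableSpace H] {w : ℕ → H} {r : ℝ}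
    (hw : ∀ k, ‖w k‖ ≤ r) :
    ∃ (g : H) (φ : ℕ → ℕ), ‖g‖ ≤ r ∧ StrictMono φ ∧
      ∀ v, Tendsto (fun k => ⟪v, w (φ k)⟫_ℂ) atTop (𝓝 ⟪v, g⟫_ℂ) := by
  obtain ⟨l, hl, φ, hφ, hlim⟩ := WeakDual.isSeqCompact_closedBall (𝕜 := ℂ) (E := H) 0 r
    (x := fun k => StrongDual.toWeakDual (InnerProductSpace.toDual ℂ H (w k)))
    (fun k => by simpa using hw k)
  refine ⟨(InnerProductSpace.toDual ℂ H).symm (WeakDual.toStrongDual l), φ, ?_, hφ, fun v => ?_⟩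
  · rw [LinearIsometryEquiv.norm_map]
    simpa using hl
  · have h1 := ((WeakBilin.eval_continuous _ v).tendsto l).comp hlim
    have h2 := (continuous_star.tendsto _).comp h1
    refine (h2.congr fun k => ?_).trans_eq ?_
    · exact inner_conj_symm v (w (φ k))
    · congr 1
      rw [← inner_conj_symm, InnerProductSpace.toDual_symm_apply]
      rfl

variable {n : ℕ}

theorem norm_sq_L2 (f : L2 n) : ‖f‖ ^ 2 = ∫ x, ‖f x‖ ^ 2 := by
  have h1 : ((‖f‖ ^ 2 : ℝ) : ℂ) = ⟪f, f⟫_ℂ := by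
    rw [inner_self_eq_norm_sq_to_K]; norm_cast
  have h2 : ⟪f, f⟫_ℂ = ∫ x, ((‖f x‖ ^ 2 : ℝ) : ℂ) := by
    rw [inner_L2]
    refine integral_congr_ae (Eventually.of_forall fun x => ?_)
    beta_reduce
    rw [Complex.mul_conj, Complex.normSq_eq_norm_sq]
  rw [h2, integral_complex_ofReal] at h1
  exact_mod_cast h1

/-- A multiplication operator times a Fourier multiplier, both by functions in `L² ∩ L^∞`, is
compact. -/
theorem isCompactOperator_mulOp_mult {a m : E n → ℝ} (ha : EssBdd a)
    (ha2 : MemLp (fun x => (a x : ℂ)) 2 (volume : Measure (E n))) (hm : EssBdd m)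
    (hm2 : MemLp (fun ξ => (m ξ : ℂ)) 2 (volume : Measure (E n))) :
    IsCompactOperator (mulOp a ha ∘L mult m hm) := by
  refine (isCompactOperator_iff_image_closedBall_subset_compact
    ((mulOp a ha ∘L mult m hm : L2 n →L[ℂ] L2 n) : L2 n →ₗ[ℂ] L2 n) one_pos).mpr
    ⟨_, IsSeqCompact.isCompact ?_, subset_rfl⟩
  intro y hy
  choose w hw hwy using hy
  have hw1 : ∀ k, ‖(𝓕 (w k) : L2 n)‖ ≤ 1 := fun k => by
    rw [Lp.norm_fourier_eq]; simpa using hw k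
  have : Fact ((2 : ℝ≥0∞) ≠ ⊤) := ⟨by norm_num⟩
  -- The differences `F k` have transforms tending weakly to zero, so by `mult_ae_inner` their
  -- images under the multiplier tend to zero at almost every point. The supremum bound makes |a|²
  -- (2M)² a dominating function, and norm convergence follows.
  obtain ⟨g, φ, hg, hφ, hlim⟩ := exists_weakly_convergent_subseq hw1
  set f : L2 n := 𝓕⁻ g with hf
  have hfg : (𝓕 f : L2 n) = g := fourier_fourierInv_eq _
  have hfn : ‖f‖ ≤ 1 := by rw [← Lp.norm_fourier_eq, hfg]; exact hg
  refine ⟨(mulOp a ha ∘L mult m hm) f, ⟨f, by simpa using hfn, rfl⟩, φ, hφ, ?_⟩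
  rw [tendsto_iff_norm_sub_tendsto_zero]
  set M : ℝ := ‖(hm2.toLp _ : L2 n)‖ with hM
  set F : ℕ → L2 n := fun k => w (φ k) - f with hF
  have hFn : ∀ k, ‖F k‖ ≤ 2 := fun k => by
    have h1 : ‖w (φ k)‖ ≤ 1 := by simpa using hw (φ k)
    exact (norm_sub_le _ _).trans (by linarith)
  have hFlim : ∀ v, Tendsto (fun k => ⟪v, (𝓕 (F k) : L2 n)⟫_ℂ) atTop (𝓝 0) := fun v => by
    have h1 := (hlim v).sub_const ⟪v, g⟫_ℂ
    rw [sub_self] at h1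
    refine h1.congr fun k => ?_
    rw [hF, fourier_sub_L2, inner_sub_right, hfg]
  have hsq : Tendsto (fun k => ‖mulOp a ha (mult m hm (F k))‖ ^ 2) atTop (𝓝 0) := by
    simp only [norm_sq_L2]
    have hz : (0 : ℝ) = ∫ _ : E n, (0 : ℝ) := by simp
    rw [hz]
    have hae : ∀ᵐ x, ∀ k, mulOp a ha (mult m hm (F k)) x = (a x : ℂ) *
        ⟪modulate hm2 x, (𝓕 (F k) : L2 n)⟫_ℂ := ae_all_iff.mpr fun k => by
      filter_upwards [mulOp_ae ha (mult m hm (F k)), mult_ae_inner hm hm2 (F k)] with x h1 h2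
      rw [h1, h2]
    refine tendsto_integral_of_dominated_convergence (fun x => ‖(a x : ℂ)‖ ^ 2 * (M * 2) ^ 2)
      (fun k => ((Lp.aestronglyMeasurable _).norm.pow 2))
      (((memLp_two_iff_integrable_sq_norm ha2.1).mp ha2).mul_const _) (fun k => ?_) ?_
    · filter_upwards [hae] with x hx
      rw [hx, norm_pow, norm_norm, norm_mul, mul_pow]
      gcongr
      refine (norm_inner_le_norm _ _).trans ?_
      rw [norm_modulate, Lp.norm_fourier_eq]
      exact mul_le_mul_of_nonneg_left (hFn k) (norm_nonneg _)
    · filter_upwards [hae] with x hx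
      simp only [hx]
      have h1 := (((hFlim (modulate hm2 x)).const_mul (a x : ℂ)).norm).pow 2
      simpa using h1
  have hsqrt := hsq.sqrt
  rw [Real.sqrt_zero] at hsqrt
  refine hsqrt.congr fun k => ?_
  rw [Real.sqrt_sq (norm_nonneg _), Function.comp_apply, ← hwy (φ k), hF, map_sub, map_sub]
  rfl

/-- If `X X*` is compact then so is `X*`. -/
theorem isCompactOperator_of_comp_adjoint {H : Type*} [NormedAddCommGroup H]
    [InnerProductSpace ℂ H] [CompleteSpace H] {X Y : H →L[ℂ] H}
    (hXY : ∀ x y, ⟪X x, y⟫_ℂ = ⟪x, Y y⟫_ℂ) (h : IsCompactOperator (X ∘L Y)) :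
    IsCompactOperator Y := by
  refine (isCompactOperator_iff_isCompact_closure_image_closedBall
    (Y : H →ₗ[ℂ] H) one_pos).mpr ?_
  refine TotallyBounded.isCompact_of_isClosed (TotallyBounded.closure ?_) isClosed_closure
  have hc : TotallyBounded ((X ∘L Y) '' Metric.closedBall 0 1) :=
    (h.isCompact_closure_image_closedBall (f := ((X ∘L Y : H →L[ℂ] H) : H →ₗ[ℂ] H))
      1).totallyBounded.subset subset_closure
  refine Metric.totallyBounded_iff.mpr fun ε hε => ?_
  -- For a difference z of two points of the unit ball, ‖z‖ ≤ 2 and ‖Y z‖² ≤ ‖X Y z‖ ‖z‖. So an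
  -- approximation within ε² / 2 for `X ∘L Y` is one within ε for `Y`.
  obtain ⟨t, hts, htf, hcov⟩ := Metric.finite_approx_of_totallyBounded hc (ε ^ 2 / 2) (by positivity)
  have hts' : ∀ y : H, y ∈ t → ∃ x ∈ Metric.closedBall (0 : H) 1, (X ∘L Y) x = y :=
    fun y hy => hts hy
  choose! p hp hpt using hts'
  refine ⟨(fun y => Y (p y)) '' t, htf.image _, ?_⟩
  rintro _ ⟨x, hx, rfl⟩
  obtain ⟨y, hy, hxy⟩ := Set.mem_iUnion₂.mp (hcov ⟨x, hx, rfl⟩)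
  refine Set.mem_iUnion₂.mpr ⟨_, ⟨y, hy, rfl⟩, ?_⟩
  rw [Metric.mem_ball, ← hpt y hy, dist_eq_norm, ← map_sub] at hxy
  rw [Metric.mem_ball, ContinuousLinearMap.coe_coe, dist_eq_norm, ← map_sub]
  set z := x - p y with hz
  have hzn : ‖z‖ ≤ 2 := by
    have h1 : ‖x‖ ≤ 1 := by simpa using hx
    have h2 : ‖p y‖ ≤ 1 := by simpa using hp y hy
    exact (norm_sub_le _ _).trans (by linarith)
  have h1 : ‖Y z‖ ^ 2 ≤ ‖(X ∘L Y) z‖ * ‖z‖ := by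
    have h2 : ⟪(X ∘L Y) z, z⟫_ℂ = ((‖Y z‖ ^ 2 : ℝ) : ℂ) := by
      rw [ContinuousLinearMap.comp_apply, hXY, inner_self_eq_norm_sq_to_K]; norm_cast
    have h3 := norm_inner_le_norm (𝕜 := ℂ) ((X ∘L Y) z) z
    rwa [h2, Complex.norm_real, Real.norm_of_nonneg (sq_nonneg _)] at h3
  refine lt_of_pow_lt_pow_left₀ 2 hε.le (h1.trans_lt ?_)
  nlinarith [norm_nonneg ((X ∘L Y) z), norm_nonneg z]

/-- The symbol of the inverse square root of `κ - Δ`. -/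
def sqrtResSymbol (κ : ℝ) (ξ : E n) : ℝ := √(resSymbol κ ξ)

theorem sqrtResSymbol_pos {κ : ℝ} (hκ : 0 < κ) (ξ : E n) : 0 < sqrtResSymbol κ ξ :=
  Real.sqrt_pos.mpr (resSymbol_pos hκ ξ)

theorem essBdd_sqrtResSymbol {κ : ℝ} (hκ : 0 < κ) : EssBdd (sqrtResSymbol κ : E n → ℝ) :=
  essBdd_of_continuous (continuous_resSymbol hκ).sqrt (√κ⁻¹) fun ξ => by
    rw [sqrtResSymbol, abs_of_nonneg (Real.sqrt_nonneg _)]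
    exact Real.sqrt_le_sqrt (resSymbol_le hκ ξ)

/-- The inverse square root of `κ - Δ` on `L²`. -/
def sqrtRes (κ : ℝ) (hκ : 0 < κ) : L2 n →L[ℂ] L2 n :=
  mult (sqrtResSymbol κ) (essBdd_sqrtResSymbol hκ)

theorem sqrtRes_sqrtRes {κ : ℝ} (hκ : 0 < κ) (f : L2 n) :
    sqrtRes κ hκ (sqrtRes κ hκ f) = res κ hκ f := by
  refine eq_of_fourier_ae ?_
  filter_upwards [fourier_mult_ae (essBdd_sqrtResSymbol hκ) (sqrtRes κ hκ f),
    fourier_mult_ae (essBdd_sqrtResSymbol hκ) f, fourier_mult_ae (essBdd_resSymbol hκ) f]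
    with ξ h1 h2 h3
  change (𝓕 (mult (sqrtResSymbol κ) (essBdd_sqrtResSymbol hκ) (sqrtRes κ hκ f)) : L2 n) ξ = _
  rw [h1, sqrtRes, h2, res, h3, ← mul_assoc, ← Complex.ofReal_mul, sqrtResSymbol,
    Real.mul_self_sqrt (resSymbol_pos hκ ξ).le]

theorem sqrtRes_injective {κ : ℝ} (hκ : 0 < κ) {f : L2 n} (h : sqrtRes κ hκ f = 0) : f = 0 :=
  mult_injective (essBdd_sqrtResSymbol hκ) (fun ξ => (sqrtResSymbol_pos hκ ξ).ne') h

/-- The symbol of the square root is not square integrable in dimensions two and three, while that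
of the resolvent is. Compactness is therefore established for a (κ - Δ)⁻¹ a, the product of the
adjoint with the operator, and transferred to the operator. -/
theorem isCompactOperator_sqrtRes_mulOp (hn3 : n ≤ 3) {a : E n → ℝ} (ha : EssBdd a)
    (ha2 : MemLp (fun x => (a x : ℂ)) 2 (volume : Measure (E n))) {κ : ℝ} (hκ : 0 < κ) :
    IsCompactOperator (sqrtRes κ hκ ∘L mulOp a ha) := by
  refine isCompactOperator_of_comp_adjoint (X := mulOp a ha ∘L sqrtRes κ hκ) (fun x y => ?_) ?_
  · rw [ContinuousLinearMap.comp_apply, mulOp_isSymmetric, sqrtRes, mult_isSymmetric]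
    rfl
  · have h1 : (mulOp a ha ∘L sqrtRes κ hκ) ∘L (sqrtRes κ hκ ∘L mulOp a ha)
        = (mulOp a ha ∘L mult (resSymbol κ) (essBdd_resSymbol hκ)) ∘L mulOp a ha := by
      ext1 f
      simp only [ContinuousLinearMap.comp_apply, sqrtRes_sqrtRes]
      rfl
    rw [h1]
    exact (isCompactOperator_mulOp_mult ha ha2 (essBdd_resSymbol hκ)
      (resSymbol_memLp hn3 hκ)).comp_clm _

end Compactness

/-! ### Two-component Schrödinger systems and their Birman–Schwinger operators. -/

section System

variable {n : ℕ}

/-- The Hilbert space `L² × L²`. -/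
abbrev L2Pair (n : ℕ) : Type := PiLp 2 (fun _ : Fin 2 => L2 n)

/-- The operator on `L² × L²` with a given matrix of entries. -/
def blockOp (A : Fin 2 → Fin 2 → L2 n →L[ℂ] L2 n) : L2Pair n →L[ℂ] L2Pair n :=
  ∑ i, ∑ j, (((PiLp.continuousLinearEquiv 2 ℂ (fun _ : Fin 2 => L2 n)).symm :
    (Fin 2 → L2 n) →L[ℂ] L2Pair n) ∘L ContinuousLinearMap.single ℂ (fun _ : Fin 2 => L2 n) i) ∘L
      A i j ∘L PiLp.proj 2 (fun _ : Fin 2 => L2 n) j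

theorem blockOp_apply (A : Fin 2 → Fin 2 → L2 n →L[ℂ] L2 n) (f : L2Pair n) (i : Fin 2) :
    blockOp A f i = ∑ j, A i j (f j) := by
  simp only [blockOp, Fin.sum_univ_two]
  fin_cases i <;> simp

theorem blockOp_isSymmetric {A : Fin 2 → Fin 2 → L2 n →L[ℂ] L2 n}
    (hA : ∀ i j x y, ⟪A i j x, y⟫_ℂ = ⟪x, A j i y⟫_ℂ) :
    (blockOp A : L2Pair n →ₗ[ℂ] L2Pair n).IsSymmetric := by
  intro x y
  simp only [ContinuousLinearMap.coe_coe, PiLp.inner_apply, blockOp_apply, sum_inner, inner_sum, hA]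
  exact Finset.sum_comm

theorem isCompactOperator_sum {α F G : Type*} [NormedAddCommGroup F] [NormedSpace ℂ F]
    [NormedAddCommGroup G] [NormedSpace ℂ G] (s : Finset α) {A : α → F →L[ℂ] G}
    (hA : ∀ i, IsCompactOperator (A i)) : IsCompactOperator (∑ i ∈ s, A i : F →L[ℂ] G) := by
  classical
  induction s using Finset.induction_on with
  | empty => simpa using isCompactOperator_zero
  | insert a s ha ih =>
    rw [Finset.sum_insert ha]
    exact (hA a).add ih

theorem isCompactOperator_blockOp {A : Fin 2 → Fin 2 → L2 n →L[ℂ] L2 n}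
    (hA : ∀ i j, IsCompactOperator (A i j)) : IsCompactOperator (blockOp A) :=
  isCompactOperator_sum _ fun i => isCompactOperator_sum _ fun j =>
    ((hA i j).comp_clm (PiLp.proj 2 (fun _ : Fin 2 => L2 n) j)).clm_comp
      (((PiLp.continuousLinearEquiv 2 ℂ (fun _ : Fin 2 => L2 n)).symm :
        (Fin 2 → L2 n) →L[ℂ] L2Pair n) ∘L ContinuousLinearMap.single ℂ (fun _ : Fin 2 => L2 n) i)

/-- The operator `-Δ + diag c - M` on `H² × H²`. -/
def sysOp (c : Fin 2 → ℝ) (M : Fin 2 → Fin 2 → L2 n →L[ℂ] L2 n) (h : Fin 2 → H2 n) :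
    Fin 2 → L2 n :=
  fun i => (c i : ℂ) • (h i : L2 n) - lap (h i) - ∑ j, M i j (h j)

/-- The quadratic form of `sysOp`. -/
def sysForm (c : Fin 2 → ℝ) (M : Fin 2 → Fin 2 → L2 n →L[ℂ] L2 n) (h : Fin 2 → H2 n) : ℝ :=
  (∑ i, ⟪sysOp c M h i, (h i : L2 n)⟫_ℂ).re

/-- A matrix of operators that defines a symmetric operator on `L² × L²`. -/
def SymmMat (M : Fin 2 → Fin 2 → L2 n →L[ℂ] L2 n) : Prop :=
  ∀ i j x y, ⟪M i j x, y⟫_ℂ = ⟪x, M j i y⟫_ℂ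

variable {c : Fin 2 → ℝ} {M : Fin 2 → Fin 2 → L2 n →L[ℂ] L2 n}

theorem sysOp_add (h k : Fin 2 → H2 n) : sysOp c M (h + k) = sysOp c M h + sysOp c M k := by
  ext1 i
  simp only [sysOp, Pi.add_apply, lap_add, Submodule.coe_add, map_add, Finset.sum_add_distrib,
    smul_add]
  abel

theorem sysOp_smul (a : ℂ) (h : Fin 2 → H2 n) : sysOp c M (a • h) = a • sysOp c M h := by
  ext1 i
  simp only [sysOp, Pi.smul_apply, lap_smul, Submodule.coe_smul, map_smul, ← Finset.smul_sum,
    smul_sub, smul_comm a]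

theorem sysOp_symm (hM : SymmMat M) (h k : Fin 2 → H2 n) :
    ∑ i, ⟪sysOp c M h i, (k i : L2 n)⟫_ℂ = ∑ i, ⟪(h i : L2 n), sysOp c M k i⟫_ℂ := by
  simp only [sysOp, inner_sub_left, inner_sub_right, inner_smul_left, inner_smul_right, sum_inner,
    inner_sum, Complex.conj_ofReal, inner_lap, Finset.sum_sub_distrib]
  congr 1
  simp only [hM _ _ _ _]
  exact Finset.sum_comm

theorem sysForm_eq_re (h : Fin 2 → H2 n) :
    sysForm c M h = (∑ i, ⟪(h i : L2 n), sysOp c M h i⟫_ℂ).re := by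
  simp only [sysForm, Complex.re_sum]
  exact Finset.sum_congr rfl fun i _ => inner_re_symm (𝕜 := ℂ) _ _

/-- The pair of resolvents `(cᵢ - Δ)⁻¹ gᵢ`. -/
def resPair (c : Fin 2 → ℝ) (hc : ∀ i, 0 < c i) (g : Fin 2 → L2 n) : Fin 2 → H2 n :=
  fun i => ⟨res (c i) (hc i) (g i), res_mem_H2 (hc i) (g i)⟩

theorem sysOp_resPair (hc : ∀ i, 0 < c i) (g : Fin 2 → L2 n) (i : Fin 2) :
    sysOp c M (resPair c hc g) i = g i - ∑ j, M i j (resPair c hc g j) := by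
  simp only [sysOp, resPair, lap_res, sub_sub_cancel]

theorem resPair_surjective (hc : ∀ i, 0 < c i) (h : Fin 2 → H2 n) :
    ∃ g, resPair c hc g = h :=
  ⟨fun i => (c i : ℂ) • (h i : L2 n) - lap (h i),
    funext fun i => Subtype.ext (res_sub_lap (hc i) (h i))⟩

/-- Injectivity of the resolvent turns the differential system into a fixed-point equation. It makes
sense for L² pairs and exposes the positivity of the resolvent. -/
theorem sysOp_eq_iff (hc : ∀ i, 0 < c i) (h : Fin 2 → H2 n) (s : Fin 2 → L2 n) :
    sysOp c M h = s ↔ ∀ i, (h i : L2 n) = res (c i) (hc i) (s i + ∑ j, M i j (h j)) := by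
  obtain ⟨g, rfl⟩ := resPair_surjective hc h
  rw [funext_iff]
  refine forall_congr' fun i => ?_
  rw [sysOp_resPair, sub_eq_iff_eq_add]
  refine ⟨fun h => by rw [← h]; rfl, fun h => ?_⟩
  have h1 : res (c i) (hc i) (g i - (s i + ∑ j, M i j (resPair c hc g j))) = 0 := by
    rw [map_sub, ← h]; exact sub_self _
  exact sub_eq_zero.mp
    (mult_injective (essBdd_resSymbol (hc i)) (fun ξ => (resSymbol_pos (hc i) ξ).ne') h1)

/-- If a pair of `L²` functions solves the resolvent equation then it is in `H²`. -/
theorem exists_sysOp_eq (hc : ∀ i, 0 < c i) {f s : Fin 2 → L2 n}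
    (h : ∀ i, f i = res (c i) (hc i) (s i + ∑ j, M i j (f j))) :
    ∃ k : Fin 2 → H2 n, (∀ i, (k i : L2 n) = f i) ∧ sysOp c M k = s := by
  have h1 : ∀ i, (resPair c hc (fun i => s i + ∑ j, M i j (f j)) i : L2 n) = f i := fun i =>
    (h i).symm
  refine ⟨resPair c hc fun i => s i + ∑ j, M i j (f j), h1, (sysOp_eq_iff hc _ _).mpr fun i => ?_⟩
  rw [h1]
  simp only [h1]
  exact h i

/-- The Birman–Schwinger operator `(c - Δ)^{-1/2} M (c - Δ)^{-1/2}`. -/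
def birmanSchwinger (c : Fin 2 → ℝ) (hc : ∀ i, 0 < c i) (M : Fin 2 → Fin 2 → L2 n →L[ℂ] L2 n) :
    L2Pair n →L[ℂ] L2Pair n :=
  blockOp fun i j => sqrtRes (c i) (hc i) ∘L M i j ∘L sqrtRes (c j) (hc j)

/-- The pair `(cᵢ - Δ)^{-1/2} gᵢ`. -/
def rootPair (c : Fin 2 → ℝ) (hc : ∀ i, 0 < c i) (g : Fin 2 → L2 n) : L2Pair n :=
  WithLp.toLp 2 fun i => sqrtRes (c i) (hc i) (g i)

theorem sqrtRes_isSymmetric {κ : ℝ} (hκ : 0 < κ) (f g : L2 n) :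
    ⟪sqrtRes κ hκ f, g⟫_ℂ = ⟪f, sqrtRes κ hκ g⟫_ℂ := mult_isSymmetric _ _ _

theorem birmanSchwinger_isSymmetric (hc : ∀ i, 0 < c i) (hM : SymmMat M) :
    (birmanSchwinger c hc M : L2Pair n →ₗ[ℂ] L2Pair n).IsSymmetric :=
  blockOp_isSymmetric fun i j x y => by
    simp only [ContinuousLinearMap.comp_apply]
    rw [sqrtRes_isSymmetric, hM, sqrtRes_isSymmetric]

/-- With L = `sysOp c M`, R = (c - Δ)⁻¹ and h = R g this is R^{1/2} L h = (1 - K) R^{1/2} g: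
conjugation by R^{1/2} replaces the unbounded operator L by the bounded operator 1 - K. -/
theorem sub_birmanSchwinger_rootPair (hc : ∀ i, 0 < c i) (g : Fin 2 → L2 n) (i : Fin 2) :
    (rootPair c hc g - birmanSchwinger c hc M (rootPair c hc g)) i
      = sqrtRes (c i) (hc i) (sysOp c M (resPair c hc g) i) := by
  rw [PiLp.sub_apply, birmanSchwinger, blockOp_apply, sysOp_resPair, map_sub, map_sum]
  simp only [rootPair, ContinuousLinearMap.comp_apply, sqrtRes_sqrtRes]
  rfl

theorem inner_sub_birmanSchwinger_rootPair (hc : ∀ i, 0 < c i) (g : Fin 2 → L2 n) :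
    ⟪rootPair c hc g - birmanSchwinger c hc M (rootPair c hc g), rootPair c hc g⟫_ℂ
      = ∑ i, ⟪sysOp c M (resPair c hc g) i, (resPair c hc g i : L2 n)⟫_ℂ := by
  rw [PiLp.inner_apply]
  refine Finset.sum_congr rfl fun i _ => ?_
  rw [sub_birmanSchwinger_rootPair, sqrtRes_isSymmetric]
  change ⟪_, sqrtRes (c i) (hc i) (sqrtRes (c i) (hc i) (g i))⟫_ℂ = _
  rw [sqrtRes_sqrtRes]
  rfl

theorem denseRange_sqrtRes {κ : ℝ} (hκ : 0 < κ) :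
    DenseRange (sqrtRes κ hκ : L2 n → L2 n) := by
  have h : (LinearMap.range ((sqrtRes κ hκ : L2 n →L[ℂ] L2 n) : L2 n →ₗ[ℂ] L2 n)).topologicalClosure = ⊤ := by
    rw [Submodule.topologicalClosure_eq_top_iff, Submodule.eq_bot_iff]
    intro x hx
    refine sqrtRes_injective hκ (inner_self_eq_zero (𝕜 := ℂ).mp ?_)
    rw [← sqrtRes_isSymmetric]
    exact Submodule.inner_right_of_mem_orthogonal (LinearMap.mem_range_self _ (sqrtRes κ hκ x)) hx
  exact (Submodule.dense_iff_topologicalClosure_eq_top.mpr h)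

theorem denseRange_rootPair (hc : ∀ i, 0 < c i) : DenseRange (rootPair (n := n) c hc) := by
  have h1 : DenseRange (Pi.map fun i => (sqrtRes (c i) (hc i) : L2 n → L2 n)) :=
    DenseRange.piMap fun i => denseRange_sqrtRes (hc i)
  exact (PiLp.continuousLinearEquiv 2 ℂ (fun _ : Fin 2 => L2 n)).symm.surjective.denseRange.comp h1
    (PiLp.continuousLinearEquiv 2 ℂ (fun _ : Fin 2 => L2 n)).symm.continuous

/-- The vectors R^{1/2} g are dense because R^{1/2} is symmetric and injective, and on them the form
is that of the differential operator. -/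
theorem birmanSchwinger_nonneg (hc : ∀ i, 0 < c i) (hpos : ∀ h, 0 ≤ sysForm c M h)
    (x : L2Pair n) : 0 ≤ (⟪x - birmanSchwinger c hc M x, x⟫_ℂ).re := by
  refine (denseRange_rootPair hc).induction_on
    (p := fun x => 0 ≤ (⟪x - birmanSchwinger c hc M x, x⟫_ℂ).re) x ?_ fun g => ?_
  · exact isClosed_le continuous_const (Complex.continuous_re.comp
      ((continuous_id.sub (birmanSchwinger c hc M).continuous).inner continuous_id))
  · rw [inner_sub_birmanSchwinger_rootPair]
    exact hpos _

/-- Although `z` is only in L², the pair k = R^{1/2} z satisfies k = R (s + M k), and the resolvent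
R maps L² into H². Every solution found on the bounded side thus returns to H². -/
theorem exists_sysOp_of_birmanSchwinger (hc : ∀ i, 0 < c i) {z : L2Pair n} {s : Fin 2 → L2 n}
    (h : ∀ i, (z - birmanSchwinger c hc M z) i = sqrtRes (c i) (hc i) (s i)) :
    ∃ k : Fin 2 → H2 n, (∀ i, (k i : L2 n) = sqrtRes (c i) (hc i) (z i)) ∧ sysOp c M k = s := by
  refine exists_sysOp_eq hc fun i => ?_
  have h1 := h i
  rw [PiLp.sub_apply, birmanSchwinger, blockOp_apply, sub_eq_iff_eq_add] at h1
  simp only [ContinuousLinearMap.comp_apply] at h1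
  rw [← map_sum, ← map_add] at h1
  rw [h1, sqrtRes_sqrtRes]

/-- A null vector of a nonnegative form is in the kernel: after conjugation this is
`norm_sq_le_of_nonneg`, and R^{1/2} is injective. -/
theorem sysOp_eq_zero_of_form (hc : ∀ i, 0 < c i) (hM : SymmMat M)
    (hpos : ∀ h, 0 ≤ sysForm c M h) {h : Fin 2 → H2 n} (h0 : sysForm c M h = 0) :
    sysOp c M h = 0 := by
  obtain ⟨g, rfl⟩ := resPair_surjective hc h
  have hsymm : ((ContinuousLinearMap.id ℂ (L2Pair n) - birmanSchwinger c hc M :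
      L2Pair n →L[ℂ] L2Pair n) : L2Pair n →ₗ[ℂ] L2Pair n).IsSymmetric := fun x y => by
    simp only [ContinuousLinearMap.coe_coe, _root_.sub_apply, ContinuousLinearMap.id_apply,
      inner_sub_left, inner_sub_right]
    congr 1
    exact birmanSchwinger_isSymmetric hc hM x y
  have h1 := norm_sq_le_of_nonneg hsymm (birmanSchwinger_nonneg hc hpos) (rootPair c hc g)
  simp only [_root_.sub_apply, ContinuousLinearMap.id_apply] at h1
  rw [inner_sub_birmanSchwinger_rootPair] at h1
  change _ ≤ _ * sysForm c M _ at h1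
  rw [h0, mul_zero] at h1
  have h2 : rootPair c hc g - birmanSchwinger c hc M (rootPair c hc g) = 0 :=
    norm_eq_zero.mp (pow_eq_zero_iff two_ne_zero |>.mp (le_antisymm h1 (sq_nonneg _)))
  ext1 i
  refine sqrtRes_injective (hc i) ?_
  rw [← sub_birmanSchwinger_rootPair, h2]
  rfl

/-- `M - τ`. -/
def shiftMat (M : Fin 2 → Fin 2 → L2 n →L[ℂ] L2 n) (τ : ℝ) : Fin 2 → Fin 2 → L2 n →L[ℂ] L2 n :=
  fun i j => M i j - if i = j then (τ : ℂ) • ContinuousLinearMap.id ℂ (L2 n) else 0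

theorem sum_shiftMat (τ : ℝ) (f : Fin 2 → L2 n) (i : Fin 2) :
    ∑ j, shiftMat M τ i j (f j) = ∑ j, M i j (f j) - (τ : ℂ) • f i := by
  simp only [shiftMat, _root_.sub_apply, Finset.sum_sub_distrib]
  congr 1
  rw [Finset.sum_eq_single i (fun j _ hj => by rw [if_neg hj.symm]; rfl)
    (fun h => absurd (Finset.mem_univ i) h), if_pos rfl]
  rfl

theorem sysOp_shiftMat (τ : ℝ) (h : Fin 2 → H2 n) (i : Fin 2) :
    sysOp c (shiftMat M τ) h i = sysOp c M h i + (τ : ℂ) • (h i : L2 n) := by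
  rw [sysOp, sysOp, sum_shiftMat τ (fun j => (h j : L2 n))]
  abel

theorem sysOp_add_shiftMat (τ : ℝ) :
    sysOp (n := n) (fun i => c i + τ) (shiftMat M (-τ)) = sysOp c M := by
  ext1 h
  ext1 i
  rw [sysOp, sysOp, sum_shiftMat (-τ) (fun j => (h j : L2 n)), Complex.ofReal_add, add_smul,
    Complex.ofReal_neg, neg_smul]
  abel

/-- If the quadratic form takes negative values then a shift of the operator is nonnegative and
has a nontrivial kernel. -/
theorem exists_ground_state (hc : ∀ i, 0 < c i) (hM : SymmMat M)
    (hcpt : ∀ i j, IsCompactOperator (sqrtRes (c i) (hc i) ∘L M i j)) {h₀ : Fin 2 → H2 n}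
    (h0 : sysForm c M h₀ < 0) :
    ∃ τ : ℝ, 0 < τ ∧ (∀ h, 0 ≤ sysForm c (shiftMat M τ) h) ∧
      ∃ h, h ≠ 0 ∧ sysOp c (shiftMat M τ) h = 0 := by
  -- Conjugation by R^{1/2} turns the shift of the operator by τ into the term τ R, so R plays the
  -- role of `C` in `exists_zero_mode`.
  set C : L2Pair n →L[ℂ] L2Pair n :=
    blockOp fun i j => if i = j then res (c i) (hc i) else 0 with hC
  have hCapp : ∀ x i, C x i = res (c i) (hc i) (x i) := fun x i => by
    rw [hC, blockOp_apply, Finset.sum_eq_single i (fun j _ hj => by rw [if_neg hj.symm]; rfl)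
      (fun h => absurd (Finset.mem_univ i) h), if_pos rfl]
  have hCin : ∀ x y, ⟪C x, y⟫_ℂ =
      ∑ i, ⟪sqrtRes (c i) (hc i) (x i), sqrtRes (c i) (hc i) (y i)⟫_ℂ := fun x y => by
    rw [PiLp.inner_apply]
    refine Finset.sum_congr rfl fun i _ => ?_
    rw [hCapp, ← sqrtRes_sqrtRes, sqrtRes_isSymmetric]
  obtain ⟨g, rfl⟩ := resPair_surjective hc h₀
  obtain ⟨τ, hτ, hpos, u, hu, hueq⟩ := exists_zero_mode (C := C) (K := birmanSchwinger c hc M)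
    (fun x y => by
      rw [ContinuousLinearMap.coe_coe, hCin, PiLp.inner_apply]
      refine Finset.sum_congr rfl fun i _ => ?_
      rw [hCapp, ← sqrtRes_sqrtRes, sqrtRes_isSymmetric])
    (fun x => by
      rw [hCin, Complex.re_sum]
      exact Finset.sum_nonneg fun i _ => inner_self_nonneg (𝕜 := ℂ))
    (fun x hx => by
      ext1 i
      refine mult_injective (essBdd_resSymbol (hc i)) (fun ξ => (resSymbol_pos (hc i) ξ).ne') ?_
      change res (c i) (hc i) (x i) = 0
      rw [← hCapp, hx]
      rfl)
    (birmanSchwinger_isSymmetric hc hM)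
    (isCompactOperator_blockOp fun i j => by
      rw [← ContinuousLinearMap.comp_assoc]
      exact (hcpt i j).comp_clm _)
    (u₀ := rootPair c hc g) (by rw [inner_sub_birmanSchwinger_rootPair]; exact h0)
  refine ⟨τ, hτ, fun h => ?_, ?_⟩
  · obtain ⟨g, rfl⟩ := resPair_surjective hc h
    have h1 := hpos (rootPair c hc g)
    rw [add_sub_right_comm, inner_add_left, inner_sub_birmanSchwinger_rootPair, inner_smul_left,
      hCin] at h1
    refine h1.trans_eq ?_
    rw [sysForm, Complex.conj_ofReal, Finset.mul_sum, ← Finset.sum_add_distrib]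
    congr 1
    refine Finset.sum_congr rfl fun i _ => ?_
    rw [sysOp_shiftMat, inner_add_left, inner_smul_left, Complex.conj_ofReal]
    simp only [rootPair, sqrtRes_sqrtRes]
    rfl
  · obtain ⟨k, hk, hks⟩ := exists_sysOp_of_birmanSchwinger (M := M) hc (z := u)
      (s := fun i => -((τ : ℂ) • sqrtRes (c i) (hc i) (u i))) fun i => by
        have h1 : u - birmanSchwinger c hc M u = -((τ : ℂ) • C u) := by
          rw [← sub_eq_zero, ← hueq]; abel
        rw [h1, map_neg, map_smul, sqrtRes_sqrtRes, ← hCapp]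
        rfl
    refine ⟨k, fun h => hu ?_, ?_⟩
    · ext1 i
      refine sqrtRes_injective (hc i) ?_
      rw [← hk, h]
      rfl
    · ext1 i
      rw [sysOp_shiftMat, hks, hk]
      exact neg_add_cancel _

end System

/-! ### Perron–Frobenius theory for cooperative systems. -/

section PerronFrobenius

variable {n : ℕ}

/-- A real-valued `L²` function. -/
def RealL (f : L2 n) : Prop := ∀ᵐ x, (f x).im = 0

theorem NonnegL.realL {f : L2 n} (hf : NonnegL f) : RealL f := by
  filter_upwards [hf] with x hx
  exact (Complex.le_def.mp hx).2.symm

theorem nonnegL_zero : NonnegL (0 : L2 n) := by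
  filter_upwards [Lp.coeFn_zero ℂ 2 (volume : Measure (E n))] with x hx
  rw [hx]; rfl

theorem NonnegL.add {f g : L2 n} (hf : NonnegL f) (hg : NonnegL g) : NonnegL (f + g) := by
  filter_upwards [hf, hg, Lp.coeFn_add f g] with x h1 h2 h3
  rw [h3]; exact add_nonneg h1 h2

theorem NonnegL.sum {f : Fin 2 → L2 n} (hf : ∀ i, NonnegL (f i)) : NonnegL (∑ i, f i) := by
  rw [Fin.sum_univ_two]; exact (hf 0).add (hf 1)

theorem RealL.add {f g : L2 n} (hf : RealL f) (hg : RealL g) : RealL (f + g) := by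
  filter_upwards [hf, hg, Lp.coeFn_add f g] with x h1 h2 h3
  rw [h3, Pi.add_apply, Complex.add_im, h1, h2, add_zero]

theorem RealL.sub {f g : L2 n} (hf : RealL f) (hg : RealL g) : RealL (f - g) := by
  filter_upwards [hf, hg, Lp.coeFn_sub f g] with x h1 h2 h3
  rw [h3, Pi.sub_apply, Complex.sub_im, h1, h2, sub_zero]

theorem RealL.smul {f : L2 n} (hf : RealL f) (a : ℝ) : RealL ((a : ℂ) • f) := by
  filter_upwards [hf, Lp.coeFn_smul (a : ℂ) f] with x h1 h2
  rw [h2, Pi.smul_apply, smul_eq_mul, Complex.im_ofReal_mul, h1, mul_zero]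

/-- The modulus of an `L²` function. -/
def absL (f : L2 n) : L2 n := (Lp.memLp f).norm.ofReal.toLp (fun x => ((‖f x‖ : ℝ) : ℂ))

theorem absL_ae (f : L2 n) : absL f =ᵐ[volume] fun x => ((‖f x‖ : ℝ) : ℂ) :=
  MemLp.coeFn_toLp _

theorem absL_nonneg (f : L2 n) : NonnegL (absL f) := by
  filter_upwards [absL_ae f] with x hx
  rw [hx]; exact Complex.zero_le_real.mpr (norm_nonneg _)

theorem absL_sub_nonneg {f : L2 n} (hf : RealL f) : NonnegL (absL f - f) := by
  filter_upwards [absL_ae f, hf, Lp.coeFn_sub (absL f) f] with x h1 h2 h3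
  rw [h3, Pi.sub_apply, h1]
  refine Complex.le_def.mpr ⟨?_, ?_⟩
  · simpa using Complex.re_le_norm (f x)
  · simp [h2]

theorem absL_add_nonneg {f : L2 n} (hf : RealL f) : NonnegL (absL f + f) := by
  filter_upwards [absL_ae f, hf, Lp.coeFn_add (absL f) f] with x h1 h2 h3
  rw [h3, Pi.add_apply, h1]
  refine Complex.le_def.mpr ⟨?_, ?_⟩
  · have := neg_le_of_abs_le (Complex.abs_re_le_norm (f x))
    simp only [Complex.zero_re, Complex.add_re, Complex.ofReal_re]
    linarith
  · simp [h2]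

theorem sub_absL_nonneg {f w : L2 n} (hf : RealL f) (h1 : NonnegL (w - f)) (h2 : NonnegL (w + f)) :
    NonnegL (w - absL f) := by
  filter_upwards [hf, h1, h2, absL_ae f, Lp.coeFn_sub w f, Lp.coeFn_add w f,
    Lp.coeFn_sub w (absL f)] with x hx h1 h2 h3 h4 h5 h6
  rw [h4, Pi.sub_apply, Complex.le_def] at h1
  rw [h5, Pi.add_apply, Complex.le_def] at h2
  rw [h6, Pi.sub_apply, h3, Complex.le_def]
  simp only [Complex.zero_re, Complex.zero_im, Complex.sub_re, Complex.sub_im, Complex.add_re,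
    Complex.add_im, Complex.ofReal_re, Complex.ofReal_im, hx, sub_zero, add_zero] at h1 h2 ⊢
  have hn : ‖f x‖ = |(f x).re| := by
    rw [← Complex.re_add_im (f x), hx]; simp
  rw [hn]
  refine ⟨?_, h1.2⟩
  rw [sub_nonneg, abs_le]
  constructor <;> linarith [h1.1, h2.1]

/-- The real part of an `L²` function. -/
def reL (f : L2 n) : L2 n := (Lp.memLp f).re.ofReal.toLp (fun x => (((f x).re : ℝ) : ℂ))

/-- The imaginary part of an `L²` function. -/
def imL (f : L2 n) : L2 n := (Lp.memLp f).im.ofReal.toLp (fun x => (((f x).im : ℝ) : ℂ))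

theorem reL_ae (f : L2 n) : reL f =ᵐ[volume] fun x => (((f x).re : ℝ) : ℂ) :=
  MemLp.coeFn_toLp _

theorem imL_ae (f : L2 n) : imL f =ᵐ[volume] fun x => (((f x).im : ℝ) : ℂ) :=
  MemLp.coeFn_toLp _

theorem realL_reL (f : L2 n) : RealL (reL f) := by
  filter_upwards [reL_ae f] with x hx
  rw [hx, Complex.ofReal_im]

theorem realL_imL (f : L2 n) : RealL (imL f) := by
  filter_upwards [imL_ae f] with x hx
  rw [hx, Complex.ofReal_im]

theorem reL_add_imL (f : L2 n) : reL f + Complex.I • imL f = f := by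
  refine Lp.ext ?_
  filter_upwards [reL_ae f, imL_ae f, Lp.coeFn_add (reL f) (Complex.I • imL f),
    Lp.coeFn_smul Complex.I (imL f)] with x h1 h2 h3 h4
  rw [h3, Pi.add_apply, h4, Pi.smul_apply, h1, h2, smul_eq_mul, mul_comm, Complex.re_add_im]

theorem RealL.eq_of_add_I_smul {a b a' b' : L2 n} (ha : RealL a) (hb : RealL b) (ha' : RealL a')
    (hb' : RealL b') (h : a + Complex.I • b = a' + Complex.I • b') : a = a' ∧ b = b' := by
  have key : ∀ᵐ x, a x = a' x ∧ b x = b' x := by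
    have h0 : (a + Complex.I • b : L2 n) =ᵐ[volume] (a' + Complex.I • b' : L2 n) := by rw [h]
    filter_upwards [ha, hb, ha', hb', h0, Lp.coeFn_add a (Complex.I • b),
      Lp.coeFn_smul Complex.I b, Lp.coeFn_add a' (Complex.I • b'),
      Lp.coeFn_smul Complex.I b'] with x h1 h2 h3 h4 h5 h6 h7 h8 h9
    rw [h6, h8, Pi.add_apply, Pi.add_apply, h7, h9, Pi.smul_apply, Pi.smul_apply] at h5
    have hre := congrArg Complex.re h5
    have him := congrArg Complex.im h5
    simp [h1, h2, h3, h4] at hre him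
    exact ⟨Complex.ext hre (h1.trans h3.symm), Complex.ext him (h2.trans h4.symm)⟩
  exact ⟨Lp.ext (key.mono fun x hx => hx.1), Lp.ext (key.mono fun x hx => hx.2)⟩

/-- Positivity preserving operators preserve real functions. -/
theorem RealL.map {A : L2 n →L[ℂ] L2 n} (hA : ∀ g, NonnegL g → NonnegL (A g)) {f : L2 n}
    (hf : RealL f) : RealL (A f) := by
  have h1 : A f = (((1 / 2 : ℝ) : ℂ)) • (A (absL f + f) - A (absL f - f)) := by
    rw [← map_sub, ← map_smul]
    congr 1
    have : absL f + f - (absL f - f) = (2 : ℂ) • f := by rw [two_smul]; abel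
    rw [this, smul_smul]
    norm_num
  rw [h1]
  exact ((hA _ (absL_add_nonneg hf)).realL.sub (hA _ (absL_sub_nonneg hf)).realL).smul _

theorem PosL.nonnegL {f : L2 n} (hf : PosL f) : NonnegL f := hf.mono fun _ h => h.le

theorem PosL.inner_pos {f g : L2 n} (hf : PosL f) (hg : PosL g) : 0 < (⟪f, g⟫_ℂ).re := by
  have h0 := hf.nonnegL.inner hg.nonnegL
  refine lt_of_le_of_ne (Complex.le_def.mp h0).1 fun h => ?_
  have h1 : ⟪f, g⟫_ℂ = ∫ x, ⟪f x, g x⟫_ℂ := rfl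
  have h2 := integral_re (L2.integrable_inner (𝕜 := ℂ) f g)
  simp only [RCLike.re_eq_complex_re] at h2
  have h3 : ∀ᵐ x, 0 < (⟪f x, g x⟫_ℂ).re := by
    filter_upwards [hf, hg] with x hx hy
    have h4 : 0 < g x * conj (f x) := mul_pos hy (star_pos_iff.mpr hx)
    exact (Complex.lt_def.mp h4).1
  rw [← h1] at h2
  rw [← h2] at h
  have h5 := (integral_eq_zero_iff_of_nonneg_ae (h3.mono fun x hx => hx.le)
    (L2.integrable_inner (𝕜 := ℂ) f g).re).mp (by simpa using h.symm)
  obtain ⟨x, hx, hx'⟩ := (h3.and h5).exists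
  exact hx.ne' hx'

/-- A matrix of positivity preserving operators with diagonal entries at least `1`. -/
structure PosMat (M : Fin 2 → Fin 2 → L2 n →L[ℂ] L2 n) : Prop where
  nonneg : ∀ i j g, NonnegL g → NonnegL (M i j g)
  one_le : ∀ i g, NonnegL g → NonnegL (M i i g - g)

variable {c : Fin 2 → ℝ} {M : Fin 2 → Fin 2 → L2 n →L[ℂ] L2 n}

/-- Put L = `sysOp c M`, w = R M |h| and d = w - |h|. Positivity of R and M gives d ≥ 0, and L w =
-M d. Hence 0 ≤ ⟨L w, w⟩ = -⟨M d, w⟩ ≤ -‖d‖², the last step because the diagonal of M dominates the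
identity and w ≥ d ≥ 0. So d = 0 and |h| = w is in the kernel. -/
theorem PosMat.exists_abs (hM : PosMat M) (hc : ∀ i, 0 < c i) (hpos : ∀ h, 0 ≤ sysForm c M h)
    {h : Fin 2 → H2 n} (hh : sysOp c M h = 0) (hr : ∀ i, RealL (h i : L2 n)) :
    ∃ k : Fin 2 → H2 n, (∀ i, (k i : L2 n) = absL (h i)) ∧ sysOp c M k = 0 := by
  have hh' := (sysOp_eq_iff hc h 0).mp hh
  simp only [Pi.zero_apply, zero_add] at hh'
  set w := resPair c hc fun i => ∑ j, M i j (absL (h j)) with hw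
  have hwi : ∀ i, (w i : L2 n) = res (c i) (hc i) (∑ j, M i j (absL (h j))) := fun i => rfl
  set d : Fin 2 → L2 n := fun i => (w i : L2 n) - absL (h i) with hd
  have hdn : ∀ i, NonnegL (d i) := fun i => by
    refine sub_absL_nonneg (hr i) ?_ ?_
    · rw [hwi, hh' i]
      rw [← map_sub, ← Finset.sum_sub_distrib]
      simp only [← map_sub]
      exact NonnegL.res (NonnegL.sum fun j => hM.nonneg _ _ _ (absL_sub_nonneg (hr j))) _
    · rw [hwi, hh' i]
      rw [← map_add, ← Finset.sum_add_distrib]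
      simp only [← map_add]
      exact NonnegL.res (NonnegL.sum fun j => hM.nonneg _ _ _ (absL_add_nonneg (hr j))) _
  have hwn : ∀ i, NonnegL (w i : L2 n) := fun i =>
    NonnegL.res (NonnegL.sum fun j => hM.nonneg _ _ _ (absL_nonneg _)) _
  have hop : ∀ i, sysOp c M w i = -∑ j, M i j (d j) := fun i => by
    rw [hw, sysOp_resPair, ← hw, ← Finset.sum_sub_distrib, ← Finset.sum_neg_distrib]
    refine Finset.sum_congr rfl fun j _ => ?_
    rw [hd, map_sub, neg_sub]
  have hle : ∀ i, ‖d i‖ ^ 2 ≤ (⟪∑ j, M i j (d j), (w i : L2 n)⟫_ℂ).re := fun i => by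
    rw [sum_inner, Complex.re_sum]
    refine le_trans ?_ (Finset.single_le_sum (f := fun j => (⟪M i j (d j), (w i : L2 n)⟫_ℂ).re)
      (fun j _ => (Complex.le_def.mp ((hM.nonneg _ _ _ (hdn j)).inner (hwn i))).1)
      (Finset.mem_univ i))
    have h1 := (Complex.le_def.mp ((hM.one_le i _ (hdn i)).inner (hwn i))).1
    have h2 := (Complex.le_def.mp ((hdn i).inner (absL_nonneg (h i)))).1
    have h3 : (w i : L2 n) = d i + absL (h i) := (sub_add_cancel _ _).symm
    have h4 : (⟪d i, (w i : L2 n)⟫_ℂ).re = ‖d i‖ ^ 2 + (⟪d i, absL (h i)⟫_ℂ).re := by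
      rw [h3, inner_add_right, Complex.add_re, inner_self_eq_norm_sq_to_K]
      norm_cast
    rw [inner_sub_left, Complex.sub_re, Complex.zero_re] at h1
    rw [Complex.zero_re] at h2
    linarith
  have hsum := hpos w
  rw [sysForm] at hsum
  simp only [hop, inner_neg_left, Finset.sum_neg_distrib, Complex.neg_re] at hsum
  rw [Complex.re_sum] at hsum
  have hd0 : ∀ i, d i = 0 := fun i => by
    have h1 : ∑ i, ‖d i‖ ^ 2 ≤ 0 := (Finset.sum_le_sum fun i _ => hle i).trans (by linarith)
    have h2 := (Finset.single_le_sum (f := fun i => ‖d i‖ ^ 2) (fun i _ => sq_nonneg _)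
      (Finset.mem_univ i)).trans h1
    exact norm_eq_zero.mp (pow_eq_zero_iff two_ne_zero |>.mp (le_antisymm h2 (sq_nonneg _)))
  refine ⟨w, fun i => sub_eq_zero.mp (hd0 i), ?_⟩
  ext1 i
  rw [hop]
  simp [hd0]

/-- The resolvent improves positivity. The alternative is taken component by component because the
coupling between the components may vanish. -/
theorem PosMat.eq_zero_or_pos (hM : PosMat M) (hc : ∀ i, 0 < c i) {h : Fin 2 → H2 n}
    (hh : sysOp c M h = 0) (hn : ∀ i, NonnegL (h i : L2 n)) (i : Fin 2) :
    (h i : L2 n) = 0 ∨ PosL (h i : L2 n) := by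
  have hh' := (sysOp_eq_iff hc h 0).mp hh i
  rw [Pi.zero_apply, zero_add] at hh'
  by_cases h0 : ∑ j, M i j (h j) = 0
  · left; rw [hh', h0, map_zero]
  · right
    rw [hh']
    exact NonnegL.res_pos (NonnegL.sum fun j => hM.nonneg _ _ _ (hn j)) h0 _

/-- Both |h| + h and |h| - h are nonnegative kernel elements, so each of their components is zero or
positive almost everywhere. They cannot both be positive, since at each point where h is real one of
the two vanishes. -/
theorem PosMat.sign (hM : PosMat M) (hc : ∀ i, 0 < c i) (hpos : ∀ h, 0 ≤ sysForm c M h)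
    {h : Fin 2 → H2 n} (hh : sysOp c M h = 0) (hr : ∀ i, RealL (h i : L2 n)) (i : Fin 2) :
    (h i : L2 n) = 0 ∨ PosL (h i : L2 n) ∨ PosL (-(h i : L2 n)) := by
  obtain ⟨k, hk, hk0⟩ := hM.exists_abs hc hpos hh hr
  have hkp := hM.eq_zero_or_pos hc hk0 (fun i => by rw [hk]; exact absL_nonneg _) i
  have hm1 : sysOp c M (k + (-1 : ℂ) • h) = 0 := by
    rw [sysOp_add, sysOp_smul, hk0, hh, smul_zero, add_zero]
  have hp1 : sysOp c M (k + h) = 0 := by rw [sysOp_add, hk0, hh, add_zero]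
  have em : ∀ i, (((k + (-1 : ℂ) • h) i : H2 n) : L2 n) = absL (h i) - (h i : L2 n) := fun i => by
    rw [Pi.add_apply, Submodule.coe_add, hk, Pi.smul_apply, Submodule.coe_smul, neg_one_smul,
      sub_eq_add_neg]
  have ep : ∀ i, (((k + h) i : H2 n) : L2 n) = absL (h i) + (h i : L2 n) := fun i => by
    rw [Pi.add_apply, Submodule.coe_add, hk]
  have hmp := hM.eq_zero_or_pos hc hm1 (fun i => by rw [em]; exact absL_sub_nonneg (hr i)) i
  have hpp := hM.eq_zero_or_pos hc hp1 (fun i => by rw [ep]; exact absL_add_nonneg (hr i)) i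
  rw [em] at hmp
  rw [ep] at hpp
  rw [hk] at hkp
  rcases hmp with hm | hm
  · rw [sub_eq_zero.mp hm] at hkp
    exact hkp.imp id Or.inl
  · rcases hpp with hp | hp
    · rw [eq_neg_of_add_eq_zero_left hp] at hkp
      exact hkp.imp neg_eq_zero.mp Or.inr
    · exfalso
      obtain ⟨x, ⟨⟨⟨⟨h1, h2⟩, h3⟩, h4⟩, h5⟩, h6⟩ := ((((((hr i).and (absL_ae (h i))).and
        (Lp.coeFn_sub (absL (h i)) (h i : L2 n))).and
          (Lp.coeFn_add (absL (h i)) (h i : L2 n))).and hm).and hp).exists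
      rw [h3, Pi.sub_apply, h2, Complex.lt_def] at h5
      rw [h4, Pi.add_apply, h2, Complex.lt_def] at h6
      have hn : ‖(h i : L2 n) x‖ = |((h i : L2 n) x).re| := by
        rw [← Complex.re_add_im ((h i : L2 n) x), h1]; simp
      have h7 := h5.1
      have h8 := h6.1
      simp only [Complex.zero_re, Complex.sub_re, Complex.add_re, Complex.ofReal_re, hn] at h7 h8
      rcases abs_choice ((h i : L2 n) x).re with h9 | h9 <;> rw [h9] at h7 h8 <;> linarith

/-- Resolvents and positivity preserving operators map real functions to real functions, so the
fixed-point equation separates into real and imaginary parts. -/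
theorem PosMat.exists_real_imag (hM : PosMat M) (hc : ∀ i, 0 < c i) {h : Fin 2 → H2 n}
    (hh : sysOp c M h = 0) :
    ∃ a b : Fin 2 → H2 n, sysOp c M a = 0 ∧ sysOp c M b = 0 ∧ (∀ i, RealL (a i : L2 n)) ∧
      (∀ i, RealL (b i : L2 n)) ∧ ∀ i, (h i : L2 n) = a i + Complex.I • (b i : L2 n) := by
  have hh' := (sysOp_eq_iff hc h 0).mp hh
  simp only [Pi.zero_apply, zero_add] at hh'
  have hreal : ∀ (f : Fin 2 → L2 n) (i : Fin 2), (∀ j, RealL (f j)) →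
      RealL (res (c i) (hc i) (∑ j, M i j (f j))) := fun f i hf => by
    refine RealL.map (fun g hg => hg.res (hc i)) ?_
    rw [Fin.sum_univ_two]
    exact ((hf 0).map (hM.nonneg i 0)).add ((hf 1).map (hM.nonneg i 1))
  have key : ∀ i, reL (h i : L2 n) = res (c i) (hc i) (∑ j, M i j (reL (h j : L2 n))) ∧
      imL (h i : L2 n) = res (c i) (hc i) (∑ j, M i j (imL (h j : L2 n))) := fun i => by
    refine RealL.eq_of_add_I_smul (realL_reL _) (realL_imL _)
      (hreal _ i fun j => realL_reL _) (hreal _ i fun j => realL_imL _) ?_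
    rw [reL_add_imL, ← map_smul, ← map_add, Finset.smul_sum, ← Finset.sum_add_distrib]
    simp only [← map_smul, ← map_add, reL_add_imL]
    exact hh' i
  obtain ⟨a, ha, ha0⟩ := exists_sysOp_eq (M := M) (s := 0) hc (f := fun i => reL (h i : L2 n))
    fun i => by rw [Pi.zero_apply, zero_add]; exact (key i).1
  obtain ⟨b, hb, hb0⟩ := exists_sysOp_eq (M := M) (s := 0) hc (f := fun i => imL (h i : L2 n))
    fun i => by rw [Pi.zero_apply, zero_add]; exact (key i).2
  refine ⟨a, b, ha0, hb0, fun i => ?_, fun i => ?_, fun i => ?_⟩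
  · rw [ha]; exact realL_reL _
  · rw [hb]; exact realL_imL _
  · rw [ha, hb, reL_add_imL]

/-- Subtracting the projection leaves a kernel element whose component `i` is orthogonal to `φ i`.
Two functions of strict constant sign are never orthogonal, so that component vanishes. -/
theorem PosMat.exists_eq_smul_of_real (hM : PosMat M) (hc : ∀ i, 0 < c i)
    (hpos : ∀ h, 0 ≤ sysForm c M h) {φ ψ : Fin 2 → H2 n} (hφ : sysOp c M φ = 0)
    (hφr : ∀ i, RealL (φ i : L2 n)) (hψ : sysOp c M ψ = 0) (hψr : ∀ i, RealL (ψ i : L2 n))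
    {i : Fin 2} (hi : (φ i : L2 n) ≠ 0) : ∃ a : ℂ, (ψ i : L2 n) = a • (φ i : L2 n) := by
  set a : ℝ := (⟪(φ i : L2 n), (ψ i : L2 n)⟫_ℂ).re / ‖(φ i : L2 n)‖ ^ 2 with ha
  have hk0 : sysOp c M (ψ + (-(a : ℂ)) • φ) = 0 := by
    rw [sysOp_add, sysOp_smul, hφ, hψ, smul_zero, add_zero]
  have hk : ∀ i, (((ψ + (-(a : ℂ)) • φ) i : H2 n) : L2 n) = ψ i - (a : ℂ) • (φ i : L2 n) :=
    fun i => by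
      rw [Pi.add_apply, Submodule.coe_add, Pi.smul_apply, Submodule.coe_smul, neg_smul,
        sub_eq_add_neg]
  have hin : (⟪(φ i : L2 n), (ψ i : L2 n) - (a : ℂ) • (φ i : L2 n)⟫_ℂ).re = 0 := by
    have hne : ‖(φ i : L2 n)‖ ≠ 0 := norm_ne_zero_iff.mpr hi
    have h1 : ⟪(φ i : L2 n), (φ i : L2 n)⟫_ℂ = ((‖(φ i : L2 n)‖ ^ 2 : ℝ) : ℂ) := by
      rw [inner_self_eq_norm_sq_to_K]; norm_cast
    rw [inner_sub_right, inner_smul_right, h1, Complex.sub_re, ← Complex.ofReal_mul,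
      Complex.ofReal_re, ha, div_mul_cancel₀ _ (pow_ne_zero 2 hne), sub_self]
  have s1 := (hM.sign hc hpos hφ hφr i).resolve_left hi
  have s2 := hM.sign hc hpos hk0 (fun i => by rw [hk]; exact (hψr i).sub ((hφr i).smul a)) i
  rw [hk] at s2
  rcases s2 with s2 | s2
  · exact ⟨a, sub_eq_zero.mp s2⟩
  · exfalso
    rcases s1 with s1 | s1 <;> rcases s2 with s2 | s2 <;> have h1 := s1.inner_pos s2 <;>
      simp only [inner_neg_left, inner_neg_right, neg_neg, Complex.neg_re, hin] at h1 <;>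
      simp at h1

/-- The components of the kernel of a nonnegative cooperative system are one-dimensional. -/
theorem PosMat.exists_eq_smul (hM : PosMat M) (hc : ∀ i, 0 < c i)
    (hpos : ∀ h, 0 ≤ sysForm c M h) {φ ψ : Fin 2 → H2 n} (hφ : sysOp c M φ = 0)
    (hφr : ∀ i, RealL (φ i : L2 n)) (hψ : sysOp c M ψ = 0)
    {i : Fin 2} (hi : (φ i : L2 n) ≠ 0) : ∃ a : ℂ, (ψ i : L2 n) = a • (φ i : L2 n) := by
  obtain ⟨a, b, ha, hb, har, hbr, hab⟩ := hM.exists_real_imag hc hψ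
  obtain ⟨s, hs⟩ := hM.exists_eq_smul_of_real hc hpos hφ hφr ha har hi
  obtain ⟨t, ht⟩ := hM.exists_eq_smul_of_real hc hpos hφ hφr hb hbr hi
  exact ⟨s + Complex.I * t, by rw [hab, hs, ht, add_smul, mul_smul]⟩

/-- A matrix of operators that preserves positivity up to a multiple of the identity. -/
def Cooperative (M : Fin 2 → Fin 2 → L2 n →L[ℂ] L2 n) : Prop :=
  ∃ κ : ℝ, 0 ≤ κ ∧ ∀ i j g, NonnegL g → NonnegL (shiftMat M (-κ) i j g)

theorem shiftMat_neg_apply (κ : ℝ) (i j : Fin 2) (g : L2 n) :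
    shiftMat M (-κ) i j g = M i j g + if i = j then (κ : ℂ) • g else 0 := by
  rw [shiftMat, _root_.sub_apply, sub_eq_add_neg]
  congr 1
  split_ifs with h
  · change -(((-κ : ℝ) : ℂ) • g) = (κ : ℂ) • g
    rw [Complex.ofReal_neg, neg_smul, neg_neg]
  · exact neg_zero

/-- Adding the same constant to `c` and to the diagonal of `M` does not change the operator. The
part κ makes `M` positivity preserving and the extra 1 provides `PosMat.one_le`. -/
theorem Cooperative.exists_posMat (hM : Cooperative M) (hc : ∀ i, 0 < c i) :
    ∃ (c' : Fin 2 → ℝ) (M' : Fin 2 → Fin 2 → L2 n →L[ℂ] L2 n),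
      (∀ i, 0 < c' i) ∧ PosMat M' ∧ sysOp c' M' = sysOp c M := by
  obtain ⟨κ, hκ, hpos⟩ := hM
  have key : ∀ i j g, shiftMat M (-(κ + 1)) i j g
      = shiftMat M (-κ) i j g + if i = j then g else 0 := fun i j g => by
    rw [shiftMat_neg_apply, shiftMat_neg_apply, add_assoc]
    congr 1
    split_ifs with h
    · rw [Complex.ofReal_add, Complex.ofReal_one, add_smul, one_smul]
    · rw [add_zero]
  refine ⟨fun i => c i + (κ + 1), shiftMat M (-(κ + 1)), fun i => by linarith [hc i],
    ⟨fun i j g hg => ?_, fun i g hg => ?_⟩, sysOp_add_shiftMat _⟩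
  · rw [key]
    refine (hpos i j g hg).add ?_
    split_ifs
    exacts [hg, nonnegL_zero]
  · rw [key, if_pos rfl, add_sub_cancel_right]
    exact hpos i i g hg

theorem Cooperative.shiftMat (hM : Cooperative M) {τ : ℝ} (hτ : 0 ≤ τ) :
    Cooperative (shiftMat M τ) := by
  obtain ⟨κ, hκ, hpos⟩ := hM
  refine ⟨κ + τ, by linarith, fun i j g hg => ?_⟩
  have h1 : ThirdHarmonic.shiftMat (ThirdHarmonic.shiftMat M τ) (-(κ + τ)) i j g
      = ThirdHarmonic.shiftMat M (-κ) i j g := by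
    have h2 : ThirdHarmonic.shiftMat M τ i j g = M i j g - if i = j then (τ : ℂ) • g else 0 := by
      rw [ThirdHarmonic.shiftMat, _root_.sub_apply]
      split_ifs <;> rfl
    rw [shiftMat_neg_apply, shiftMat_neg_apply, h2]
    split_ifs with h
    · rw [Complex.ofReal_add, add_smul]; abel
    · simp
  rw [h1]
  exact hpos i j g hg

/-- A cooperative system that annihilates a positive pair is nonnegative. -/
theorem Cooperative.nonneg_of_pos_kernel (hM : Cooperative M) (hc : ∀ i, 0 < c i)
    (hsymm : SymmMat M) (hcpt : ∀ i j, IsCompactOperator (sqrtRes (c i) (hc i) ∘L M i j))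
    {φ : Fin 2 → H2 n} (hφ : sysOp c M φ = 0) (hφpos : ∀ i, PosL (φ i : L2 n))
    (h : Fin 2 → H2 n) : 0 ≤ sysForm c M h := by
  by_contra! hneg
  -- A negative value yields a ground state with eigenvalue -τ. The moduli `g` of its real and
  -- imaginary parts are null vectors of the shifted operator too; pairing with `φ` gives τ ⟨g, φ⟩ =
  -- 0, and positivity of `φ` forces g = 0.
  obtain ⟨τ, hτ, hpos, k, hk, hk0⟩ := exists_ground_state hc hsymm hcpt hneg
  obtain ⟨c', M', hc', hM', hop⟩ := (hM.shiftMat hτ.le).exists_posMat hc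
  have hform : ∀ h, sysForm c' M' h = sysForm c (ThirdHarmonic.shiftMat M τ) h := fun h => by
    rw [sysForm, sysForm, hop]
  have key : ∀ f : Fin 2 → H2 n, sysOp c' M' f = 0 → (∀ i, RealL (f i : L2 n)) →
      ∀ i, (f i : L2 n) = 0 := by
    intro f hf hfr i
    obtain ⟨g, hg, hg0⟩ := hM'.exists_abs hc' (fun h => by rw [hform]; exact hpos h) hf hfr
    rw [hop] at hg0
    have hgn : ∀ i, NonnegL (g i : L2 n) := fun i => by rw [hg]; exact absL_nonneg _
    have h1 : ∀ i, sysOp c M g i = -((τ : ℂ) • (g i : L2 n)) := fun i =>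
      eq_neg_of_add_eq_zero_left ((sysOp_shiftMat τ g i).symm.trans (congrFun hg0 i))
    have h2 := sysOp_symm (c := c) hsymm g φ
    simp only [h1, hφ, Pi.zero_apply, inner_zero_right, Finset.sum_const_zero, inner_neg_left,
      inner_smul_left, Complex.conj_ofReal, Finset.sum_neg_distrib, neg_eq_zero,
      ← Finset.mul_sum] at h2
    have h3 := (mul_eq_zero.mp h2).resolve_left (Complex.ofReal_ne_zero.mpr hτ.ne')
    have h4 := (Finset.sum_eq_zero_iff_of_nonneg fun j _ =>
      (hgn j).inner (hφpos j).nonnegL).mp h3 i (Finset.mem_univ i)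
    have hgi : (g i : L2 n) = 0 := by
      rcases hM'.eq_zero_or_pos hc' (by rw [hop]; exact hg0) hgn i with h5 | h5
      · exact h5
      · have h6 := h5.inner_pos (hφpos i)
        rw [h4] at h6
        exact absurd h6 (lt_irrefl _)
    rw [hg] at hgi
    refine Lp.ext ?_
    have h7 := absL_ae (f i : L2 n)
    rw [hgi] at h7
    filter_upwards [h7, Lp.coeFn_zero ℂ 2 (volume : Measure (E n))] with x h8 h9
    rw [h9] at h8 ⊢
    simpa using h8.symm
  obtain ⟨a, b, ha, hb, har, hbr, hab⟩ := hM'.exists_real_imag hc' (by rw [hop]; exact hk0)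
  refine hk (funext fun i => Subtype.ext ?_)
  rw [hab, key a ha har, key b hb hbr, smul_zero, add_zero]
  rfl

theorem Cooperative.exists_eq_smul (hM : Cooperative M) (hc : ∀ i, 0 < c i)
    (hpos : ∀ h, 0 ≤ sysForm c M h) {φ ψ : Fin 2 → H2 n} (hφ : sysOp c M φ = 0)
    (hφr : ∀ i, RealL (φ i : L2 n)) (hψ : sysOp c M ψ = 0)
    {i : Fin 2} (hi : (φ i : L2 n) ≠ 0) : ∃ a : ℂ, (ψ i : L2 n) = a • (φ i : L2 n) := by
  obtain ⟨c', M', hc', hM', hop⟩ := hM.exists_posMat hc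
  exact hM'.exists_eq_smul hc' (fun h => by rw [sysForm, hop]; exact hpos h) (by rw [hop]; exact hφ)
    hφr (by rw [hop]; exact hψ) hi

theorem Cooperative.sign (hM : Cooperative M) (hc : ∀ i, 0 < c i)
    (hpos : ∀ h, 0 ≤ sysForm c M h) {h : Fin 2 → H2 n} (hh : sysOp c M h = 0)
    (hr : ∀ i, RealL (h i : L2 n)) (i : Fin 2) :
    (h i : L2 n) = 0 ∨ PosL (h i : L2 n) ∨ PosL (-(h i : L2 n)) := by
  obtain ⟨c', M', hc', hM', hop⟩ := hM.exists_posMat hc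
  exact hM'.sign hc' (fun h => by rw [sysForm, hop]; exact hpos h) (by rw [hop]; exact hh) hr i

end PerronFrobenius

/-! ### Unstable modes and negative directions. -/

section SpectralStability

variable {n : ℕ} {c d : Fin 2 → ℝ} {Mp Mm : Fin 2 → Fin 2 → L2 n →L[ℂ] L2 n}

/-- A negative direction of the first form that is orthogonal to the kernel of the second operator
produces an unstable eigenvalue. -/
theorem exists_unstable_mode (hc : ∀ i, 0 < c i) (hd : ∀ i, 0 < d i) (hMp : SymmMat Mp)
    (hMm : SymmMat Mm) (hMpc : ∀ i j, IsCompactOperator (sqrtRes (c i) (hc i) ∘L Mp i j))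
    (hMmc : ∀ i j, IsCompactOperator (sqrtRes (c i) (hc i) ∘L Mm i j))
    (hpos : ∀ h, 0 ≤ sysForm c Mm h) {h : Fin 2 → H2 n} (hneg : sysForm c Mp h < 0)
    (hperp : ∀ ψ : Fin 2 → H2 n, sysOp c Mm ψ = 0 →
      ∑ i, (d i : ℂ) * ⟪(ψ i : L2 n), (h i : L2 n)⟫_ℂ = 0) :
    ∃ (lam : ℝ) (f g : Fin 2 → H2 n), 0 < lam ∧ f ≠ 0 ∧
      (∀ i, sysOp c Mm g i = ((lam * d i : ℝ) : ℂ) • (f i : L2 n)) ∧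
      ∀ i, sysOp c Mp f i = -(((lam * d i : ℝ) : ℂ) • (g i : L2 n)) := by
  -- This is R^{1/2} diag(d) R^{1/2}, the weight after the same conjugation as the two operators.
  set S : L2Pair n →L[ℂ] L2Pair n :=
    blockOp fun i j => if i = j then (d i : ℂ) • res (c i) (hc i) else 0 with hS
  have hSapp : ∀ x i, S x i = (d i : ℂ) • res (c i) (hc i) (x i) := fun x i => by
    rw [hS, blockOp_apply, Finset.sum_eq_single i (fun j _ hj => by rw [if_neg hj.symm]; rfl)
      (fun h => absurd (Finset.mem_univ i) h), if_pos rfl]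
    rfl
  have hSin : ∀ x y, ⟪S x, y⟫_ℂ =
      ∑ i, (d i : ℂ) * ⟪sqrtRes (c i) (hc i) (x i), sqrtRes (c i) (hc i) (y i)⟫_ℂ := fun x y => by
    rw [PiLp.inner_apply]
    refine Finset.sum_congr rfl fun i _ => ?_
    rw [hSapp, ← sqrtRes_sqrtRes, inner_smul_left, sqrtRes_isSymmetric, Complex.conj_ofReal]
  obtain ⟨v, rfl⟩ := resPair_surjective hc h
  have hcpt : ∀ {M : Fin 2 → Fin 2 → L2 n →L[ℂ] L2 n},
      (∀ i j, IsCompactOperator (sqrtRes (c i) (hc i) ∘L M i j)) →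
      IsCompactOperator (birmanSchwinger c hc M) := fun hM =>
    isCompactOperator_blockOp fun i j => by
      rw [← ContinuousLinearMap.comp_assoc]
      exact (hM i j).comp_clm _
  obtain ⟨lam, u, w, hlam, hu, hw1, hu1⟩ := exists_hamiltonian_mode (S := S)
    (Kp := birmanSchwinger c hc Mp) (Km := birmanSchwinger c hc Mm)
    (fun x y => by
      rw [ContinuousLinearMap.coe_coe, hSin, PiLp.inner_apply]
      refine Finset.sum_congr rfl fun i _ => ?_
      rw [hSapp, ← sqrtRes_sqrtRes, inner_smul_right, sqrtRes_isSymmetric])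
    (fun x hx => by
      ext1 i
      refine mult_injective (essBdd_resSymbol (hc i)) (fun ξ => (resSymbol_pos (hc i) ξ).ne') ?_
      refine (smul_eq_zero.mp (?_ : (d i : ℂ) • res (c i) (hc i) (x i) = 0)).resolve_left
        (Complex.ofReal_ne_zero.mpr (hd i).ne')
      rw [← hSapp, hx]
      rfl)
    (birmanSchwinger_isSymmetric hc hMp) (hcpt hMpc) (birmanSchwinger_isSymmetric hc hMm)
    (hcpt hMmc) (birmanSchwinger_nonneg hc hpos) (u₀ := rootPair c hc v)
    (by rw [inner_sub_birmanSchwinger_rootPair]; exact hneg)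
    -- A fixed vector `z` of the Birman–Schwinger operator corresponds to the kernel element R^{1/2}
    -- z, so `hperp` becomes the orthogonality that `exists_hamiltonian_mode` asks for.
    (fun z hz => by
      obtain ⟨ψ, hψ, hψ0⟩ := exists_sysOp_of_birmanSchwinger (M := Mm) hc (z := z) (s := 0)
        fun i => by rw [hz, sub_self, Pi.zero_apply, map_zero]; rfl
      rw [hSin, ← hperp ψ hψ0]
      refine Finset.sum_congr rfl fun i _ => ?_
      rw [hψ]
      simp only [rootPair, sqrtRes_sqrtRes]
      rfl)
  obtain ⟨g, hg, hg1⟩ := exists_sysOp_of_birmanSchwinger (M := Mm) hc (z := w)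
    (s := fun i => ((lam * d i : ℝ) : ℂ) • sqrtRes (c i) (hc i) (u i)) fun i => by
      rw [hw1, PiLp.smul_apply, hSapp, map_smul, sqrtRes_sqrtRes, smul_smul, Complex.ofReal_mul]
  obtain ⟨f, hf, hf1⟩ := exists_sysOp_of_birmanSchwinger (M := Mp) hc (z := u)
    (s := fun i => -(((lam * d i : ℝ) : ℂ) • sqrtRes (c i) (hc i) (w i))) fun i => by
      rw [hu1, PiLp.neg_apply, PiLp.smul_apply, hSapp, map_neg, map_smul, sqrtRes_sqrtRes,
        smul_smul, Complex.ofReal_mul]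
  refine ⟨lam, f, g, hlam, fun h0 => hu ?_, fun i => ?_, fun i => ?_⟩
  · ext1 i
    refine sqrtRes_injective (hc i) ?_
    rw [← hf, h0]
    rfl
  · rw [hg1, hf]
  · rw [hf1, hg]

/-- An unstable eigenvalue produces a negative direction of the first form. -/
theorem form_neg_of_unstable_mode (hc : ∀ i, 0 < c i) (hd : ∀ i, 0 < d i) (hMp : SymmMat Mp)
    (hMm : SymmMat Mm) (hpos : ∀ h, 0 ≤ sysForm c Mm h) {φ : Fin 2 → H2 n}
    (hφ : sysOp c Mm φ = 0) {lam : ℂ} (hlam : 0 < lam.re) {f g : Fin 2 → H2 n}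
    (hfg : f ≠ 0 ∨ g ≠ 0) (hg : ∀ i, sysOp c Mm g i = (lam * d i) • (f i : L2 n))
    (hf : ∀ i, sysOp c Mp f i = -((lam * d i) • (g i : L2 n))) :
    sysForm c Mp f < 0 ∧ ∑ i, (d i : ℂ) * ⟪(φ i : L2 n), (f i : L2 n)⟫_ℂ = 0 := by
  have hlam0 : lam ≠ 0 := fun h => by rw [h] at hlam; exact lt_irrefl _ hlam
  have hd0 : ∀ i, (d i : ℂ) ≠ 0 := fun i => Complex.ofReal_ne_zero.mpr (hd i).ne'
  constructor
  -- By symmetry both λ z and λ z̄ are real. The difference of their imaginary parts is 2 Re λ · Im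
  -- z, so z is real and the two forms are opposite.
  · set z : ℂ := ∑ i, (d i : ℂ) * ⟪(g i : L2 n), (f i : L2 n)⟫_ℂ with hz
    have hA : ∑ i, ⟪(g i : L2 n), sysOp c Mm g i⟫_ℂ = lam * z := by
      rw [hz, Finset.mul_sum]
      exact Finset.sum_congr rfl fun i _ => by rw [hg, inner_smul_right]; ring
    have hB : ∑ i, ⟪(f i : L2 n), sysOp c Mp f i⟫_ℂ = -(lam * conj z) := by
      rw [hz, map_sum, Finset.mul_sum, ← Finset.sum_neg_distrib]
      refine Finset.sum_congr rfl fun i _ => ?_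
      rw [hf, inner_neg_right, inner_smul_right, map_mul, Complex.conj_ofReal, inner_conj_symm]
      ring
    have him : ∀ {M : Fin 2 → Fin 2 → L2 n →L[ℂ] L2 n}, SymmMat M → ∀ k : Fin 2 → H2 n,
        (∑ i, ⟪(k i : L2 n), sysOp c M k i⟫_ℂ).im = 0 := fun hM k => by
      refine Complex.conj_eq_iff_im.mp ?_
      rw [map_sum]
      simp only [inner_conj_symm]
      exact sysOp_symm hM k k
    have hAim := him hMm g
    have hBim := him hMp f
    have hAre : 0 ≤ (∑ i, ⟪(g i : L2 n), sysOp c Mm g i⟫_ℂ).re := by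
      rw [← sysForm_eq_re]; exact hpos g
    rw [hA] at hAim hAre
    rw [hB] at hBim
    rw [sysForm_eq_re, hB]
    -- If the nonnegative form vanishes at `g`, then `g` is in the kernel; as λ ≠ 0, the first
    -- equation gives f = 0 and the second g = 0.
    rcases hAre.eq_or_lt with h0 | h0
    · exfalso
      have h1 : sysOp c Mm g = 0 := sysOp_eq_zero_of_form hc hMm hpos (by
        rw [sysForm_eq_re, hA, ← h0])
      have hf0 : f = 0 := funext fun i => Subtype.ext <| by
        have h2 := hg i
        rw [h1] at h2
        exact (smul_eq_zero.mp h2.symm).resolve_left (mul_ne_zero hlam0 (hd0 i))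
      have hg0 : g = 0 := funext fun i => Subtype.ext <| by
        have h2 := hf i
        have h3 : sysOp c Mp f = 0 := by
          have := sysOp_smul (c := c) (M := Mp) 0 f
          rw [zero_smul, zero_smul] at this
          rw [hf0, this]
        rw [h3] at h2
        exact (smul_eq_zero.mp (neg_eq_zero.mp h2.symm)).resolve_left (mul_ne_zero hlam0 (hd0 i))
      rcases hfg with h | h
      exacts [h hf0, h hg0]
    · simp only [Complex.neg_re, Complex.neg_im, Complex.mul_re, Complex.mul_im, Complex.conj_re,
        Complex.conj_im] at hAim hBim h0 ⊢
      have h1 : lam.re * z.im = 0 := by linarith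
      have h2 : z.im = 0 := (mul_eq_zero.mp h1).resolve_left hlam.ne'
      rw [h2] at h0 ⊢
      linarith
  · have h1 := sysOp_symm (c := c) hMm φ g
    rw [hφ] at h1
    simp only [Pi.zero_apply, inner_zero_left, Finset.sum_const_zero, hg, inner_smul_right,
      mul_assoc] at h1
    rw [← Finset.mul_sum] at h1
    exact (mul_eq_zero.mp h1.symm).resolve_left hlam0

end SpectralStability

/-! ### Matrices of potentials quadratic in P and Q. -/

section QuadraticPotentials

variable {n : ℕ} {P Q : E n → ℝ}

/-- The potential `αP² + βPQ + γQ²`. -/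
def quadPot (α β γ : ℝ) (P Q : E n → ℝ) (x : E n) : ℝ :=
  α * P x ^ 2 + β * (P x * Q x) + γ * Q x ^ 2

theorem EssBdd.mul {a b : E n → ℝ} (ha : EssBdd a) (hb : EssBdd b) :
    EssBdd fun x => a x * b x := by
  obtain ⟨C, hC, h1⟩ := ha.exists_bound
  obtain ⟨D, hD, h2⟩ := hb.exists_bound
  refine essBdd_of_bound (ha.aestronglyMeasurable.mul hb.aestronglyMeasurable) (C * D) ?_
  filter_upwards [h1, h2] with x h3 h4
  rw [abs_mul]
  exact mul_le_mul h3 h4 (abs_nonneg _) hC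

theorem EssBdd.quadPot (hP : EssBdd P) (hQ : EssBdd Q) (α β γ : ℝ) :
    EssBdd (quadPot α β γ P Q) := by
  have h := (((hP.mul hP).const_mul (α : ℂ)).add ((hP.mul hQ).const_mul (β : ℂ))).add
    ((hQ.mul hQ).const_mul (γ : ℂ))
  refine h.ae_eq (Eventually.of_forall fun x => ?_)
  simp only [Pi.add_apply, ThirdHarmonic.quadPot]
  push_cast
  ring

theorem memLp_quadPot (hP : EssBdd P) (hQ : EssBdd Q)
    (hP2 : MemLp (fun x => (P x : ℂ)) 2 (volume : Measure (E n)))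
    (hQ2 : MemLp (fun x => (Q x : ℂ)) 2 (volume : Measure (E n))) (α β γ : ℝ) :
    MemLp (fun x => (quadPot α β γ P Q x : ℂ)) 2 (volume : Measure (E n)) := by
  have h := (((hP2.mul' hP (r := 2)).const_mul (α : ℂ)).add
    ((hQ2.mul' hP (r := 2)).const_mul (β : ℂ))).add ((hQ2.mul' hQ (r := 2)).const_mul (γ : ℂ))
  refine h.ae_eq (Eventually.of_forall fun x => ?_)
  simp only [Pi.add_apply, quadPot]
  push_cast
  ring

/-- A matrix of multiplication operators by quadratic expressions in `P`, `Q`. -/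
def quadMat (hP : EssBdd P) (hQ : EssBdd Q) (α β γ : Matrix (Fin 2) (Fin 2) ℝ) :
    Fin 2 → Fin 2 → L2 n →L[ℂ] L2 n :=
  fun i j => mulOp (quadPot (α i j) (β i j) (γ i j) P Q) (hP.quadPot hQ _ _ _)

theorem quadMat_ae (hP : EssBdd P) (hQ : EssBdd Q) (α β γ : Matrix (Fin 2) (Fin 2) ℝ)
    (i j : Fin 2) (f : L2 n) : quadMat hP hQ α β γ i j f =ᵐ[volume]
      fun x => (quadPot (α i j) (β i j) (γ i j) P Q x : ℂ) * f x := mulOp_ae _ f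

theorem quadMat_symm (hP : EssBdd P) (hQ : EssBdd Q) {α β γ : Matrix (Fin 2) (Fin 2) ℝ}
    (hα : α.IsSymm) (hβ : β.IsSymm) (hγ : γ.IsSymm) : SymmMat (quadMat hP hQ α β γ) := by
  intro i j x y
  have h1 : quadMat hP hQ α β γ j i = quadMat hP hQ α β γ i j :=
    mulOp_congr _ _ (Eventually.of_forall fun x => by rw [hα.apply i j, hβ.apply i j, hγ.apply i j])
  rw [h1]
  exact mulOp_isSymmetric _ x y

theorem quadMat_compact (hn3 : n ≤ 3) (hP : EssBdd P) (hQ : EssBdd Q)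
    (hP2 : MemLp (fun x => (P x : ℂ)) 2 (volume : Measure (E n)))
    (hQ2 : MemLp (fun x => (Q x : ℂ)) 2 (volume : Measure (E n)))
    (α β γ : Matrix (Fin 2) (Fin 2) ℝ) {κ : ℝ} (hκ : 0 < κ) (i j : Fin 2) :
    IsCompactOperator (sqrtRes κ hκ ∘L quadMat hP hQ α β γ i j) :=
  isCompactOperator_sqrtRes_mulOp hn3 _ (memLp_quadPot hP hQ hP2 hQ2 _ _ _) hκ

theorem quadMat_cooperative (hP : EssBdd P) (hQ : EssBdd Q) {α β γ : Matrix (Fin 2) (Fin 2) ℝ}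
    (h : ∀ i j, i ≠ j → ∀ x, 0 ≤ quadPot (α i j) (β i j) (γ i j) P Q x) :
    Cooperative (quadMat hP hQ α β γ) := by
  choose C hC hb using fun i : Fin 2 => (hP.quadPot hQ (α i i) (β i i) (γ i i)).exists_bound
  refine ⟨∑ i, C i, Finset.sum_nonneg fun i _ => hC i, fun i j g hg => ?_⟩
  rw [shiftMat_neg_apply]
  split_ifs with hij
  · subst hij
    filter_upwards [quadMat_ae hP hQ α β γ i i g, hb i, hg, Lp.coeFn_add
      (quadMat hP hQ α β γ i i g) (((∑ i, C i : ℝ) : ℂ) • g),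
      Lp.coeFn_smul ((∑ i, C i : ℝ) : ℂ) g] with x h1 h2 h3 h4 h5
    rw [h4, Pi.add_apply, h1, h5, Pi.smul_apply, smul_eq_mul, ← add_mul, ← Complex.ofReal_add]
    refine mul_nonneg (Complex.zero_le_real.mpr ?_) h3
    have h6 := Finset.single_le_sum (f := C) (fun i _ => hC i) (Finset.mem_univ i)
    linarith [neg_le_of_abs_le h2]
  · rw [add_zero]
    filter_upwards [quadMat_ae hP hQ α β γ i j g, hg] with x h1 h2
    rw [h1]
    exact mul_nonneg (Complex.zero_le_real.mpr (h i j hij x)) h2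

end QuadraticPotentials

/-! ### The operators 𝓛₊ and 𝓛₋ and the kernel of 𝓛₋. -/

section ThirdHarmonicSystem

variable {n : ℕ} {P Q : E n → ℝ}

/-- The constants `(ω + 1, μ + 3σω)`. -/
def waveConst (μ σ ω : ℝ) : Fin 2 → ℝ := ![ω + 1, μ + 3 * σ * ω]

theorem waveConst_pos {μ σ ω : ℝ} (hσ : 0 < σ) (hω : max (-1) (-(μ / (3 * σ))) < ω) (i : Fin 2) :
    0 < waveConst μ σ ω i := by
  obtain ⟨h1, h2⟩ := max_lt_iff.mp hω
  have h3 := (lt_div_iff₀ (by positivity)).mp (neg_lt.mp h2)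
  fin_cases i
  · change 0 < ω + 1
    linarith
  · change 0 < μ + 3 * σ * ω
    linarith

/-- The potentials of `𝓛₊`. -/
def plusMat (hP : EssBdd P) (hQ : EssBdd Q) : Fin 2 → Fin 2 → L2 n →L[ℂ] L2 n :=
  quadMat hP hQ !![1 / 3, 1 / 3; 1 / 3, 2] !![2 / 3, 4; 4, 0] !![2, 0; 0, 27]

/-- The potentials of `𝓛₋`. -/
def minusMat (hP : EssBdd P) (hQ : EssBdd Q) : Fin 2 → Fin 2 → L2 n →L[ℂ] L2 n :=
  quadMat hP hQ !![1 / 9, 1 / 3; 1 / 3, 2] !![-2 / 3, 0; 0, 0] !![2, 0; 0, 9]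

theorem isSymm_fin_two (a b d : ℝ) : (!![a, b; b, d]).IsSymm :=
  Matrix.IsSymm.ext fun i j => by fin_cases i <;> fin_cases j <;> rfl

theorem plusMat_symm (hP : EssBdd P) (hQ : EssBdd Q) : SymmMat (plusMat hP hQ) :=
  quadMat_symm hP hQ (isSymm_fin_two _ _ _) (isSymm_fin_two _ _ _) (isSymm_fin_two _ _ _)

theorem minusMat_symm (hP : EssBdd P) (hQ : EssBdd Q) : SymmMat (minusMat hP hQ) :=
  quadMat_symm hP hQ (isSymm_fin_two _ _ _) (isSymm_fin_two _ _ _) (isSymm_fin_two _ _ _)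

/-- The only coupling potential is P² / 3, nonnegative whatever the signs of P and Q. -/
theorem minusMat_cooperative (hP : EssBdd P) (hQ : EssBdd Q) : Cooperative (minusMat hP hQ) :=
  quadMat_cooperative hP hQ fun i j hij x => by
    fin_cases i <;> fin_cases j <;> simp at hij <;> simp [quadPot] <;> positivity

theorem sysOp_ae {c : Fin 2 → ℝ} {M : Fin 2 → Fin 2 → L2 n →L[ℂ] L2 n} (h : Fin 2 → H2 n)
    (i : Fin 2) : sysOp c M h i =ᵐ[volume] fun x =>
      (c i : ℂ) * (h i : L2 n) x - lap (h i) x - (M i 0 (h 0) x + M i 1 (h 1) x) := by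
  rw [sysOp, Fin.sum_univ_two]
  filter_upwards [Lp.coeFn_sub ((c i : ℂ) • (h i : L2 n) - lap (h i)) (M i 0 (h 0) + M i 1 (h 1)),
    Lp.coeFn_sub ((c i : ℂ) • (h i : L2 n)) (lap (h i)), Lp.coeFn_smul (c i : ℂ) (h i : L2 n),
    Lp.coeFn_add (M i 0 (h 0)) (M i 1 (h 1))] with x h1 h2 h3 h4
  rw [h1, Pi.sub_apply, h2, Pi.sub_apply, h3, h4]
  rfl

theorem Lplus_ae (hP : EssBdd P) (hQ : EssBdd Q) (μ σ ω : ℝ) (h : Fin 2 → H2 n) (i : Fin 2) :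
    Lplus μ σ ω P Q h i =ᵐ[volume] sysOp (waveConst μ σ ω) (plusMat hP hQ) h i := by
  fin_cases i
  · filter_upwards [sysOp_ae (c := waveConst μ σ ω) (M := plusMat hP hQ) h 0,
      quadMat_ae hP hQ _ _ _ 0 0 (h 0 : L2 n), quadMat_ae hP hQ _ _ _ 0 1 (h 1 : L2 n)]
      with x h1 h2 h3
    refine Eq.trans ?_ h1.symm
    rw [plusMat, h2, h3]
    simp [Lplus, schrodinger, quadPot, waveConst]
    ring
  · filter_upwards [sysOp_ae (c := waveConst μ σ ω) (M := plusMat hP hQ) h 1,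
      quadMat_ae hP hQ _ _ _ 1 0 (h 0 : L2 n), quadMat_ae hP hQ _ _ _ 1 1 (h 1 : L2 n)]
      with x h1 h2 h3
    refine Eq.trans ?_ h1.symm
    rw [plusMat, h2, h3]
    simp [Lplus, schrodinger, quadPot, waveConst]
    ring

theorem Lminus_ae (hP : EssBdd P) (hQ : EssBdd Q) (μ σ ω : ℝ) (h : Fin 2 → H2 n) (i : Fin 2) :
    Lminus μ σ ω P Q h i =ᵐ[volume] sysOp (waveConst μ σ ω) (minusMat hP hQ) h i := by
  fin_cases i
  · filter_upwards [sysOp_ae (c := waveConst μ σ ω) (M := minusMat hP hQ) h 0,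
      quadMat_ae hP hQ _ _ _ 0 0 (h 0 : L2 n), quadMat_ae hP hQ _ _ _ 0 1 (h 1 : L2 n)]
      with x h1 h2 h3
    refine Eq.trans ?_ h1.symm
    rw [minusMat, h2, h3]
    simp [Lminus, schrodinger, quadPot, waveConst]
    ring
  · filter_upwards [sysOp_ae (c := waveConst μ σ ω) (M := minusMat hP hQ) h 1,
      quadMat_ae hP hQ _ _ _ 1 0 (h 0 : L2 n), quadMat_ae hP hQ _ _ _ 1 1 (h 1 : L2 n)]
      with x h1 h2 h3
    refine Eq.trans ?_ h1.symm
    rw [minusMat, h2, h3]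
    simp [Lminus, schrodinger, quadPot, waveConst]
    ring

theorem pairing_eq_sum_inner {F : Fin 2 → E n → ℂ} {u : Fin 2 → L2 n} (hF : ∀ i, F i =ᵐ[volume] u i)
    (h : Fin 2 → H2 n) : pairing F (toFun2 h) = ∑ i, ⟪(h i : L2 n), u i⟫_ℂ := by
  refine Finset.sum_congr rfl fun i _ => ?_
  rw [inner_L2]
  refine integral_congr_ae ?_
  filter_upwards [hF i] with x hx
  rw [hx]
  rfl

theorem formPlus_eq (hP : EssBdd P) (hQ : EssBdd Q) (μ σ ω : ℝ) (h : Fin 2 → H2 n) :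
    formPlus μ σ ω P Q h = sysForm (waveConst μ σ ω) (plusMat hP hQ) h := by
  rw [formPlus, pairing_eq_sum_inner (Lplus_ae hP hQ μ σ ω h), sysForm_eq_re]

theorem formMinus_eq (hP : EssBdd P) (hQ : EssBdd Q) (μ σ ω : ℝ) (h : Fin 2 → H2 n) :
    formMinus μ σ ω P Q h = sysForm (waveConst μ σ ω) (minusMat hP hQ) h := by
  rw [formMinus, pairing_eq_sum_inner (Lminus_ae hP hQ μ σ ω h), sysForm_eq_re]

/-- The weights `(1, σ)`. -/
def waveWeight (σ : ℝ) : Fin 2 → ℝ := ![1, σ]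

theorem waveWeight_pos {σ : ℝ} (hσ : 0 < σ) (i : Fin 2) : 0 < waveWeight σ i := by
  fin_cases i
  exacts [one_pos, hσ]

theorem eq_smul_iff_ae (f g : L2 n) (a : ℂ) : f = a • g ↔ ∀ᵐ x, f x = a * g x := by
  rw [Lp.ext_iff]
  exact eventually_congr ((Lp.coeFn_smul a g).mono fun x hx => by
    rw [hx, Pi.smul_apply, smul_eq_mul])

/-- Moving the factors 1/σ of 𝓙 to the other side splits the problem into 𝓛₋ g = λ D f and 𝓛₊ f = -λ
D g with D = diag(1, σ). -/
theorem isEigenSolution_iff (hP : EssBdd P) (hQ : EssBdd Q) (μ : ℝ) {σ : ℝ} (hσ : 0 < σ) (ω : ℝ)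
    (lam : ℂ) (v : Fin 4 → H2 n) : IsEigenSolution μ σ ω P Q lam v ↔
      (∀ i, sysOp (waveConst μ σ ω) (minusMat hP hQ) ![v 2, v 3] i =
        (lam * waveWeight σ i) • ((![v 0, v 1] : Fin 2 → H2 n) i : L2 n)) ∧
      ∀ i, sysOp (waveConst μ σ ω) (plusMat hP hQ) ![v 0, v 1] i =
        -((lam * waveWeight σ i) • ((![v 2, v 3] : Fin 2 → H2 n) i : L2 n)) := by
  have hσ0 : (σ : ℂ) ≠ 0 := Complex.ofReal_ne_zero.mpr hσ.ne'
  set fm := sysOp (waveConst μ σ ω) (minusMat hP hQ) ![v 2, v 3] with hfm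
  set fp := sysOp (waveConst μ σ ω) (plusMat hP hQ) ![v 0, v 1] with hfp
  have key : ∀ᵐ x, ((J σ *ᵥ fun j => calL μ σ ω P Q v j x) = fun j => lam * (v j : L2 n) x) ↔
      (fm 0 x = lam * (v 0 : L2 n) x ∧ fm 1 x = lam * σ * (v 1 : L2 n) x) ∧
        (fp 0 x = -(lam * (v 2 : L2 n) x) ∧ fp 1 x = -(lam * σ * (v 3 : L2 n) x)) := by
    filter_upwards [Lplus_ae hP hQ μ σ ω ![v 0, v 1] 0, Lplus_ae hP hQ μ σ ω ![v 0, v 1] 1,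
      Lminus_ae hP hQ μ σ ω ![v 2, v 3] 0, Lminus_ae hP hQ μ σ ω ![v 2, v 3] 1] with x h1 h2 h3 h4
    have e : (fun j => calL μ σ ω P Q v j x) = ![fp 0 x, fp 1 x, fm 0 x, fm 1 x] := by
      funext j
      fin_cases j
      exacts [h1, h2, h3, h4]
    rw [e, funext_iff, Fin.forall_fin_succ, Fin.forall_fin_succ, Fin.forall_fin_two]
    have e1 : ∀ a b : ℂ, (σ : ℂ)⁻¹ * a = lam * b ↔ a = lam * σ * b := fun a b => by
      rw [inv_mul_eq_iff_eq_mul₀ hσ0, mul_left_comm, mul_assoc]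
    have e2 : ∀ a b : ℂ, -((σ : ℂ)⁻¹ * a) = lam * b ↔ a = -(lam * σ * b) := fun a b => by
      rw [← mul_neg, e1, neg_eq_iff_eq_neg]
    have e3 : ∀ a b : ℂ, -a = lam * b ↔ a = -(lam * b) := fun a b => neg_eq_iff_eq_neg
    simp [J, Matrix.mulVec, dotProduct, Fin.sum_univ_four, e1, e2, e3, and_assoc]
  rw [IsEigenSolution, eventually_congr key, eventually_and, eventually_and, eventually_and,
    Fin.forall_fin_two, Fin.forall_fin_two]
  simp only [← neg_smul, eq_smul_iff_ae]
  simp [waveWeight]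

/-- The pair `(P, 3Q)` in `H² × H²`. -/
def wavePair (p q : H2 n) : Fin 2 → H2 n := ![p, (3 : ℂ) • q]

section Wave

variable {μ σ ω : ℝ} {p q : H2 n}

/-- The pair generates the gauge rotation (e^{iθ} u, e^{3iθ} v). Substituting the stationary
equations for the Laplacians makes both rows cancel. -/
theorem sysOp_wavePair (hP : EssBdd P) (hQ : EssBdd Q)
    (hp : (p : L2 n) =ᵐ[volume] fun x => (P x : ℂ)) (hq : (q : L2 n) =ᵐ[volume] fun x => (Q x : ℂ))
    (hlp : lap p =ᵐ[volume] fun x => (((ω + 1) * P x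
      - (1 / 9 * P x ^ 3 + 2 * Q x ^ 2 * P x + 1 / 3 * P x ^ 2 * Q x) : ℝ) : ℂ))
    (hlq : lap q =ᵐ[volume] fun x => (((μ + 3 * σ * ω) * Q x
      - (9 * Q x ^ 3 + 2 * P x ^ 2 * Q x + 1 / 9 * P x ^ 3) : ℝ) : ℂ)) :
    sysOp (waveConst μ σ ω) (minusMat hP hQ) (wavePair p q) = 0 := by
  have h3 : ((wavePair p q 1 : H2 n) : L2 n) =ᵐ[volume] fun x => 3 * (Q x : ℂ) := by
    filter_upwards [Lp.coeFn_smul (3 : ℂ) (q : L2 n), hq] with x h1 h2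
    refine Eq.trans h1 ?_
    rw [Pi.smul_apply, h2, smul_eq_mul]
  have h4 : lap (wavePair p q 1) =ᵐ[volume] fun x => 3 * lap q x := by
    change lap ((3 : ℂ) • q) =ᵐ[volume] _
    rw [lap_smul]
    exact Lp.coeFn_smul (3 : ℂ) (lap q)
  have hp' : ((wavePair p q 0 : H2 n) : L2 n) =ᵐ[volume] fun x => (P x : ℂ) := hp
  have hlp' : lap (wavePair p q 0) =ᵐ[volume] lap p := Eventually.of_forall fun _ => rfl
  have key : ∀ i, sysOp (waveConst μ σ ω) (minusMat hP hQ) (wavePair p q) i = 0 := fun i => by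
    refine Lp.ext ?_
    filter_upwards [Lp.coeFn_zero ℂ 2 (volume : Measure (E n)),
      sysOp_ae (c := waveConst μ σ ω) (M := minusMat hP hQ) (wavePair p q) i,
      quadMat_ae hP hQ !![1 / 9, 1 / 3; 1 / 3, 2] !![-2 / 3, 0; 0, 0] !![2, 0; 0, 9] i 0
        (wavePair p q 0 : L2 n),
      quadMat_ae hP hQ !![1 / 9, 1 / 3; 1 / 3, 2] !![-2 / 3, 0; 0, 0] !![2, 0; 0, 9] i 1
        (wavePair p q 1 : L2 n), hp', h3, hlp', hlp, h4, hlq] with x e0 e1 e2 e3 e4 e5 e6 e7 e8 e9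
    rw [e0, e1, minusMat, e2, e3]
    fin_cases i
    · simp [e4, e5, e6, e7, waveConst, quadPot]
      ring
    · simp [e4, e5, e8, e9, waveConst, quadPot]
      ring
  exact funext key

theorem pairing_wave_eq (hp : (p : L2 n) =ᵐ[volume] fun x => (P x : ℂ))
    (hq : (q : L2 n) =ᵐ[volume] fun x => (Q x : ℂ)) (h : Fin 2 → H2 n) :
    pairing (toFun2 h) ![fun x => (P x : ℂ), fun x => ((3 * σ * Q x : ℝ) : ℂ)]
      = ∑ i, (waveWeight σ i : ℂ) * ⟪(wavePair p q i : L2 n), (h i : L2 n)⟫_ℂ := by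
  refine Finset.sum_congr rfl fun i _ => ?_
  rw [inner_L2, ← integral_const_mul]
  refine integral_congr_ae ?_
  fin_cases i
  · filter_upwards [hp] with x hx
    simp [toFun2, waveWeight, wavePair, hx]
  · filter_upwards [hq, Lp.coeFn_smul (3 : ℂ) (q : L2 n)] with x hx h3
    have h4 : ((wavePair p q 1 : H2 n) : L2 n) x = 3 * (Q x : ℂ) := by
      refine Eq.trans h3 ?_
      rw [Pi.smul_apply, hx, smul_eq_mul]
    simp [toFun2, waveWeight, h4]
    ring

theorem realL_wavePair (hp : (p : L2 n) =ᵐ[volume] fun x => (P x : ℂ))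
    (hq : (q : L2 n) =ᵐ[volume] fun x => (Q x : ℂ)) (i : Fin 2) :
    RealL (wavePair p q i : L2 n) := by
  have hp' : RealL (p : L2 n) := hp.mono fun x hx => by rw [hx, Complex.ofReal_im]
  have hq' : RealL (q : L2 n) := hq.mono fun x hx => by rw [hx, Complex.ofReal_im]
  fin_cases i
  · exact hp'
  · have h := hq'.smul 3
    simpa [wavePair] using h

theorem posL_wavePair (hp : (p : L2 n) =ᵐ[volume] fun x => (P x : ℂ))
    (hq : (q : L2 n) =ᵐ[volume] fun x => (Q x : ℂ)) (h : ∀ᵐ x, 0 < P x ∧ 0 < Q x) (i : Fin 2) :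
    PosL (wavePair p q i : L2 n) := by
  fin_cases i
  · filter_upwards [hp, h] with x h1 h2
    refine lt_of_lt_of_eq ?_ h1.symm
    exact Complex.zero_lt_real.mpr h2.1
  · filter_upwards [hq, h, Lp.coeFn_smul (3 : ℂ) (q : L2 n)] with x h1 h2 h3
    refine lt_of_lt_of_eq ?_ h3.symm
    rw [Pi.smul_apply, h1, smul_eq_mul]
    exact mul_pos (by norm_num) (Complex.zero_lt_real.mpr h2.2)

/-- If `P ≠ 0` then the kernel of `𝓛₋` is spanned by `(P, 3Q)`. -/
theorem ker_minus_eq_span (hc : ∀ i, 0 < waveConst μ σ ω i) (hP : EssBdd P) (hQ : EssBdd Q)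
    (hp : (p : L2 n) =ᵐ[volume] fun x => (P x : ℂ)) (hq : (q : L2 n) =ᵐ[volume] fun x => (Q x : ℂ))
    (hker : sysOp (waveConst μ σ ω) (minusMat hP hQ) (wavePair p q) = 0)
    (hpos : ∀ h, 0 ≤ sysForm (waveConst μ σ ω) (minusMat hP hQ) h) (hp0 : (p : L2 n) ≠ 0)
    {ψ : Fin 2 → H2 n} (hψ : sysOp (waveConst μ σ ω) (minusMat hP hQ) ψ = 0) :
    ∃ a : ℂ, ψ = a • wavePair p q := by
  have hcoop := minusMat_cooperative hP hQ
  obtain ⟨a, ha⟩ := hcoop.exists_eq_smul hc hpos hker (realL_wavePair hp hq) hψ (i := 0) hp0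
  refine ⟨a, ?_⟩
  set k : Fin 2 → H2 n := ψ + (-a) • wavePair p q with hk
  have hk0 : k 0 = 0 := Subtype.ext (by
    rw [hk, Pi.add_apply, Submodule.coe_add, ha, Pi.smul_apply, Submodule.coe_smul, neg_smul,
      add_neg_cancel]
    rfl)
  have hkker : sysOp (waveConst μ σ ω) (minusMat hP hQ) k = 0 := by
    rw [hk, sysOp_add, sysOp_smul, hψ, hker, smul_zero, add_zero]
  have hlap0 : lap (0 : H2 n) = 0 := by
    rw [← zero_smul ℂ (0 : H2 n), lap_smul, zero_smul]
  -- As `k 0 = 0`, the first row of the kernel equation reduces to P² k₁ = 0. The sign alternative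
  -- for P shows that P vanishes almost nowhere, hence `k 1 = 0`.
  have h1 : minusMat hP hQ 0 1 (k 1) = 0 := by
    have h2 := congrFun hkker 0
    rw [sysOp, Fin.sum_univ_two, hk0, hlap0] at h2
    simpa using h2
  have hsign := (hcoop.sign hc hpos hker (realL_wavePair hp hq) 0).resolve_left hp0
  have hPne : ∀ᵐ x, P x ≠ 0 := by
    rcases hsign with hs | hs
    · filter_upwards [hs, hp] with x h1 h2 h3
      change 0 < (p : L2 n) x at h1
      rw [h2, h3, Complex.ofReal_zero] at h1
      exact lt_irrefl _ h1
    · filter_upwards [hs, hp, Lp.coeFn_neg (p : L2 n)] with x h1 h2 h4 h3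
      change 0 < (-(p : L2 n) : L2 n) x at h1
      rw [h4, Pi.neg_apply, h2, h3, Complex.ofReal_zero, neg_zero] at h1
      exact lt_irrefl _ h1
  have hk1 : k 1 = 0 := Subtype.ext (Lp.ext (by
    have h2 := quadMat_ae hP hQ !![1 / 9, 1 / 3; 1 / 3, 2] !![-2 / 3, 0; 0, 0] !![2, 0; 0, 9] 0 1
      (k 1 : L2 n)
    change minusMat hP hQ 0 1 (k 1) =ᵐ[volume] _ at h2
    rw [h1] at h2
    filter_upwards [h2, hPne, Lp.coeFn_zero ℂ 2 (volume : Measure (E n))] with x h3 h4 h5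
    rw [h5] at h3
    refine Eq.trans ?_ h5.symm
    simpa [quadPot, h4] using h3.symm))
  have hk00 : k = 0 := by
    ext1 i
    fin_cases i
    exacts [hk0, hk1]
  rw [hk, neg_smul, ← sub_eq_add_neg, sub_eq_zero] at hk00
  exact hk00

theorem sysForm_fin_two {c : Fin 2 → ℝ} {M : Fin 2 → Fin 2 → L2 n →L[ℂ] L2 n} (h : Fin 2 → H2 n) :
    sysForm c M h = (⟪(c 0 : ℂ) • (h 0 : L2 n) - lap (h 0) - (M 0 0 (h 0) + M 0 1 (h 1)),
        (h 0 : L2 n)⟫_ℂ).re + (⟪(c 1 : ℂ) • (h 1 : L2 n) - lap (h 1) -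
          (M 1 0 (h 0) + M 1 1 (h 1)), (h 1 : L2 n)⟫_ℂ).re := by
  rw [sysForm, Fin.sum_univ_two, Complex.add_re, sysOp, sysOp, Fin.sum_univ_two, Fin.sum_univ_two]

/-- A negative direction of `𝓛₊` orthogonal to `(P, 3σQ)` can be chosen orthogonal to the whole
kernel of `𝓛₋`, with the weights `(1, σ)`. -/
theorem exists_neg_perp_kernel (hc : ∀ i, 0 < waveConst μ σ ω i) (hP : EssBdd P) (hQ : EssBdd Q)
    (hp : (p : L2 n) =ᵐ[volume] fun x => (P x : ℂ)) (hq : (q : L2 n) =ᵐ[volume] fun x => (Q x : ℂ))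
    (hker : sysOp (waveConst μ σ ω) (minusMat hP hQ) (wavePair p q) = 0)
    (hpos : ∀ h, 0 ≤ sysForm (waveConst μ σ ω) (minusMat hP hQ) h) {h : Fin 2 → H2 n}
    (hperp : ∑ i, (waveWeight σ i : ℂ) * ⟪(wavePair p q i : L2 n), (h i : L2 n)⟫_ℂ = 0)
    (hneg : sysForm (waveConst μ σ ω) (plusMat hP hQ) h < 0) :
    ∃ k : Fin 2 → H2 n, sysForm (waveConst μ σ ω) (plusMat hP hQ) k < 0 ∧
      ∀ ψ, sysOp (waveConst μ σ ω) (minusMat hP hQ) ψ = 0 →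
        ∑ i, (waveWeight σ i : ℂ) * ⟪(ψ i : L2 n), (k i : L2 n)⟫_ℂ = 0 := by
  -- For P ≠ 0 the kernel is a line and `h` itself works. For P = 0 the system decouples and 𝓛₋ may
  -- have a further kernel in the first component, so the first component of `h` is discarded.
  by_cases hp0 : (p : L2 n) = 0
  swap
  · refine ⟨h, hneg, fun ψ hψ => ?_⟩
    obtain ⟨a, rfl⟩ := ker_minus_eq_span hc hP hQ hp hq hker hpos hp0 hψ
    rw [← mul_zero (conj a), ← hperp, Finset.mul_sum]
    refine Finset.sum_congr rfl fun i _ => ?_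
    rw [Pi.smul_apply, Submodule.coe_smul, inner_smul_left]
    ring
  have hP0 : ∀ᵐ x, P x = 0 := by
    rw [hp0] at hp
    filter_upwards [hp, Lp.coeFn_zero ℂ 2 (volume : Measure (E n))] with x h1 h2
    rw [h2] at h1
    exact (Complex.ofReal_eq_zero.mp h1.symm)
  have hzero : ∀ (α β : ℝ) (hb : EssBdd (quadPot α β 0 P Q)) (f : L2 n),
      mulOp (quadPot α β 0 P Q) hb f = 0 := fun α β hb f => Lp.ext (by
    filter_upwards [mulOp_ae hb f, hP0, Lp.coeFn_zero ℂ 2 (volume : Measure (E n))] with x h1 h2 h3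
    rw [h1, h3, quadPot, h2]
    simp)
  have hp01 : ∀ f, plusMat hP hQ 0 1 f = 0 := fun f => hzero _ _ _ f
  have hp10 : ∀ f, plusMat hP hQ 1 0 f = 0 := fun f => hzero _ _ _ f
  have hm01 : ∀ f, minusMat hP hQ 0 1 f = 0 := fun f => hzero _ _ _ f
  have hm10 : ∀ f, minusMat hP hQ 1 0 f = 0 := fun f => hzero _ _ _ f
  -- For P = 0 the first diagonal entries of 𝓛₊ and 𝓛₋ coincide, so `h 0` contributes a nonnegative
  -- amount and the negativity comes from `h 1`.
  have h00 : plusMat hP hQ 0 0 = minusMat hP hQ 0 0 := mulOp_congr _ _ (by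
    filter_upwards [hP0] with x hx
    simp [quadPot, hx])
  have hlap0 : lap (0 : H2 n) = 0 := by
    rw [← zero_smul ℂ (0 : H2 n), lap_smul, zero_smul]
  have h1 := hpos ![h 0, 0]
  rw [sysForm_fin_two] at h1 hneg
  simp only [hp01, hp10, h00] at hneg
  simp [hm01] at h1
  simp only [add_zero, zero_add] at hneg
  have hneg1 : sysForm (waveConst μ σ ω) (plusMat hP hQ) ![0, h 1] < 0 := by
    rw [sysForm_fin_two]
    simp [hp10]
    simp at hneg
    linarith
  refine ⟨![0, h 1], hneg1, fun ψ hψ => ?_⟩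
  -- If Q also vanished, 𝓛₊ and 𝓛₋ would agree and no negative direction could exist. Since Q ≠ 0,
  -- second components of kernel elements of 𝓛₋ are multiples of Q.
  have hwq : (wavePair p q 1 : L2 n) ≠ 0 := by
    intro hw
    have hq0 : (q : L2 n) = 0 := by
      have h2 : (3 : ℂ) • (q : L2 n) = 0 := hw
      exact (smul_eq_zero.mp h2).resolve_left (by norm_num)
    have hQ0 : ∀ᵐ x, Q x = 0 := by
      rw [hq0] at hq
      filter_upwards [hq, Lp.coeFn_zero ℂ 2 (volume : Measure (E n))] with x h1 h2
      rw [h2] at h1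
      exact (Complex.ofReal_eq_zero.mp h1.symm)
    have h11 : plusMat hP hQ 1 1 = minusMat hP hQ 1 1 := mulOp_congr _ _ (by
      filter_upwards [hP0, hQ0] with x hx hx'
      simp [quadPot, hx, hx'])
    have h3 := hpos ![0, h 1]
    rw [sysForm_fin_two] at h3 hneg1
    simp only [hp01, hp10, h00, h11] at hneg1
    simp only [hm01, hm10] at h3
    exact absurd hneg1 (not_lt.mpr h3)
  obtain ⟨a, ha⟩ := (minusMat_cooperative hP hQ).exists_eq_smul hc hpos hker
    (realL_wavePair hp hq) hψ hwq
  have hw0 : (wavePair p q 0 : L2 n) = 0 := hp0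
  rw [Fin.sum_univ_two, hw0, inner_zero_left, mul_zero, zero_add] at hperp
  rw [Fin.sum_univ_two, ha, inner_smul_left]
  have h4 : (((![0, h 1] : Fin 2 → H2 n) 0 : H2 n) : L2 n) = 0 := rfl
  have h5 : (![0, h 1] : Fin 2 → H2 n) 1 = h 1 := rfl
  rw [h4, h5, inner_zero_right, mul_zero, zero_add, mul_left_comm, hperp, mul_zero]

end Wave

end ThirdHarmonicSystem

end

end ThirdHarmonic
-- The stability criterion.
theorem proposition5 {n : ℕ} (hn1 : 1 ≤ n) (hn3 : n ≤ 3)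
    (μ σ ω : ℝ) (hμ : 0 < μ) (hσ : 0 < σ) (hω : max (-1) (-(μ / (3 * σ))) < ω)
    (P Q : ThirdHarmonic.E n → ℝ)
    (hP : ThirdHarmonic.MemH1 P) (hQ : ThirdHarmonic.MemH1 Q)
    (hsol : ThirdHarmonic.SolvesStationary μ σ ω P Q)
    (hwave : (∀ᵐ x, 0 < P x ∧ 0 < Q x) ∨
      ∀ h : Fin 2 → ThirdHarmonic.H2 n, 0 ≤ ThirdHarmonic.formMinus μ σ ω P Q h) :
    (¬ ThirdHarmonic.SpectrallyStable μ σ ω P Q ↔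
      ∃ h : Fin 2 → ThirdHarmonic.H2 n,
        ThirdHarmonic.PerpWave σ P Q h ∧ ThirdHarmonic.formPlus μ σ ω P Q h < 0) ∧
    (ThirdHarmonic.SpectrallyStable μ σ ω P Q ↔
      ∀ h : Fin 2 → ThirdHarmonic.H2 n,
        ThirdHarmonic.PerpWave σ P Q h → 0 ≤ ThirdHarmonic.formPlus μ σ ω P Q h) := by
  have hc := ThirdHarmonic.waveConst_pos (μ := μ) hσ hω
  have hd := ThirdHarmonic.waveWeight_pos hσ
  obtain ⟨hPb, hQb, p, q, hp, hq, hlp, hlq⟩ := hsol.regularity hn1 hn3 hP hQ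
  have hker := ThirdHarmonic.sysOp_wavePair hPb hQb hp hq hlp hlq
  have hMp := ThirdHarmonic.plusMat_symm hPb hQb
  have hMm := ThirdHarmonic.minusMat_symm hPb hQb
  have hMpc := fun i j => ThirdHarmonic.quadMat_compact hn3 hPb hQb hP.choose hQ.choose
    !![1 / 3, 1 / 3; 1 / 3, 2] !![2 / 3, 4; 4, 0] !![2, 0; 0, 27] (hc i) i j
  have hMmc := fun i j => ThirdHarmonic.quadMat_compact hn3 hPb hQb hP.choose hQ.choose
    !![1 / 9, 1 / 3; 1 / 3, 2] !![-2 / 3, 0; 0, 0] !![2, 0; 0, 9] (hc i) i j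
  -- The two alternatives in `hwave` enter only through the nonnegativity of 𝓛₋.
  have hpos : ∀ h, 0 ≤ ThirdHarmonic.sysForm (ThirdHarmonic.waveConst μ σ ω)
      (ThirdHarmonic.minusMat hPb hQb) h := by
    rcases hwave with hw | hw
    · exact (ThirdHarmonic.minusMat_cooperative hPb hQb).nonneg_of_pos_kernel hc hMm hMmc hker
        (ThirdHarmonic.posL_wavePair hp hq hw)
    · exact fun h => (hw h).trans_eq (ThirdHarmonic.formMinus_eq hPb hQb μ σ ω h)
  have main : ¬ ThirdHarmonic.SpectrallyStable μ σ ω P Q ↔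
      ∃ h : Fin 2 → ThirdHarmonic.H2 n,
        ThirdHarmonic.PerpWave σ P Q h ∧ ThirdHarmonic.formPlus μ σ ω P Q h < 0 := by
    rw [ThirdHarmonic.SpectrallyStable, not_not]
    constructor
    · rintro ⟨lam, v, hlam, hv, hev⟩
      obtain ⟨hg, hf⟩ := (ThirdHarmonic.isEigenSolution_iff hPb hQb μ hσ ω lam v).mp hev
      have hfg : ![v 0, v 1] ≠ 0 ∨ ![v 2, v 3] ≠ 0 := by
        by_contra! h
        refine hv (funext fun i => ?_)
        fin_cases i
        exacts [congrFun h.1 0, congrFun h.1 1, congrFun h.2 0, congrFun h.2 1]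
      obtain ⟨h1, h2⟩ := ThirdHarmonic.form_neg_of_unstable_mode hc hd hMp hMm hpos hker hlam hfg
        hg hf
      exact ⟨![v 0, v 1], (ThirdHarmonic.pairing_wave_eq hp hq _).trans h2,
        (ThirdHarmonic.formPlus_eq hPb hQb μ σ ω _).trans_lt h1⟩
    · rintro ⟨h, hperp, hneg⟩
      rw [ThirdHarmonic.formPlus_eq hPb hQb] at hneg
      rw [ThirdHarmonic.PerpWave, ThirdHarmonic.pairing_wave_eq hp hq] at hperp
      obtain ⟨k, hk, hkperp⟩ := ThirdHarmonic.exists_neg_perp_kernel hc hPb hQb hp hq hker hpos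
        hperp hneg
      obtain ⟨lam, f, g, hlam, hf0, hg, hf⟩ := ThirdHarmonic.exists_unstable_mode hc hd hMp hMm
        hMpc hMmc hpos hk hkperp
      refine ⟨lam, ![f 0, f 1, g 0, g 1], by simpa using hlam, fun h0 => hf0 ?_,
        (ThirdHarmonic.isEigenSolution_iff hPb hQb μ hσ ω _ _).mpr ?_⟩
      · funext i
        fin_cases i
        exacts [congrFun h0 0, congrFun h0 1]
      · have ef : (![f 0, f 1] : Fin 2 → ThirdHarmonic.H2 n) = f := by
          funext i; fin_cases i <;> rfl
        have eg : (![g 0, g 1] : Fin 2 → ThirdHarmonic.H2 n) = g := by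
          funext i; fin_cases i <;> rfl
        change (∀ i, ThirdHarmonic.sysOp _ _ ![g 0, g 1] i = _ • ((![f 0, f 1] :
            Fin 2 → ThirdHarmonic.H2 n) i : ThirdHarmonic.L2 n)) ∧
          ∀ i, ThirdHarmonic.sysOp _ _ ![f 0, f 1] i = -(_ • ((![g 0, g 1] :
            Fin 2 → ThirdHarmonic.H2 n) i : ThirdHarmonic.L2 n))
        rw [ef, eg]
        exact ⟨fun i => by rw [hg, Complex.ofReal_mul], fun i => by rw [hf, Complex.ofReal_mul]⟩
  refine ⟨main, ?_⟩
  rw [← not_iff_not, main]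
  push Not
  rfl
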